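/- Let $0\le\mu\le 1$ and $-1<\gamma<1$, and let $(\xi_1,\xi_2)$ be a random vector in $\mathbb C^2$ that belongs to the $(\mu,\gamma)$-family, i.e. $\xi_1,\xi_2$ have mean zero and variance one, $\mathbb E[(\Re\xi_i)^2]=\mu$ and $\mathbb E[(\Im\xi_i)^2]=1-\mu$ for $i=1,2$, $\mathbb E[\Re\xi_1\Re\xi_2]=\mu\gamma$, $\mathbb E[\Im\xi_1\Im\xi_2]=-(1-\mu)\gamma$, and $\mathbb E[\Re\xi_i\,\Im\xi_j]=0$ for all $i,j\in\{1,2\}$. For each $n$ let $X=X_n$ be an $n\times n$ complex random matrix such that $\{X_{ii}:1\le i\le n\}\cup\{(X_{ij},X_{ji}):1\le i<j\le n\}$ is a collection of independent random elements and every pair $(X_{ij},X_{ji})$ with $i<j$ is distributed as $(\xi_1,\xi_2)$ (nothing else is assumed about the diagonal entries). Let $D$ be the diagonal matrix with $D_{ii}=\sum_{k=1}^nX_{ik}$, let $M=(X-D)/\sqrt n$, and let $B$ be the $n\times n$ matrix of $2\times2$ blocks $B_{ij}=\begin{bmatrix}0&M_{ij}\\ \overline{M_{ji}}&0\end{bmatrix}$.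 Fix $z\in\mathbb C$ and $\eta\in\mathbb C$ with $\Im\eta>0$, and put $$q=q(z,\eta)=\begin{bmatrix}\eta&z\\ \bar z&\eta\end{bmatrix},\qquad R(q)=(B-1_n\otimes q)^{-1},\qquad \Gamma_n(q)=\frac1n\sum_{k=1}^nR(q)_{kk},$$ where $R(q)_{kk}$ is the $k$-th diagonal $2\times2$ block of $R(q)$. (i) For every $n$, the matrix $B-1_n\otimes q$ is invertible for every outcome, and $\Gamma_n(q)=\begin{bmatrix}a&b\\ c&a\end{bmatrix}$ for some random $a,b,c$ (depending on $n$ and $q$), which are integrable. If $\eta\in i\mathbb R$, then $c=\bar b$. (ii) Every accumulation point of the sequence $\mathbb E[\Gamma_n(q)]$ as $n\to\infty$ has the form $\begin{bmatrix}\alpha&\beta\\ \delta&\alpha\end{bmatrix}$, with $\delta=\bar\beta$ if $\eta\in i\mathbb R$, and solves the fixed point equation $$\begin{bmatrix}\alpha&\beta\\ \delta&\alpha\end{bmatrix}=-\,\mathbb E\left(q+\begin{bmatrix}\alpha&\gamma\delta\\ \gamma\beta&\alpha\end{bmatrix}-\begin{bmatrix}0&G\\ \overline G&0\end{bmatrix}\right)^{-1},$$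 where $G$ is a Gaussian random variable on $\mathbb C$ with law $\mathcal N(0,K_\mu)$, i.e. $(\Re G,\Im G)$ is a centered Gaussian vector with covariance matrix $K_\mu=\begin{bmatrix}\mu&0\\0&1-\mu\end{bmatrix}$; here the matrix in parentheses is invertible for every value of $G$ in $\mathbb C$, and its inverse has integrable entries. In particular, for $\eta\in i\mathbb R$, $\Im\eta>0$, every accumulation point of $\mathbb E\begin{bmatrix}a&b\\ \bar b&a\end{bmatrix}$ solves $$\begin{bmatrix}\alpha&\beta\\ \bar\beta&\alpha\end{bmatrix}=-\,\mathbb E\left(q+\begin{bmatrix}\alpha&\gamma\bar\beta\\ \gamma\beta&\alpha\end{bmatrix}-\begin{bmatrix}0&G\\ \overline G&0\end{bmatrix}\right)^{-1}.$$ -/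

import Mathlib

open MeasureTheory ProbabilityTheory Filter Topology Matrix ComplexConjugate
open scoped Kronecker

noncomputable section

namespace EllipticLaplacian

/-- The pair of complex random variables `(ξ₁, ξ₂)` belongs to the `(μ, γ)`-family,
for parameters `0 ≤ μ ≤ 1` and `-1 < γ < 1`. Since the means vanish, the variance of `ξᵢ` is
`𝔼 |ξᵢ|²`. -/
structure IsFamily {Ω : Type*} [MeasurableSpace Ω] (P : Measure Ω) (μ γ : ℝ)
    (ξ₁ ξ₂ : Ω → ℂ) : Prop where
  mu_nonneg : 0 ≤ μ
  mu_le_one : μ ≤ 1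
  neg_one_lt_gamma : -1 < γ
  gamma_lt_one : γ < 1
  memLp₁ : MemLp ξ₁ 2 P
  memLp₂ : MemLp ξ₂ 2 P
  mean₁ : ∫ ω, ξ₁ ω ∂P = 0
  mean₂ : ∫ ω, ξ₂ ω ∂P = 0
  variance₁ : ∫ ω, ‖ξ₁ ω‖ ^ 2 ∂P = 1
  variance₂ : ∫ ω, ‖ξ₂ ω‖ ^ 2 ∂P = 1
  re_sq₁ : ∫ ω, (ξ₁ ω).re ^ 2 ∂P = μ
  re_sq₂ : ∫ ω, (ξ₂ ω).re ^ 2 ∂P = μ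
  im_sq₁ : ∫ ω, (ξ₁ ω).im ^ 2 ∂P = 1 - μ
  im_sq₂ : ∫ ω, (ξ₂ ω).im ^ 2 ∂P = 1 - μ
  re_re : ∫ ω, (ξ₁ ω).re * (ξ₂ ω).re ∂P = μ * γ
  im_im : ∫ ω, (ξ₁ ω).im * (ξ₂ ω).im ∂P = -(1 - μ) * γ
  re_im₁₁ : ∫ ω, (ξ₁ ω).re * (ξ₁ ω).im ∂P = 0
  re_im₁₂ : ∫ ω, (ξ₁ ω).re * (ξ₂ ω).im ∂P = 0
  re_im₂₁ : ∫ ω, (ξ₂ ω).re * (ξ₁ ω).im ∂P = 0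
  re_im₂₂ : ∫ ω, (ξ₂ ω).re * (ξ₂ ω).im ∂P = 0

/-- The `n × n` random matrix `X` satisfies Conditions C0-a and C0-b with atom variables
`(ξ₁, ξ₂)`. The diagonal entries are arbitrary, apart from the independence. -/
structure IsElliptic {Ω₀ Ω : Type*} [MeasurableSpace Ω₀] [MeasurableSpace Ω]
    (P₀ : Measure Ω₀) (ξ₁ ξ₂ : Ω₀ → ℂ) (P : Measure Ω) {n : ℕ}
    (X : Ω → Matrix (Fin n) (Fin n) ℂ) : Prop where
  measurable_entry : ∀ i j, Measurable fun ω => X ω i j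
  /-- C0-a: the `X i i` and the pairs `(X i j, X j i)`, `i < j`, are independent. (For `i = j` the
  pair `(X i i, X i i)` carries the same information as `X i i`.) -/
  indep : iIndepFun
    (fun (p : {p : Fin n × Fin n // p.1 ≤ p.2}) ω => (X ω p.1.1 p.1.2, X ω p.1.2 p.1.1)) P
  /-- C0-b: the pairs `(X i j, X j i)`, `i < j`, are copies of `(ξ₁, ξ₂)`. -/
  identDistrib : ∀ i j, i < j →
    IdentDistrib (fun ω => (X ω i j, X ω j i)) (fun ω => (ξ₁ ω, ξ₂ ω)) P P₀

variable {n : ℕ}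

/-- The diagonal matrix `D` of row sums of `X`. -/
def rowSums (X : Matrix (Fin n) (Fin n) ℂ) : Matrix (Fin n) (Fin n) ℂ :=
  Matrix.diagonal fun i => ∑ k, X i k

/-- The rescaled Laplacian matrix `M = (X - D) / √n`. -/
def laplacian (X : Matrix (Fin n) (Fin n) ℂ) : Matrix (Fin n) (Fin n) ℂ :=
  ((Real.sqrt n : ℝ) : ℂ)⁻¹ • (X - rowSums X)

/-- The matrix `q(z, η)`; these matrices, for `z ∈ ℂ` and `Im η > 0`, form the set `ℍ₊`. -/
def qMat (z η : ℂ) : Matrix (Fin 2) (Fin 2) ℂ :=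
  !![η, z; conj z, η]

/-- The `2 × 2` matrix with zero diagonal and off-diagonal entries `u`, `v̄`. -/
def offDiag (u v : ℂ) : Matrix (Fin 2) (Fin 2) ℂ :=
  !![0, u; conj v, 0]

/-- The Hermitization `B` of `M`: the `n × n` matrix of `2 × 2` blocks
`B i j = [0, M i j; conj (M j i), 0]`, viewed as a `2n × 2n` matrix. -/
def hermitization (M : Matrix (Fin n) (Fin n) ℂ) : Matrix (Fin n × Fin 2) (Fin n × Fin 2) ℂ :=
  Matrix.comp _ _ _ _ _ (Matrix.of fun i j => offDiag (M i j) (M j i))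

/-- The matrix `B - 1ₙ ⊗ q`. -/
def shifted (M : Matrix (Fin n) (Fin n) ℂ) (q : Matrix (Fin 2) (Fin 2) ℂ) :
    Matrix (Fin n × Fin 2) (Fin n × Fin 2) ℂ :=
  hermitization M - (1 : Matrix (Fin n) (Fin n) ℂ) ⊗ₖ q

/-- The resolvent `R(q) = (B - 1ₙ ⊗ q)⁻¹`. -/
def resolvent (M : Matrix (Fin n) (Fin n) ℂ) (q : Matrix (Fin 2) (Fin 2) ℂ) :
    Matrix (Fin n × Fin 2) (Fin n × Fin 2) ℂ :=
  (shifted M q)⁻¹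

/-- The `k`-th diagonal `2 × 2` block `R(q)ₖₖ` of the resolvent. -/
def diagBlock (M : Matrix (Fin n) (Fin n) ℂ) (q : Matrix (Fin 2) (Fin 2) ℂ) (k : Fin n) :
    Matrix (Fin 2) (Fin 2) ℂ :=
  (resolvent M q).submatrix (fun s => (k, s)) (fun t => (k, t))

/-- The averaged diagonal block `Γₙ(q) = (1/n) ∑ₖ R(q)ₖₖ`. -/
def avgBlock (M : Matrix (Fin n) (Fin n) ℂ) (q : Matrix (Fin 2) (Fin 2) ℂ) :
    Matrix (Fin 2) (Fin 2) ℂ :=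
  (n : ℂ)⁻¹ • ∑ k, diagBlock M q k

/-- The entrywise expectation of a random `2 × 2` matrix. -/
def expectation {Ω : Type*} [MeasurableSpace Ω] (P : Measure Ω)
    (A : Ω → Matrix (Fin 2) (Fin 2) ℂ) : Matrix (Fin 2) (Fin 2) ℂ :=
  Matrix.of fun i j => ∫ ω, A ω i j ∂P

/-- The law `𝒩(0, K_μ)` on `ℂ`, for which the real and imaginary parts are jointly Gaussian and
centered with covariance matrix `K_μ = diag(μ, 1 - μ)`. -/
def gaussianLaw (μ : ℝ) : Measure ℂ :=
  (multivariateGaussian 0 !![μ, 0; 0, 1 - μ]).map fun v : EuclideanSpace ℝ (Fin 2) =>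
    (⟨v 0, v 1⟩ : ℂ)

/-- The matrix `q + [α, γ δ; γ β, α] - [0, g; ḡ, 0]`. -/
def fixedPointMat (γ : ℝ) (q : Matrix (Fin 2) (Fin 2) ℂ) (α β δ g : ℂ) :
    Matrix (Fin 2) (Fin 2) ℂ :=
  q + !![α, γ * δ; γ * β, α] - offDiag g g

end EllipticLaplacian

end

/-!
Every accumulation point of `𝔼 Γₙ` solves the fixed point equation because, by the Schur complement
formula, each diagonal block of the resolvent is nearly a function of `𝔼 Γₙ` and of one diagonal
entry of the Laplacian, and these entries are asymptotically Gaussian.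

*Bounds.* The matrix `B - 1 ⊗ q` is a Hermitian matrix minus `η`, so it is `Dissipative`: its
imaginary part is at most `-Im η`. It is therefore invertible, with an inverse of norm at most
`1 / Im η` and nonnegative imaginary part. The last property passes to `Γₙ` and to its expectation,
where it says `‖δ - conj β‖ ≤ 2 Im α`. This closed condition in turn makes the matrix in the fixed
point equation dissipative as well, up to a sign, since `|γ| ≤ 1`
(`dissipative_neg_fixedPointMat`). All inverses are thus bounded uniformly, and every comparison
reduces to the identity `F⁻¹ - F'⁻¹ = F⁻¹ (F' - F) F'⁻¹`.

*Schur complement.* The diagonal of `X` cancels in the Laplacian and is set to zero. The minor of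
`M` without row and column `k` still depends on the entries `X i k` through its diagonal; removing
them costs only the sup norm of a column of `X / √n` (`laplacian_add_diagonal_apply`,
`IsElliptic.lintegral_norm_col_le`). Then the `k`-th diagonal block of the resolvent is the inverse
of `[0, M k k; conj (M k k), 0] - q - S`, where `S` is a quadratic form in row and column `k`, which
are independent of its coefficients (`schurForm_mul_diagBlock`). As no moments beyond the second are
available, `S` concentrates by a second moment bound off the diagonal and by truncation on the
diagonal (`lintegral_enorm_quadForm_le`). Its conditional mean is, up to `O(1 / n)`, the block `Γₙ`
of the matrix without row and column `k`, with its diagonal entries exchanged and its off-diagonal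
entries exchanged and multiplied by `γ`; the equality of the diagonal entries of `Γₙ`
(`avgBlock_one_one`) then yields the block `[α, γ δ; γ β, α]`. Finally, `Γₙ` is close to `𝔼 Γₙ` by
the Efron-Stein inequality (`integral_norm_sub_integral_sq_le`), as changing one pair of entries
changes `Γₙ` by `O(n ^ (-3/2))` (`norm_avgBlock_laplacian_sub_le`). Altogether `𝔼 Γₙ` satisfies the
fixed point equation up to a vanishing error, with the averaged law of the diagonal entries of `M`
in the place of the Gaussian law (`IsElliptic.norm_expectation_add_integral_le`).

*Limit.* The averaged law converges weakly to the Gaussian law by Lévy's continuity theorem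
(`tendsto_integral_diagLaw`), and the matrix in the fixed point equation is uniformly invertible, so
the equation passes to the limit along a subsequence of `𝔼 Γₙ` (`fixedPoint_of_tendsto`).
-/

namespace EllipticLaplacian

section Deterministic

open scoped Matrix.Norms.L2Operator

/-! ### Strictly dissipative matrices -/

section Dissipative

variable {ι : Type*} [Fintype ι]

/-- The imaginary part `(A - Aᴴ) / 2i` of the matrix `A` is at most `-c`, in the sense of quadratic
forms. -/
def Dissipative (c : ℝ) (A : Matrix ι ι ℂ) : Prop :=
  ∀ v : ι → ℂ, (star v ⬝ᵥ A *ᵥ v).im ≤ -(c * ∑ i, ‖v i‖ ^ 2)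

variable {c : ℝ} {A : Matrix ι ι ℂ}

lemma Dissipative.le_norm_mulVec (hA : Dissipative c A) (v : ι → ℂ) :
    c * ‖WithLp.toLp 2 v‖ ≤ ‖WithLp.toLp 2 (A *ᵥ v)‖ := by
  have h1 := hA v
  have h2 : star v ⬝ᵥ A *ᵥ v = inner ℂ (WithLp.toLp 2 v) (WithLp.toLp 2 (A *ᵥ v)) := by
    rw [EuclideanSpace.inner_eq_star_dotProduct, dotProduct_comm]
  have h3 : ∑ i, ‖v i‖ ^ 2 = ‖WithLp.toLp 2 v‖ ^ 2 := by
    rw [EuclideanSpace.norm_sq_eq]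
  have h4 : |(star v ⬝ᵥ A *ᵥ v).im| ≤ ‖WithLp.toLp 2 v‖ * ‖WithLp.toLp 2 (A *ᵥ v)‖ :=
    (Complex.abs_im_le_norm _).trans (h2 ▸ norm_inner_le_norm _ _)
  rw [h3] at h1
  rcases (norm_nonneg (WithLp.toLp 2 v)).eq_or_lt with h0 | h0
  · rw [← h0]; simp
  · have h5 := neg_abs_le (star v ⬝ᵥ A *ᵥ v).im
    refine le_of_mul_le_mul_left ?_ h0
    nlinarith

lemma Dissipative.isUnit_det [DecidableEq ι] (hc : 0 < c) (hA : Dissipative c A) :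
    IsUnit A.det := by
  rw [isUnit_iff_ne_zero]
  intro h
  obtain ⟨v, hv, hAv⟩ := Matrix.exists_mulVec_eq_zero_iff.2 h
  have h1 := hA.le_norm_mulVec v
  rw [hAv, WithLp.toLp_zero, norm_zero] at h1
  have h2 : 0 < ‖WithLp.toLp 2 v‖ := by
    rw [norm_pos_iff]; simpa using hv
  nlinarith

lemma Dissipative.norm_inv_le [DecidableEq ι] (hc : 0 < c) (hA : Dissipative c A) :
    ‖A⁻¹‖ ≤ c⁻¹ := by
  rw [l2_opNorm_def]
  refine ContinuousLinearMap.opNorm_le_bound _ (by positivity) fun x => ?_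
  have h1 := hA.le_norm_mulVec (A⁻¹ *ᵥ x.ofLp)
  rw [Matrix.mulVec_mulVec, Matrix.mul_nonsing_inv _ (hA.isUnit_det hc), Matrix.one_mulVec] at h1
  rw [inv_mul_eq_div, le_div_iff₀' hc]
  exact h1

lemma Dissipative.im_star_dotProduct_inv_mulVec_nonneg [DecidableEq ι] (hc : 0 < c)
    (hA : Dissipative c A) (v : ι → ℂ) : 0 ≤ (star v ⬝ᵥ A⁻¹ *ᵥ v).im := by
  have h1 := hA (A⁻¹ *ᵥ v)
  have h2 : v = A *ᵥ (A⁻¹ *ᵥ v) := by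
    rw [Matrix.mulVec_mulVec, Matrix.mul_nonsing_inv _ (hA.isUnit_det hc), Matrix.one_mulVec]
  have h3 : star v ⬝ᵥ A⁻¹ *ᵥ v = conj (star (A⁻¹ *ᵥ v) ⬝ᵥ (A *ᵥ (A⁻¹ *ᵥ v))) := by
    rw [← h2]
    exact Matrix.star_dotProduct _ _
  rw [h3, Complex.conj_im]
  have : 0 ≤ c * ∑ i, ‖(A⁻¹ *ᵥ v) i‖ ^ 2 := by positivity
  linarith

end Dissipative

/-! ### Entries of a matrix and its operator norm -/

section Entries

variable {m n : Type*} [Fintype m] [Fintype n] [DecidableEq n]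

lemma sum_col_sq_le (A : Matrix m n ℂ) (j : n) : ∑ i, ‖A i j‖ ^ 2 ≤ ‖A‖ ^ 2 := by
  have h := l2_opNorm_mulVec A (EuclideanSpace.single j 1)
  rw [PiLp.norm_single, norm_one, mul_one] at h
  have h2 := pow_le_pow_left₀ (norm_nonneg _) h 2
  rw [EuclideanSpace.norm_sq_eq] at h2
  simpa using h2

lemma sum_row_sq_le [DecidableEq m] (A : Matrix m n ℂ) (i : m) :
    ∑ j, ‖A i j‖ ^ 2 ≤ ‖A‖ ^ 2 := by
  have h := sum_col_sq_le Aᴴ i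
  rw [l2_opNorm_conjTranspose] at h
  simpa using h

lemma norm_entry_le (A : Matrix m n ℂ) (i : m) (j : n) : ‖A i j‖ ≤ ‖A‖ := by
  refine le_of_sq_le_sq ?_ (norm_nonneg _)
  exact (Finset.single_le_sum (f := fun i => ‖A i j‖ ^ 2) (fun _ _ => by positivity)
    (Finset.mem_univ i)).trans (sum_col_sq_le A j)

end Entries

/-! ### The resolvent of the Hermitization -/

section Resolvent

variable {n : ℕ} (M : Matrix (Fin n) (Fin n) ℂ) (q : Matrix (Fin 2) (Fin 2) ℂ) (z η : ℂ)

lemma shifted_apply (i j : Fin n) (s t : Fin 2) :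
    shifted M q (i, s) (j, t) = offDiag (M i j) (M j i) s t - if i = j then q s t else 0 := by
  simp [shifted, hermitization, Matrix.comp_apply, Matrix.one_apply]

lemma isHermitian_shifted_qMat_zero : (shifted M (qMat z 0)).IsHermitian := by
  ext ⟨i, s⟩ ⟨j, t⟩
  rw [conjTranspose_apply, shifted_apply, shifted_apply]
  by_cases h : i = j
  · subst h; fin_cases s <;> fin_cases t <;> simp [offDiag, qMat]
  · fin_cases s <;> fin_cases t <;> simp [offDiag, h, Ne.symm h]

lemma shifted_qMat : shifted M (qMat z η) = shifted M (qMat z 0) - η • 1 := by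
  ext ⟨i, s⟩ ⟨j, t⟩
  rw [Matrix.sub_apply, shifted_apply, shifted_apply]
  by_cases h : i = j
  · subst h; fin_cases s <;> fin_cases t <;> simp [offDiag, qMat]
  · simp [h]

lemma dissipative_shifted : Dissipative η.im (shifted M (qMat z η)) := by
  intro v
  have h := (isHermitian_shifted_qMat_zero M z).im_star_dotProduct_mulVec_self v
  have h2 : star v ⬝ᵥ v = ((∑ i, ‖v i‖ ^ 2 : ℝ) : ℂ) := by
    simp only [dotProduct, Pi.star_apply, RCLike.star_def, Complex.conj_mul']
    push_cast
    rfl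
  simp only [RCLike.im_to_complex] at h
  rw [shifted_qMat, Matrix.sub_mulVec, dotProduct_sub, Matrix.smul_mulVec, Matrix.one_mulVec,
    dotProduct_smul, h2, Complex.sub_im, h, smul_eq_mul, Complex.im_mul_ofReal]
  simp

variable {η}

lemma isUnit_det_shifted (hη : 0 < η.im) : IsUnit (shifted M (qMat z η)).det :=
  (dissipative_shifted M z η).isUnit_det hη

lemma norm_resolvent_le (hη : 0 < η.im) : ‖resolvent M (qMat z η)‖ ≤ η.im⁻¹ :=
  (dissipative_shifted M z η).norm_inv_le hη

lemma resolvent_mul_shifted (hη : 0 < η.im) :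
    resolvent M (qMat z η) * shifted M (qMat z η) = 1 :=
  Matrix.nonsing_inv_mul _ (isUnit_det_shifted M z hη)

lemma shifted_mul_resolvent (hη : 0 < η.im) :
    shifted M (qMat z η) * resolvent M (qMat z η) = 1 :=
  Matrix.mul_nonsing_inv _ (isUnit_det_shifted M z hη)

lemma avgBlock_apply (s t : Fin 2) :
    avgBlock M q s t = (n : ℂ)⁻¹ * ∑ k, resolvent M q (k, s) (k, t) := by
  simp [avgBlock, diagBlock, Matrix.sum_apply]

lemma norm_diagBlock_apply_le (hη : 0 < η.im) (k : Fin n) (s t : Fin 2) :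
    ‖resolvent M (qMat z η) (k, s) (k, t)‖ ≤ η.im⁻¹ :=
  (norm_entry_le _ _ _).trans (norm_resolvent_le M z hη)

lemma norm_avgBlock_apply_le (hη : 0 < η.im) (s t : Fin 2) :
    ‖avgBlock M (qMat z η) s t‖ ≤ η.im⁻¹ := by
  rw [avgBlock_apply, norm_mul, norm_inv, Complex.norm_natCast]
  have h : ‖∑ k : Fin n, resolvent M (qMat z η) (k, s) (k, t)‖ ≤ n * η.im⁻¹ := by
    refine (norm_sum_le _ _).trans ?_
    refine (Finset.sum_le_sum fun k _ => norm_diagBlock_apply_le M z hη k s t).trans ?_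
    simp
  rcases Nat.eq_zero_or_pos n with rfl | hn
  · simp [hη.le]
  · rw [inv_mul_le_iff₀ (by positivity)]
    exact h

/-- Both diagonal entries of the averaged block agree: with `R` the resolvent and `N` the
off-diagonal part of `B - 1 ⊗ q`, the equations `R N = N R` on the diagonal yield
`-η tr R₀₀ + tr R₀₁ N₁₀ = n = tr N₁₀ R₀₁ - η tr R₁₁`. -/
lemma avgBlock_one_one (hη : 0 < η.im) :
    avgBlock M (qMat z η) 1 1 = avgBlock M (qMat z η) 0 0 := by
  rw [avgBlock_apply, avgBlock_apply]
  congr 1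
  set R := resolvent M (qMat z η)
  set A := shifted M (qMat z η) with hA
  have h00 : ∀ i j : Fin n, A (i, 0) (j, 0) = if i = j then -η else 0 := fun i j => by
    rw [hA, shifted_apply]; split_ifs <;> simp [offDiag, qMat]
  have h11 : ∀ i j : Fin n, A (i, 1) (j, 1) = if i = j then -η else 0 := fun i j => by
    rw [hA, shifted_apply]; split_ifs <;> simp [offDiag, qMat]
  have h1 : ∀ k : Fin n, -η * R (k, 0) (k, 0) + ∑ j, R (k, 0) (j, 1) * A (j, 1) (k, 0) = 1 := by
    intro k
    have := congr_fun₂ (resolvent_mul_shifted M z hη) (k, 0) (k, 0)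
    rw [Matrix.mul_apply, Fintype.sum_prod_type] at this
    simp only [Fin.sum_univ_two, Finset.sum_add_distrib, ← hA] at this
    simp only [h00] at this
    simpa [mul_comm] using this
  have h2 : ∀ k : Fin n, ∑ j, A (k, 1) (j, 0) * R (j, 0) (k, 1) + -η * R (k, 1) (k, 1) = 1 := by
    intro k
    have := congr_fun₂ (shifted_mul_resolvent M z hη) (k, 1) (k, 1)
    rw [Matrix.mul_apply, Fintype.sum_prod_type] at this
    simp only [Fin.sum_univ_two, Finset.sum_add_distrib, ← hA] at this
    simp only [h11] at this
    simpa [mul_comm] using this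
  have h3 : ∑ k : Fin n, (-η * R (k, 0) (k, 0) + ∑ j, R (k, 0) (j, 1) * A (j, 1) (k, 0)) =
      ∑ k : Fin n, (∑ j, A (k, 1) (j, 0) * R (j, 0) (k, 1) + -η * R (k, 1) (k, 1)) :=
    Finset.sum_congr rfl fun k _ => by rw [h1, h2]
  have h4 : ∑ k : Fin n, ∑ j, A (k, 1) (j, 0) * R (j, 0) (k, 1) =
      ∑ k : Fin n, ∑ j, R (k, 0) (j, 1) * A (j, 1) (k, 0) := by
    rw [Finset.sum_comm]
    simp only [mul_comm]
  rw [Finset.sum_add_distrib, Finset.sum_add_distrib, h4, add_comm, add_left_cancel_iff,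
    ← Finset.mul_sum, ← Finset.mul_sum] at h3
  have hη0 : -η ≠ 0 := by
    intro h
    rw [neg_eq_zero.1 h] at hη
    simp at hη
  exact (mul_left_cancel₀ hη0 h3).symm

/-- For purely imaginary `η`, conjugation by `diag(1, -1)` maps `B - 1 ⊗ q` to minus its
adjoint. -/
lemma resolvent_apply_of_re_eq_zero (hη : 0 < η.im) (h0 : η.re = 0) (i j : Fin n) :
    resolvent M (qMat z η) (i, 1) (j, 0) = conj (resolvent M (qMat z η) (j, 0) (i, 1)) := by
  set A := shifted M (qMat z η) with hA
  let S : Matrix (Fin n × Fin 2) (Fin n × Fin 2) ℂ := diagonal fun p => if p.2 = 0 then 1 else -1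
  have hη' : conj η = -η := by
    apply Complex.ext <;> simp [h0]
  have hS : S * S = 1 := by
    rw [diagonal_mul_diagonal, ← diagonal_one]
    congr 1; ext ⟨i, s⟩; fin_cases s <;> simp
  have hSi : S⁻¹ = S := Matrix.inv_eq_left_inv hS
  have h : S * A * S = -Aᴴ := by
    ext ⟨i, s⟩ ⟨j, t⟩
    rw [mul_diagonal, diagonal_mul, neg_apply, conjTranspose_apply, hA, shifted_apply,
      shifted_apply]
    by_cases h : i = j
    · subst h; fin_cases s <;> fin_cases t <;> simp [offDiag, qMat, hη']
    · fin_cases s <;> fin_cases t <;> simp [offDiag, h, Ne.symm h]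
  have h2 : S * A⁻¹ * S = -(A⁻¹)ᴴ := by
    have := congr_arg (·⁻¹) h
    simp only [Matrix.mul_inv_rev, hSi] at this
    rw [← mul_assoc] at this
    rw [this, Matrix.conjTranspose_nonsing_inv]
    refine Matrix.inv_eq_left_inv ?_
    rw [neg_mul_neg, Matrix.nonsing_inv_mul]
    rw [Matrix.det_conjTranspose]
    exact (isUnit_det_shifted M z hη).star
  have h3 := congr_fun₂ h2 (i, 1) (j, 0)
  rw [mul_diagonal, diagonal_mul, neg_apply, conjTranspose_apply] at h3
  simpa [resolvent, ← hA] using h3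

lemma avgBlock_one_zero (hη : 0 < η.im) (h0 : η.re = 0) :
    avgBlock M (qMat z η) 1 0 = conj (avgBlock M (qMat z η) 0 1) := by
  rw [avgBlock_apply, avgBlock_apply, map_mul, map_inv₀, map_sum, Complex.conj_natCast]
  simp only [resolvent_apply_of_re_eq_zero M z hη h0]

lemma im_star_dotProduct_diagBlock_nonneg (hη : 0 < η.im) (k : Fin n) (w : Fin 2 → ℂ) :
    0 ≤ (star w ⬝ᵥ diagBlock M (qMat z η) k *ᵥ w).im := by
  have h := (dissipative_shifted M z η).im_star_dotProduct_inv_mulVec_nonneg hη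
    (fun p => if p.1 = k then w p.2 else 0)
  convert h using 2
  simp [dotProduct, mulVec, Fintype.sum_prod_type, diagBlock, resolvent, apply_ite]

/-- The averaged block has nonnegative imaginary part; this is the resulting bound on its
anti-Hermitian off-diagonal part, obtained from a unimodular test vector `(1, u)`. -/
lemma norm_avgBlock_sub_le (hη : 0 < η.im) :
    ‖avgBlock M (qMat z η) 1 0 - conj (avgBlock M (qMat z η) 0 1)‖ ≤
      2 * (avgBlock M (qMat z η) 0 0).im := by
  have key : ∀ w : Fin 2 → ℂ, 0 ≤ (star w ⬝ᵥ avgBlock M (qMat z η) *ᵥ w).im := by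
    intro w
    have h1 : star w ⬝ᵥ avgBlock M (qMat z η) *ᵥ w =
        ((n : ℝ)⁻¹ : ℝ) * ∑ k, star w ⬝ᵥ diagBlock M (qMat z η) k *ᵥ w := by
      rw [avgBlock, Matrix.smul_mulVec, dotProduct_smul, Matrix.sum_mulVec, dotProduct_sum]
      simp
    rw [h1, Complex.im_ofReal_mul, Complex.im_sum]
    have := Finset.sum_nonneg fun k (_ : k ∈ Finset.univ) =>
      im_star_dotProduct_diagBlock_nonneg M z hη k w
    positivity
  have h11 := avgBlock_one_one M z hη
  set a := avgBlock M (qMat z η) with ha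
  set D := a 1 0 - conj (a 0 1) with hD
  rcases eq_or_ne D 0 with h0 | h0
  · have h := key ![1, 0]
    have h2 : star ![1, 0] ⬝ᵥ a *ᵥ ![1, 0] = a 0 0 := by
      simp [dotProduct, mulVec, Fin.sum_univ_two]
    rw [h2] at h
    rw [h0, norm_zero]
    linarith
  · have hn : (‖D‖ : ℂ) ≠ 0 := by simpa using h0
    set u : ℂ := Complex.I * D / ‖D‖ with hu
    have huu : conj u * u = 1 := by
      rw [hu, map_div₀, map_mul, Complex.conj_I, Complex.conj_ofReal]
      field_simp
      rw [Complex.I_sq, mul_assoc, Complex.conj_mul']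
      ring
    have h := key ![1, u]
    have h2 : star ![1, u] ⬝ᵥ a *ᵥ ![1, u] = 2 * a 0 0 + (conj u * a 1 0 + a 0 1 * u) := by
      simp only [dotProduct, mulVec, Fin.sum_univ_two, h11, Pi.star_apply, RCLike.star_def]
      simp
      linear_combination (a 0 0) * huu
    have h3 : (conj u * a 1 0 + a 0 1 * u).im = (conj u * D).im := by
      rw [hD, mul_sub, Complex.add_im, Complex.sub_im, ← map_mul, Complex.conj_im, mul_comm u]
      ring
    have h4 : conj u * D = -Complex.I * ‖D‖ := by
      rw [hu, map_div₀, map_mul, Complex.conj_I, Complex.conj_ofReal]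
      field_simp
      rw [Complex.conj_mul']
    rw [h2, Complex.add_im, h3, h4] at h
    simp at h
    linarith

end Resolvent

/-! ### The matrix of the fixed point equation -/

section FixedPoint

variable {z η α β δ : ℂ} {γ : ℝ}

/-- Multiplying the off-diagonal entries of a matrix with nonnegative imaginary part by `γ` and
transposing them leaves the imaginary part nonnegative, as `|γ| ≤ 1`. -/
lemma dissipative_neg_fixedPointMat (hγ : |γ| ≤ 1) (h : ‖δ - conj β‖ ≤ 2 * α.im) (g : ℂ) :
    Dissipative η.im (-fixedPointMat γ (qMat z η) α β δ g) := by
  intro v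
  have e : star v ⬝ᵥ (-fixedPointMat γ (qMat z η) α β δ g) *ᵥ v =
      -((η + α) * (conj (v 0) * v 0 + conj (v 1) * v 1) + ((z - g) * (conj (v 0) * v 1) +
        conj ((z - g) * (conj (v 0) * v 1))) +
        γ * (δ * (conj (v 0) * v 1) + β * conj (conj (v 0) * v 1))) := by
    simp [fixedPointMat, qMat, offDiag, dotProduct, mulVec, Fin.sum_univ_two]
    ring
  set w := conj (v 0) * v 1 with hw
  have h1 : (δ * w + β * conj w).im = ((δ - conj β) * w).im := by
    simp; ring
  have h2 : |((δ - conj β) * w).im| ≤ 2 * α.im * ‖w‖ :=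
    (Complex.abs_im_le_norm _).trans (by rw [norm_mul]; gcongr)
  have h3 : 2 * ‖w‖ ≤ ‖v 0‖ ^ 2 + ‖v 1‖ ^ 2 := by
    rw [hw, norm_mul, Complex.norm_conj]
    nlinarith [sq_nonneg (‖v 0‖ - ‖v 1‖)]
  have hα : 0 ≤ α.im := by linarith [norm_nonneg (δ - conj β)]
  have h4 : |γ * ((δ - conj β) * w).im| ≤ α.im * (‖v 0‖ ^ 2 + ‖v 1‖ ^ 2) := by
    rw [abs_mul]
    calc |γ| * |((δ - conj β) * w).im| ≤ 1 * (2 * α.im * ‖w‖) := by gcongr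
      _ = α.im * (2 * ‖w‖) := by ring
      _ ≤ _ := by gcongr
  have h5 : ((η + α) * (conj (v 0) * v 0 + conj (v 1) * v 1)).im =
      (η.im + α.im) * (‖v 0‖ ^ 2 + ‖v 1‖ ^ 2) := by
    rw [Complex.conj_mul', Complex.conj_mul']
    have : (‖v 0‖ : ℂ) ^ 2 + (‖v 1‖ : ℂ) ^ 2 = ((‖v 0‖ ^ 2 + ‖v 1‖ ^ 2 : ℝ) : ℂ) := by
      push_cast; rfl
    rw [this, Complex.im_mul_ofReal, Complex.add_im]
  rw [e, Complex.neg_im, Complex.add_im, Complex.add_im, h5, Complex.im_ofReal_mul, h1,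
    Complex.add_im, Complex.conj_im, Fin.sum_univ_two]
  have := neg_abs_le (γ * ((δ - conj β) * w).im)
  nlinarith

lemma isUnit_det_fixedPointMat (hη : 0 < η.im) (hγ : |γ| ≤ 1) (h : ‖δ - conj β‖ ≤ 2 * α.im)
    (g : ℂ) : IsUnit (fixedPointMat γ (qMat z η) α β δ g).det := by
  have := (dissipative_neg_fixedPointMat (z := z) (η := η) hγ h g).isUnit_det hη
  rw [Matrix.det_neg] at this
  simpa using this

lemma norm_inv_fixedPointMat_apply_le (hη : 0 < η.im) (hγ : |γ| ≤ 1)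
    (h : ‖δ - conj β‖ ≤ 2 * α.im) (g : ℂ) (s t : Fin 2) :
    ‖(fixedPointMat γ (qMat z η) α β δ g)⁻¹ s t‖ ≤ η.im⁻¹ := by
  have h1 := (dissipative_neg_fixedPointMat (z := z) (η := η) hγ h g).norm_inv_le hη
  have h2 : (-fixedPointMat γ (qMat z η) α β δ g)⁻¹ = -(fixedPointMat γ (qMat z η) α β δ g)⁻¹ :=
    Matrix.inv_eq_left_inv (by
      rw [neg_mul_neg, Matrix.nonsing_inv_mul _ (isUnit_det_fixedPointMat hη hγ h g)])
  rw [h2, norm_neg] at h1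
  exact (norm_entry_le _ _ _).trans h1

lemma norm_triple_mul_apply_le {c C : ℝ} (hc : 0 ≤ c) {A E B : Matrix (Fin 2) (Fin 2) ℂ}
    (hA : ∀ s t, ‖A s t‖ ≤ c) (hB : ∀ s t, ‖B s t‖ ≤ C) (s t : Fin 2) :
    ‖(A * E * B) s t‖ ≤ c * C * ∑ u, ∑ v, ‖E u v‖ := by
  have h : (A * E * B) s t = ∑ v, ∑ u, A s u * E u v * B v t := by
    simp only [Matrix.mul_apply, Finset.sum_mul]
  rw [h, Finset.sum_comm, Finset.mul_sum]
  refine (norm_sum_le _ _).trans (Finset.sum_le_sum fun u _ => ?_)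
  rw [Finset.mul_sum]
  refine (norm_sum_le _ _).trans (Finset.sum_le_sum fun v _ => ?_)
  rw [norm_mul, norm_mul]
  calc ‖A s u‖ * ‖E u v‖ * ‖B v t‖ ≤ c * ‖E u v‖ * C := by
        gcongr
        · exact hA s u
        · exact hB v t
    _ = c * C * ‖E u v‖ := by ring

/-- A matrix `r` with `(H - q - S) r = 1` is close to `-(fixedPointMat …)⁻¹` if `S` is close to
`[α, γ δ; γ β, α]`. -/
lemma norm_add_inv_fixedPointMat_apply_le (hη : 0 < η.im) (hγ : |γ| ≤ 1)
    (h : ‖δ - conj β‖ ≤ 2 * α.im) (g : ℂ) {r S : Matrix (Fin 2) (Fin 2) ℂ}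
    (hr : (offDiag g g - qMat z η - S) * r = 1) (hr' : ∀ s t, ‖r s t‖ ≤ η.im⁻¹) (s t : Fin 2) :
    ‖r s t + (fixedPointMat γ (qMat z η) α β δ g)⁻¹ s t‖ ≤
      η.im⁻¹ ^ 2 * ∑ u, ∑ v, ‖(S - !![α, γ * δ; γ * β, α]) u v‖ := by
  set F := fixedPointMat γ (qMat z η) α β δ g with hF
  have h1 : r + F⁻¹ = -(r * (S - !![α, γ * δ; γ * β, α]) * F⁻¹) := by
    have hu : F * F⁻¹ = 1 := Matrix.mul_nonsing_inv _ (isUnit_det_fixedPointMat hη hγ h g)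
    have hl : r * (offDiag g g - qMat z η - S) = 1 := mul_eq_one_comm.1 hr
    have h2 : S - !![α, γ * δ; γ * β, α] = -(offDiag g g - qMat z η - S) - F := by
      rw [hF, fixedPointMat]; abel
    rw [h2, mul_sub, mul_neg, hl, sub_mul, mul_assoc r, hu]
    simp
  rw [← Matrix.add_apply, h1, Matrix.neg_apply, norm_neg, sq]
  exact norm_triple_mul_apply_le (by positivity) hr'
    (norm_inv_fixedPointMat_apply_le hη hγ h g) s t

end FixedPoint

/-! ### Perturbation of the resolvent -/

section Perturbation

variable {n : ℕ} (M M' : Matrix (Fin n) (Fin n) ℂ) (z : ℂ) {η : ℂ}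

lemma shifted_sub_shifted (q : Matrix (Fin 2) (Fin 2) ℂ) :
    shifted M q - shifted M' q = hermitization (M - M') := by
  ext ⟨i, s⟩ ⟨j, t⟩
  rw [Matrix.sub_apply, shifted_apply, shifted_apply]
  fin_cases s <;> fin_cases t <;> simp [hermitization, offDiag, Matrix.comp_apply]

lemma resolvent_sub_resolvent (hη : 0 < η.im) :
    resolvent M (qMat z η) - resolvent M' (qMat z η) =
      resolvent M (qMat z η) * hermitization (M' - M) * resolvent M' (qMat z η) := by
  rw [← shifted_sub_shifted M' M (qMat z η), mul_sub, resolvent_mul_shifted M z hη, sub_mul,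
    mul_assoc, shifted_mul_resolvent M' z hη, one_mul, mul_one]

lemma norm_hermitization_diagonal_le {d : Fin n → ℂ} {C : ℝ} (hC : 0 ≤ C) (hd : ∀ i, ‖d i‖ ≤ C) :
    ‖hermitization (diagonal d)‖ ≤ C := by
  refine le_of_sq_le_sq ?_ hC
  have h : (hermitization (diagonal d))ᴴ * hermitization (diagonal d) =
      diagonal fun p => ((‖d p.1‖ ^ 2 : ℝ) : ℂ) := by
    ext ⟨i, s⟩ ⟨j, t⟩
    simp only [Matrix.mul_apply, Fintype.sum_prod_type, Fin.sum_univ_two, conjTranspose_apply,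
      hermitization, Matrix.comp_apply, Matrix.of_apply]
    by_cases h : i = j
    · subst h
      fin_cases s <;> fin_cases t <;>
        simp [offDiag, diagonal_apply, apply_ite, Complex.conj_mul', Complex.mul_conj']
    · fin_cases s <;> fin_cases t <;> simp [offDiag, diagonal_apply, h, Ne.symm h]
  rw [sq, ← l2_opNorm_conjTranspose_mul_self, h, l2_opNorm_diagonal, pi_norm_le_iff_of_nonneg
    (by positivity)]
  rintro ⟨i, s⟩
  rw [Complex.norm_real, Real.norm_of_nonneg (by positivity)]
  exact pow_le_pow_left₀ (norm_nonneg _) (hd i) 2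

lemma norm_resolvent_sub_apply_le (hη : 0 < η.im) {d : Fin n → ℂ} {C : ℝ} (hC : 0 ≤ C)
    (hd : ∀ i, ‖d i‖ ≤ C) (p p' : Fin n × Fin 2) :
    ‖resolvent M (qMat z η) p p' - resolvent (M + diagonal d) (qMat z η) p p'‖ ≤
      η.im⁻¹ ^ 2 * C := by
  rw [← Matrix.sub_apply, resolvent_sub_resolvent M _ z hη, add_sub_cancel_left]
  refine (norm_entry_le _ _ _).trans ((norm_mul_le _ _).trans ?_)
  calc _ ≤ (η.im⁻¹ * C) * η.im⁻¹ := by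
        gcongr
        · exact (norm_mul_le _ _).trans (by
            gcongr
            · exact norm_resolvent_le M z hη
            · exact norm_hermitization_diagonal_le hC hd)
        · exact norm_resolvent_le _ z hη
    _ = _ := by ring

/-- The averaged block is Lipschitz in the `ℓ¹`-norm of the entries: in the resolvent identity the
entry `(M' - M) i j` comes with an entry of `∑ₖ R'_{·k} R_{k·}`, bounded by Cauchy-Schwarz. -/
lemma norm_avgBlock_sub_avgBlock_le (hη : 0 < η.im) (s t : Fin 2) :
    ‖avgBlock M (qMat z η) s t - avgBlock M' (qMat z η) s t‖ ≤
      2 * η.im⁻¹ ^ 2 / n * ∑ i, ∑ j, ‖M i j - M' i j‖ := by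
  set R := resolvent M (qMat z η) with hR
  set R' := resolvent M' (qMat z η) with hR'
  set E := hermitization (M' - M) with hE
  have h1 : ∑ k, R (k, s) (k, t) - ∑ k, R' (k, s) (k, t) =
      ∑ p, ∑ p', E p p' * ∑ k, R (k, s) p * R' p' (k, t) := by
    rw [← Finset.sum_sub_distrib]
    simp only [← Matrix.sub_apply, hR, hR', resolvent_sub_resolvent M M' z hη]
    simp only [Matrix.mul_apply, Finset.sum_mul, Finset.mul_sum, ← hE, ← hR, ← hR']
    rw [Finset.sum_comm, Finset.sum_congr rfl fun _ _ => Finset.sum_comm, Finset.sum_comm]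
    refine Finset.sum_congr rfl fun p _ => Finset.sum_congr rfl fun p' _ =>
      Finset.sum_congr rfl fun k _ => by ring
  have h2 : ∀ p p', ‖∑ k, R (k, s) p * R' p' (k, t)‖ ≤ η.im⁻¹ ^ 2 := by
    intro p p'
    refine (norm_sum_le _ _).trans ?_
    simp only [norm_mul]
    refine (Real.sum_mul_le_sqrt_mul_sqrt _ _ _).trans ?_
    rw [sq]
    have e1 : ∑ k : Fin n, ‖R (k, s) p‖ ^ 2 ≤ η.im⁻¹ ^ 2 := by
      refine le_trans ?_ ((sum_col_sq_le R p).trans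
        (pow_le_pow_left₀ (norm_nonneg _) (norm_resolvent_le M z hη) 2))
      rw [Fintype.sum_prod_type]
      exact Finset.sum_le_sum fun k _ => Finset.single_le_sum (f := fun s => ‖R (k, s) p‖ ^ 2)
        (fun _ _ => by positivity) (Finset.mem_univ s)
    have e2 : ∑ k : Fin n, ‖R' p' (k, t)‖ ^ 2 ≤ η.im⁻¹ ^ 2 := by
      refine le_trans ?_ ((sum_row_sq_le R' p').trans
        (pow_le_pow_left₀ (norm_nonneg _) (norm_resolvent_le M' z hη) 2))
      rw [Fintype.sum_prod_type]
      exact Finset.sum_le_sum fun k _ => Finset.single_le_sum (f := fun s => ‖R' p' (k, s)‖ ^ 2)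
        (fun _ _ => by positivity) (Finset.mem_univ t)
    gcongr
    · exact Real.sqrt_le_iff.2 ⟨by positivity, e1⟩
    · exact Real.sqrt_le_iff.2 ⟨by positivity, e2⟩
  have h3 : ∑ p, ∑ p', ‖E p p'‖ = 2 * ∑ i, ∑ j, ‖M i j - M' i j‖ := by
    have : ∀ i j s t, E (i, s) (j, t) = offDiag (M' i j - M i j) (M' j i - M j i) s t := by
      intro i j s t; simp [hE, hermitization, Matrix.comp_apply]
    simp only [Fintype.sum_prod_type, Fin.sum_univ_two, this, offDiag]
    simp only [Finset.sum_add_distrib]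
    have e1 : ∑ i, ∑ j, ‖M' j i - M j i‖ = ∑ i, ∑ j, ‖M' i j - M i j‖ := Finset.sum_comm
    have e2 : ∀ a b : ℂ, ‖conj (a - b)‖ = ‖a - b‖ := fun a b => Complex.norm_conj _
    simp only [norm_sub_rev (M _ _), Matrix.of_apply, Matrix.cons_val', Matrix.cons_val_zero,
      Matrix.cons_val_one, Matrix.cons_val_fin_one, norm_zero, Finset.sum_const_zero, zero_add,
      add_zero, e2, e1, two_mul]
  rw [avgBlock_apply, avgBlock_apply, ← mul_sub, h1, norm_mul, norm_inv, Complex.norm_natCast]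
  have h4 : ‖∑ p, ∑ p', E p p' * ∑ k, R (k, s) p * R' p' (k, t)‖ ≤
      η.im⁻¹ ^ 2 * (2 * ∑ i, ∑ j, ‖M i j - M' i j‖) := by
    rw [← h3, Finset.mul_sum]
    refine (norm_sum_le _ _).trans (Finset.sum_le_sum fun p _ => ?_)
    rw [Finset.mul_sum]
    refine (norm_sum_le _ _).trans (Finset.sum_le_sum fun p' _ => ?_)
    rw [norm_mul, mul_comm]
    gcongr
    exact h2 p p'
  calc _ ≤ (n : ℝ)⁻¹ * (η.im⁻¹ ^ 2 * (2 * ∑ i, ∑ j, ‖M i j - M' i j‖)) := by gcongr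
    _ = _ := by ring

lemma sum_norm_laplacian_sub_le (X X' : Matrix (Fin n) (Fin n) ℂ) :
    ∑ i, ∑ j, ‖laplacian X i j - laplacian X' i j‖ ≤
      2 / √n * ∑ i, ∑ j, ‖X i j - X' i j‖ := by
  have h : ∀ i, ∑ j, ‖laplacian X i j - laplacian X' i j‖ ≤
      2 / √n * ∑ j, ‖X i j - X' i j‖ := by
    intro i
    have h1 : ∀ j, ‖laplacian X i j - laplacian X' i j‖ ≤
        (√n)⁻¹ * (‖X i j - X' i j‖ + if i = j then ∑ k, ‖X i k - X' i k‖ else 0) := by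
      intro j
      have e : laplacian X i j - laplacian X' i j = ((√n : ℝ) : ℂ)⁻¹ *
          ((X i j - X' i j) - if i = j then ∑ k, (X i k - X' i k) else 0) := by
        simp only [laplacian, rowSums, Matrix.smul_apply, Matrix.sub_apply, diagonal_apply,
          smul_eq_mul, Finset.sum_sub_distrib]
        split_ifs <;> ring
      rw [e, norm_mul, norm_inv, Complex.norm_real, Real.norm_of_nonneg (by positivity)]
      gcongr
      refine (norm_sub_le _ _).trans ?_
      gcongr
      split_ifs
      · exact norm_sum_le _ _
      · simp
    refine (Finset.sum_le_sum fun j _ => h1 j).trans (le_of_eq ?_)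
    rw [← Finset.mul_sum, Finset.sum_add_distrib]
    simp
    ring
  refine (Finset.sum_le_sum fun i _ => h i).trans (le_of_eq ?_)
  rw [← Finset.mul_sum]

lemma norm_avgBlock_laplacian_sub_le (hη : 0 < η.im) (X X' : Matrix (Fin n) (Fin n) ℂ)
    (s t : Fin 2) :
    ‖avgBlock (laplacian X) (qMat z η) s t - avgBlock (laplacian X') (qMat z η) s t‖ ≤
      4 * η.im⁻¹ ^ 2 / (n * √n) * ∑ i, ∑ j, ‖X i j - X' i j‖ := by
  refine (norm_avgBlock_sub_avgBlock_le _ _ z hη s t).trans ?_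
  calc _ ≤ 2 * η.im⁻¹ ^ 2 / n * (2 / √n * ∑ i, ∑ j, ‖X i j - X' i j‖) := by
        gcongr
        exact sum_norm_laplacian_sub_le X X'
    _ = _ := by ring

end Perturbation

/-! ### The Schur complement formula -/

section Schur

variable {n : ℕ}

/-- The matrix `Y` with row `k` and column `k` replaced by zero. -/
noncomputable def zeroCross (Y : Matrix (Fin n) (Fin n) ℂ) (k : Fin n) : Matrix (Fin n) (Fin n) ℂ :=
  Matrix.of fun i j => if i = k ∨ j = k then 0 else Y i j

/-- With `w = (Y k i, Y i k)`, the nonzero entry of row `s` of the block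
`[0, Y k i; conj (Y i k), 0]`, located in column `1 - s`. -/
noncomputable def rowVar (s : Fin 2) (w : ℂ × ℂ) : ℂ := ![w.1, conj w.2] s

/-- With `w = (Y k j, Y j k)`, the nonzero entry of column `t` of the block
`[0, Y j k; conj (Y k j), 0]`, located in row `1 - t`. -/
noncomputable def colVar (t : Fin 2) (w : ℂ × ℂ) : ℂ := ![conj w.1, w.2] t

/-- The pairs `(Y k j, Y j k)` formed by row `k` and column `k` of `Y`. -/
def crossPairs (Y : Matrix (Fin n) (Fin n) ℂ) (k : Fin n) (j : Fin n) : ℂ × ℂ :=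
  (Y k j, Y j k)

/-- The quadratic form `∑ᵢⱼ Bₖᵢ Rᵢⱼ Bⱼₖ` in the Schur complement formula, where `B` is the
Hermitization of `Y / √n` and `w i = (Y k i, Y i k)`. -/
noncomputable def schurForm (R : Matrix (Fin n × Fin 2) (Fin n × Fin 2) ℂ) (w : Fin n → ℂ × ℂ) :
    Matrix (Fin 2) (Fin 2) ℂ :=
  Matrix.of fun s t => (n : ℂ)⁻¹ *
    ∑ i, ∑ j, rowVar s (w i) * R (i, 1 - s) (j, 1 - t) * colVar t (w j)

lemma zeroCross_apply (Y : Matrix (Fin n) (Fin n) ℂ) (k i j : Fin n) :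
    zeroCross Y k i j = if i = k ∨ j = k then 0 else Y i j := rfl

variable (Y : Matrix (Fin n) (Fin n) ℂ) (z : ℂ) {η : ℂ} (k : Fin n)

/-- If the diagonal of `Y` vanishes, then deleting the entries `Y i k` from the diagonal of the
Laplacian of `Y` makes its minor without row and column `k` independent of that row and column. -/
lemma laplacian_add_diagonal_apply (hY : ∀ i, Y i i = 0) (i j : Fin n) :
    (laplacian Y + diagonal fun i => ((√n : ℝ) : ℂ)⁻¹ * Y i k) i j =
      laplacian (zeroCross Y k) i j + (if i = k ∧ j = k then laplacian Y k k else 0) +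
        ((if i = k then ((√n : ℝ) : ℂ)⁻¹ * Y k j else 0) +
          if j = k then ((√n : ℝ) : ℂ)⁻¹ * Y i k else 0) := by
  have h : i ≠ k → ∑ l, zeroCross Y k i l = ∑ l, Y i l - Y i k := by
    intro hik
    have h1 : ∀ l, zeroCross Y k i l = Y i l - if l = k then Y i l else 0 := fun l => by
      by_cases h : l = k <;> simp [zeroCross, hik, h]
    simp only [h1]
    simp
  have h' : ∑ l, zeroCross Y k k l = 0 := by simp [zeroCross]
  simp only [laplacian, rowSums, Matrix.add_apply, Matrix.smul_apply, Matrix.sub_apply,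
    diagonal_apply, smul_eq_mul]
  by_cases hi : i = k
  · subst hi
    by_cases hj : j = i
    · subst hj
      simp [hY, zeroCross]
    · simp [hj, Ne.symm hj, zeroCross]
  · by_cases hj : j = k
    · subst hj
      simp [hi, zeroCross]
    · by_cases hij : i = j
      · subst hij
        have h2 : zeroCross Y k i i = Y i i := by simp [zeroCross, hi]
        simp [hi, h hi, h2]
        ring
      · simp [hi, hj, hij, zeroCross]

/-- The Schur complement formula for the matrix in `laplacian_add_diagonal_apply`. Its `k`-th
diagonal block is `offDiag (laplacian Y k k) (laplacian Y k k)`, and the rest of it is the Laplacian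
of `zeroCross Y k`. -/
lemma schurForm_mul_diagBlock (hη : 0 < η.im) (hY : ∀ i, Y i i = 0) :
    (offDiag (laplacian Y k k) (laplacian Y k k) - qMat z η -
        schurForm (resolvent (laplacian (zeroCross Y k)) (qMat z η)) (crossPairs Y k)) *
      diagBlock (laplacian Y + diagonal fun i => ((√n : ℝ) : ℂ)⁻¹ * Y i k) (qMat z η) k = 1 := by
  set M' := laplacian (zeroCross Y k) with hM'
  set M'' := laplacian Y + diagonal fun i => ((√n : ℝ) : ℂ)⁻¹ * Y i k with hM''
  set H := offDiag (laplacian Y k k) (laplacian Y k k) with hH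
  set q := qMat z η with hq
  -- `V` is the inclusion of the `k`-th block; `b` and `c` are the `k`-th block row and column.
  let V : Matrix (Fin n × Fin 2) (Fin 2) ℂ := Matrix.of fun p t => if p = (k, t) then 1 else 0
  let W : Matrix (Fin 2) (Fin n × Fin 2) ℂ := Matrix.of fun t p => if p = (k, t) then 1 else 0
  let b : Matrix (Fin 2) (Fin n × Fin 2) ℂ :=
    Matrix.of fun s p => ((√n : ℝ) : ℂ)⁻¹ * offDiag (Y k p.1) (Y p.1 k) s p.2
  let c : Matrix (Fin n × Fin 2) (Fin 2) ℂ :=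
    Matrix.of fun p t => ((√n : ℝ) : ℂ)⁻¹ * offDiag (Y p.1 k) (Y k p.1) p.2 t
  have hV : ∀ {κ : Type} (B : Matrix (Fin 2) κ ℂ) (i s x),
      (V * B) (i, s) x = if i = k then B s x else 0 := by
    intro κ B i s x
    simp [Matrix.mul_apply, V, Prod.ext_iff, ite_and]
  have hW : ∀ {κ : Type} (B : Matrix κ (Fin 2) ℂ) (x i s),
      (B * W) x (i, s) = if i = k then B x s else 0 := by
    intro κ B x i s
    simp [Matrix.mul_apply, W, Prod.ext_iff, ite_and]
  have hW' : ∀ {κ : Type} (B : Matrix (Fin n × Fin 2) κ ℂ) (s x),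
      (W * B) s x = B (k, s) x := by
    intro κ B s x
    simp [Matrix.mul_apply, W]
  have hV' : ∀ {κ : Type} (B : Matrix κ (Fin n × Fin 2) ℂ) (x s),
      (B * V) x s = B x (k, s) := by
    intro κ B x s
    simp [Matrix.mul_apply, V]
  have hWV : W * V = 1 := by
    ext s t; rw [hV']; simp [W, Matrix.one_apply, eq_comm]
  have hbV : b * V = 0 := by
    ext s t; rw [hV']; fin_cases s <;> fin_cases t <;> simp [b, hY, offDiag]
  have hWc : W * c = 0 := by
    ext s t; rw [hW']; fin_cases s <;> fin_cases t <;> simp [c, hY, offDiag]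
  have hM'k : ∀ j, M' k j = 0 := fun j => by
    simp [hM', laplacian, rowSums, zeroCross_apply, diagonal_apply]
  have hM'k' : ∀ j, M' j k = 0 := fun j => by
    by_cases h : j = k <;> simp [hM', laplacian, rowSums, zeroCross, h]
  have hA'V : shifted M' q * V = -(V * q) := by
    ext ⟨i, s⟩ t
    rw [hV', Matrix.neg_apply, hV, shifted_apply, hM'k, hM'k']
    by_cases h : i = k <;> fin_cases s <;> fin_cases t <;> simp [offDiag, h]
  have hWA' : W * shifted M' q = -(q * W) := by
    ext s ⟨i, t⟩
    rw [hW', Matrix.neg_apply, hW, shifted_apply, hM'k, hM'k']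
    by_cases h : i = k
    · subst h; fin_cases s <;> fin_cases t <;> simp [offDiag]
    · fin_cases s <;> fin_cases t <;> simp [offDiag, h, Ne.symm h]
  have hA : shifted M'' q = shifted M' q + V * (H * W) + V * b + c * W := by
    ext ⟨i, s⟩ ⟨j, t⟩
    simp only [Matrix.add_apply, hV, hW, shifted_apply, hM'', hM', hH,
      laplacian_add_diagonal_apply Y k hY]
    by_cases hi : i = k
    · subst hi
      by_cases hj : j = i
      · subst hj
        fin_cases s <;> fin_cases t <;> simp [offDiag, b, c, hY] <;> ring
      · fin_cases s <;> fin_cases t <;> simp [offDiag, b, c, hj, Ne.symm hj]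
    · by_cases hj : j = k
      · subst hj
        fin_cases s <;> fin_cases t <;> simp [offDiag, b, c, hi]
      · simp [hi, hj]
  set R' := resolvent M' q with hR'
  set R'' := resolvent M'' q with hR''
  have hr : diagBlock M'' q k = W * (R'' * V) := by
    ext s t
    rw [hW', hV']; rfl
  have hbR'V : b * (R' * V) = 0 := by
    have h1 : R' * (V * q) = -V := by
      rw [eq_neg_iff_add_eq_zero, ← neg_eq_zero, neg_add, ← Matrix.mul_neg, ← hA'V,
        ← Matrix.mul_assoc, hR', resolvent_mul_shifted M' z hη, Matrix.one_mul, add_neg_cancel]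
    have h2 : IsUnit q.det := by
      have := isUnit_det_fixedPointMat (z := z) (γ := 0) (α := 0) (β := 0) (δ := 0) hη (by simp)
        (by simp) 0
      convert this
      ext s t
      fin_cases s <;> fin_cases t <;> simp [fixedPointMat, offDiag, hq]
    calc b * (R' * V) = b * (R' * (V * q)) * q⁻¹ := by
          rw [Matrix.mul_assoc b, Matrix.mul_assoc R', Matrix.mul_assoc V,
            Matrix.mul_nonsing_inv _ h2, Matrix.mul_one]
      _ = 0 := by rw [h1, Matrix.mul_neg, hbV, neg_zero, Matrix.zero_mul]
  -- The resolvent equation `(B - 1 ⊗ q) R'' V = V`, multiplied by `W` and by `b R'`.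
  have e0 : shifted M'' q * (R'' * V) = V := by
    rw [← Matrix.mul_assoc, hR'', shifted_mul_resolvent M'' z hη, Matrix.one_mul]
  rw [hA] at e0
  set Q := R'' * V
  have e1 : (H - q) * (W * Q) + b * Q = 1 := by
    have := congr_arg (W * ·) e0
    simp only [Matrix.add_mul, Matrix.mul_add, ← Matrix.mul_assoc, hWA', hWV, hWc, Matrix.one_mul,
      Matrix.zero_mul, add_zero] at this
    rw [← this, sub_mul, Matrix.neg_mul, Matrix.mul_assoc, Matrix.mul_assoc]
    abel
  have e2 : b * Q + b * R' * c * (W * Q) = 0 := by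
    have := congr_arg (b * R' * ·) e0
    simp only [Matrix.add_mul, Matrix.mul_add] at this
    have f1 : b * R' * (shifted M' q * Q) = b * Q := by
      rw [← Matrix.mul_assoc, Matrix.mul_assoc b, hR', resolvent_mul_shifted M' z hη,
        Matrix.mul_one]
    have f2 : b * R' * V = 0 := by rw [Matrix.mul_assoc, hbR'V]
    rw [f1, Matrix.mul_assoc V, ← Matrix.mul_assoc _ V, Matrix.mul_assoc V, ← Matrix.mul_assoc _ V,
      f2, Matrix.zero_mul, Matrix.zero_mul, add_zero, add_zero, Matrix.mul_assoc c,
      ← Matrix.mul_assoc _ c] at this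
    exact this
  have hS : schurForm R' (crossPairs Y k) = b * R' * c := by
    have hn : ((√n : ℝ) : ℂ)⁻¹ * ((√n : ℝ) : ℂ)⁻¹ = (n : ℂ)⁻¹ := by
      rw [← mul_inv, ← Complex.ofReal_mul, Real.mul_self_sqrt (by positivity)]
      simp
    ext s t
    rw [schurForm, Matrix.of_apply, ← hn, Finset.sum_comm, Finset.mul_sum, Matrix.mul_apply,
      Fintype.sum_prod_type]
    refine Finset.sum_congr rfl fun j _ => ?_
    simp only [Matrix.mul_apply, Fintype.sum_prod_type, b, c, Matrix.of_apply, Fin.sum_univ_two]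
    rw [Finset.mul_sum]
    fin_cases s <;> fin_cases t <;>
      simp [offDiag, rowVar, colVar, crossPairs, Finset.sum_mul] <;>
      exact Finset.sum_congr rfl fun i _ => by ring
  rw [hr, hS, sub_mul]
  rw [← e1, eq_neg_of_add_eq_zero_left e2, sub_eq_add_neg]

/-- The deterministic part of the fixed point equation. The diagonal block of the resolvent is
compared with the one of the perturbed matrix from `laplacian_add_diagonal_apply`, which costs the
maximum of `|Y i k| / √n`, and the latter is given by the Schur complement formula. -/
lemma norm_resolvent_add_inv_fixedPointMat_le (hη : 0 < η.im) (hY : ∀ i, Y i i = 0) {γ : ℝ}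
    {α β δ : ℂ} (hγ : |γ| ≤ 1) (h : ‖δ - conj β‖ ≤ 2 * α.im) (s t : Fin 2) :
    ‖resolvent (laplacian Y) (qMat z η) (k, s) (k, t) +
        (fixedPointMat γ (qMat z η) α β δ (laplacian Y k k))⁻¹ s t‖ ≤
      η.im⁻¹ ^ 2 * (‖fun i => Y i k‖ / √n) + η.im⁻¹ ^ 2 * ∑ u, ∑ v,
        ‖(schurForm (resolvent (laplacian (zeroCross Y k)) (qMat z η)) (crossPairs Y k) -
          !![α, γ * δ; γ * β, α]) u v‖ := by
  have h1 := norm_resolvent_sub_apply_le (laplacian Y) z hη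
    (d := fun i => ((√n : ℝ) : ℂ)⁻¹ * Y i k) (C := ‖fun i => Y i k‖ / √n) (by positivity)
    (fun i => by
      rw [norm_mul, norm_inv, Complex.norm_real, Real.norm_of_nonneg (by positivity),
        inv_mul_eq_div]
      gcongr
      exact norm_le_pi_norm (fun i => Y i k) i) (k, s) (k, t)
  have h2 := norm_add_inv_fixedPointMat_apply_le hη hγ h (laplacian Y k k)
    (schurForm_mul_diagBlock Y z k hη hY) (fun s t => norm_diagBlock_apply_le _ z hη k s t) s t
  refine le_trans (le_trans (le_of_eq ?_) (norm_add_le _ _)) (add_le_add h1 h2)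
  rw [diagBlock, Matrix.submatrix_apply]
  congr 1
  ring

end Schur

end Deterministic

/-! ### The Efron-Stein inequality -/

section EfronStein

/-- The bias-variance decomposition of a bounded complex random variable. -/
lemma integral_norm_sub_sq {Ω : Type*} [MeasurableSpace Ω] {P : Measure Ω} [IsProbabilityMeasure P]
    {f : Ω → ℂ} (hf : MemLp f 2 P) (a : ℂ) :
    ∫ ω, ‖f ω - a‖ ^ 2 ∂P = ∫ ω, ‖f ω - ∫ x, f x ∂P‖ ^ 2 ∂P + ‖∫ x, f x ∂P - a‖ ^ 2 := by
  set m := ∫ x, f x ∂P with hm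
  have hi : Integrable f P := hf.integrable (by norm_num)
  have h1 : ∀ ω, ‖f ω - a‖ ^ 2 = ‖f ω - m‖ ^ 2 + ‖m - a‖ ^ 2 +
      2 * ((f ω - m) * conj (m - a)).re := by
    intro ω
    have : f ω - a = (f ω - m) + (m - a) := by ring
    rw [this, ← Complex.normSq_eq_norm_sq, Complex.normSq_add, Complex.normSq_eq_norm_sq,
      Complex.normSq_eq_norm_sq]
  have h2 : Integrable (fun ω => ‖f ω - m‖ ^ 2) P := (hf.sub (memLp_const m)).integrable_norm_pow
    (by norm_num)
  have h3 : Integrable (fun ω => (f ω - m) * conj (m - a)) P :=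
    (hi.sub (integrable_const m)).mul_const _
  have h5 : Integrable (fun ω => 2 * ((f ω - m) * conj (m - a)).re) P := h3.re.const_mul 2
  have h6 : Integrable (fun ω => ‖f ω - m‖ ^ 2 + ‖m - a‖ ^ 2) P := h2.add (integrable_const _)
  simp only [h1]
  rw [integral_add h6 h5, integral_add h2 (integrable_const _), integral_const_mul]
  have h4 : ∫ ω, ((f ω - m) * conj (m - a)).re ∂P = 0 := by
    have := integral_re h3
    simp only [RCLike.re_to_complex] at this
    rw [this, integral_mul_const, integral_sub hi (integrable_const m)]
    simp [← hm]
  rw [h4]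
  simp

/-- **Efron-Stein inequality**, in the form of bounded differences with respect to replacing one
coordinate by the fixed value `e`. -/
theorem integral_norm_sub_integral_sq_le {E : Type*} [MeasurableSpace E] (e : E) :
    ∀ {m : ℕ} (ν : Fin m → Measure E) [∀ i, IsProbabilityMeasure (ν i)] {F : (Fin m → E) → ℂ}
      (_ : Measurable F) {C : ℝ} (_ : ∀ w, ‖F w‖ ≤ C) {δ : Fin m → E → ℝ}
      (_ : ∀ i, Integrable (fun x => δ i x ^ 2) (ν i))
      (_ : ∀ w i, ‖F w - F (Function.update w i e)‖ ≤ δ i (w i)),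
      ∫ w, ‖F w - ∫ w', F w' ∂(Measure.pi ν)‖ ^ 2 ∂(Measure.pi ν) ≤ ∑ i, ∫ x, δ i x ^ 2 ∂(ν i) := by
  intro m
  induction m with
  | zero =>
    intro ν _ F _ C _ δ _ _
    rw [Measure.pi_of_empty (x := fun i => i.elim0)]
    simp
  | succ m ih =>
    intro ν _ F hF C hC δ hδ hd
    have hmp := (measurePreserving_piFinSuccAbove ν 0).symm
    simp only [Fin.zero_succAbove] at hmp
    set ν' : Fin m → Measure E := fun j => ν j.succ with hν'
    set m₀ := ∫ w', F w' ∂(Measure.pi ν) with hm₀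
    let G : E × (Fin m → E) → ℂ := fun p => F (Fin.cons p.1 p.2)
    have hcons : Measurable fun p : E × (Fin m → E) => (Fin.cons p.1 p.2 : Fin (m + 1) → E) := by
      refine measurable_pi_iff.2 fun i => ?_
      refine Fin.cases ?_ (fun j => ?_) i
      · simpa using measurable_fst
      · simp only [Fin.cons_succ]
        exact (measurable_pi_apply j).comp measurable_snd
    have hsymm : ∀ p : E × (Fin m → E), (MeasurableEquiv.piFinSuccAbove (fun _ => E) 0).symm p =
        (Fin.cons p.1 p.2 : Fin (m + 1) → E) := fun p => by
      simp [MeasurableEquiv.piFinSuccAbove_symm_apply, Fin.insertNthEquiv]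
    have hG : Measurable G := hF.comp hcons
    have hmap : ∀ f : (Fin (m + 1) → E) → ℝ, ∫ w, f w ∂(Measure.pi ν) =
        ∫ p, f (Fin.cons p.1 p.2) ∂((ν 0).prod (Measure.pi ν')) := by
      intro f
      rw [← hmp.integral_comp']
      simp only [hsymm]
    have hmapC : ∀ f : (Fin (m + 1) → E) → ℂ, ∫ w, f w ∂(Measure.pi ν) =
        ∫ p, f (Fin.cons p.1 p.2) ∂((ν 0).prod (Measure.pi ν')) := by
      intro f
      rw [← hmp.integral_comp']
      simp only [hsymm]
    have hb : ∀ {Ω : Type _} [MeasurableSpace Ω] {Q : Measure Ω} [IsProbabilityMeasure Q]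
        {f : Ω → ℂ} {p : ENNReal}, Measurable f → (∀ ω, ‖f ω‖ ≤ C) → MemLp f p Q :=
      fun hf hfC => MemLp.of_bound hf.aestronglyMeasurable C (ae_of_all _ hfC)
    let g : E → ℂ := fun x => ∫ y, G (x, y) ∂(Measure.pi ν')
    have hg : Measurable g := (hG.stronglyMeasurable.integral_prod_right').measurable
    have hGC : ∀ p, ‖G p‖ ≤ C := fun p => hC _
    have hgC : ∀ x, ‖g x‖ ≤ C := fun x => by
      refine (norm_integral_le_of_norm_le_const (ae_of_all _ fun y => hGC (x, y))).trans ?_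
      simp
    have hGi : Integrable G ((ν 0).prod (Measure.pi ν')) := memLp_one_iff_integrable.1 (hb hG hGC)
    have hm₁ : m₀ = ∫ x, g x ∂(ν 0) := by
      rw [hm₀, hmapC, integral_prod _ hGi]
    have hsq : Integrable (fun p => ‖G p - m₀‖ ^ 2) ((ν 0).prod (Measure.pi ν')) :=
      ((hb hG hGC).sub (memLp_const m₀)).integrable_norm_pow (p := 2) (by norm_num)
    rw [hmap]
    change ∫ p, ‖G p - m₀‖ ^ 2 ∂((ν 0).prod (Measure.pi ν')) ≤ _
    rw [integral_prod _ hsq]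
    -- the conditional variance given the first coordinate, by induction
    have h1 : ∀ x, ∫ y, ‖G (x, y) - m₀‖ ^ 2 ∂(Measure.pi ν') ≤
        ∑ i : Fin m, ∫ a, δ i.succ a ^ 2 ∂(ν i.succ) + ‖g x - m₀‖ ^ 2 := by
      intro x
      rw [integral_norm_sub_sq (f := fun y => G (x, y))
        (hb (hG.comp measurable_prodMk_left) fun y => hGC (x, y)) m₀]
      refine add_le_add ?_ le_rfl
      refine ih ν' (F := fun y => G (x, y)) (hG.comp measurable_prodMk_left) (fun y => hGC (x, y))
        (fun i => hδ i.succ) fun y i => ?_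
      have := hd (Fin.cons x y) i.succ
      rwa [← Fin.cons_update, Fin.cons_succ] at this
    -- the variance of the conditional expectation
    have h2 : ∫ x, ‖g x - m₀‖ ^ 2 ∂(ν 0) ≤ ∫ x, δ 0 x ^ 2 ∂(ν 0) := by
      have h3 := integral_norm_sub_sq (hb hg hgC : MemLp g 2 (ν 0)) (g e)
      have h4 : ∫ x, ‖g x - g e‖ ^ 2 ∂(ν 0) ≤ ∫ x, δ 0 x ^ 2 ∂(ν 0) := by
        refine integral_mono (((hb hg hgC).sub (memLp_const _)).integrable_norm_pow (p := 2)
          (by norm_num)) (hδ 0) fun x => ?_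
        refine pow_le_pow_left₀ (norm_nonneg _) ?_ 2
        have hi : ∀ x, Integrable (fun y => G (x, y)) (Measure.pi ν') := fun x =>
          memLp_one_iff_integrable.1 (hb (hG.comp measurable_prodMk_left) fun y => hGC (x, y))
        simp only [g]
        rw [← integral_sub (hi x) (hi e)]
        refine (norm_integral_le_of_norm_le_const (C := δ 0 x) (ae_of_all _ fun y => ?_)).trans ?_
        · have := hd (Fin.cons x y) 0
          rw [Fin.update_cons_zero] at this
          simpa using this
        · simp
      rw [← hm₁] at h3
      nlinarith [sq_nonneg ‖m₀ - g e‖]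
    have hgi : Integrable (fun x => ‖g x - m₀‖ ^ 2) (ν 0) :=
      ((hb hg hgC).sub (memLp_const _)).integrable_norm_pow (p := 2) (by norm_num)
    calc _ ≤ ∫ x, (∑ i : Fin m, ∫ a, δ i.succ a ^ 2 ∂(ν i.succ) + ‖g x - m₀‖ ^ 2) ∂(ν 0) :=
          integral_mono hsq.integral_prod_left ((integrable_const _).add hgi) h1
      _ = ∑ i : Fin m, ∫ a, δ i.succ a ^ 2 ∂(ν i.succ) + ∫ x, ‖g x - m₀‖ ^ 2 ∂(ν 0) := by
          rw [integral_add (integrable_const _) hgi]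
          simp
      _ ≤ _ := by
          rw [Fin.sum_univ_succ, add_comm]
          gcongr

end EfronStein

/-! ### Concentration of quadratic forms -/

section QuadraticForm

lemma lintegral_enorm_le_of_integral_sq_le {Ω : Type*} [MeasurableSpace Ω] {P : Measure Ω}
    [IsProbabilityMeasure P] {f : Ω → ℂ} (hf : MemLp f 2 P) {B : ℝ}
    (hB : ∫ ω, ‖f ω‖ ^ 2 ∂P ≤ B) : ∫⁻ ω, ‖f ω‖ₑ ∂P ≤ ENNReal.ofReal (√B) := by
  rw [← eLpNorm_one_eq_lintegral_enorm]
  refine (eLpNorm_le_eLpNorm_of_exponent_le (by norm_num : (1 : ENNReal) ≤ 2)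
    hf.aestronglyMeasurable).trans ?_
  rw [hf.eLpNorm_eq_integral_rpow_norm (by norm_num) (by norm_num)]
  refine ENNReal.ofReal_le_ofReal ?_
  simp only [ENNReal.toReal_ofNat, Real.rpow_ofNat]
  rw [inv_eq_one_div, ← Real.sqrt_eq_rpow]
  exact Real.sqrt_le_sqrt hB

/-- The second moment of a linear combination in terms of the Gram matrix. -/
lemma integral_norm_sum_sq {Ω κ : Type*} [MeasurableSpace Ω] {P : Measure Ω}
    (S : Finset κ) {Z : κ → Ω → ℂ} (hZ : ∀ p ∈ S, MemLp (Z p) 2 P) (a : κ → ℂ) :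
    ((∫ ω, ‖∑ p ∈ S, a p * Z p ω‖ ^ 2 ∂P : ℝ) : ℂ) =
      ∑ p ∈ S, ∑ q ∈ S, a p * conj (a q) * ∫ ω, Z p ω * conj (Z q ω) ∂P := by
  have hint : ∀ p ∈ S, ∀ q ∈ S, Integrable (fun ω => Z p ω * conj (Z q ω)) P := fun p hp q hq =>
    (hZ p hp).integrable_mul (hZ q hq).star
  have h1 : ∀ ω, ((‖∑ p ∈ S, a p * Z p ω‖ ^ 2 : ℝ) : ℂ) =
      ∑ p ∈ S, ∑ q ∈ S, a p * conj (a q) * (Z p ω * conj (Z q ω)) := by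
    intro ω
    push_cast
    rw [← Complex.mul_conj', map_sum, Finset.sum_mul_sum]
    refine Finset.sum_congr rfl fun p _ => Finset.sum_congr rfl fun q _ => ?_
    rw [map_mul]; ring
  rw [← integral_complex_ofReal]
  simp only [h1]
  rw [integral_finsetSum _ fun p hp => integrable_finsetSum _ fun q hq =>
    (hint p hp q hq).const_mul _]
  refine Finset.sum_congr rfl fun p hp => ?_
  rw [integral_finsetSum _ fun q hq => (hint p hp q hq).const_mul _]
  exact Finset.sum_congr rfl fun q _ => integral_const_mul _ _

variable {n : ℕ} {E : Type*} [MeasurableSpace E] (ν : Fin n → Measure E)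
  [∀ i, IsProbabilityMeasure (ν i)] {u v : E → ℂ}

omit [MeasurableSpace E] in
lemma norm_mul_eval_sq_eq_prod (u v : E → ℂ) (i j : Fin n) (w : Fin n → E) :
    ‖u (w i) * v (w j)‖ ^ 2 = ∏ m, (fun m x => (if m = i then ‖u x‖ ^ 2 else 1) *
      (if m = j then ‖v x‖ ^ 2 else 1)) m (w m) := by
  simp only [Finset.prod_mul_distrib, Finset.prod_ite_eq', Finset.mem_univ, if_true, norm_mul,
    mul_pow]

lemma memLp_mul_eval (hu : ∀ i, MemLp u 2 (ν i)) (hv : ∀ i, MemLp v 2 (ν i)) {i j : Fin n}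
    (hij : i ≠ j) : MemLp (fun w : Fin n → E => u (w i) * v (w j)) 2 (Measure.pi ν) := by
  have hm : AEStronglyMeasurable (fun w : Fin n → E => u (w i) * v (w j)) (Measure.pi ν) :=
    ((hu i).aestronglyMeasurable.comp_measurePreserving (measurePreserving_eval ν i)).mul
      ((hv j).aestronglyMeasurable.comp_measurePreserving (measurePreserving_eval ν j))
  rw [memLp_two_iff_integrable_sq_norm hm]
  refine Integrable.congr (Integrable.fintype_prod (f := fun m x =>
    (if m = i then ‖u x‖ ^ 2 else 1) * (if m = j then ‖v x‖ ^ 2 else 1)) fun m => ?_)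
    (ae_of_all _ fun w => (norm_mul_eval_sq_eq_prod u v i j w).symm)
  by_cases hi : m = i
  · subst hi
    simpa [hij] using (hu m).integrable_norm_pow (by norm_num)
  · by_cases hj : m = j
    · subst hj
      simpa [hi] using (hv m).integrable_norm_pow (by norm_num)
    · simp [hi, hj]

lemma integral_norm_mul_eval_sq_le (hu1 : ∀ i, ∫ x, ‖u x‖ ^ 2 ∂(ν i) ≤ 1)
    (hv1 : ∀ i, ∫ x, ‖v x‖ ^ 2 ∂(ν i) ≤ 1) {i j : Fin n} (hij : i ≠ j) :
    ∫ w, ‖u (w i) * v (w j)‖ ^ 2 ∂(Measure.pi ν) ≤ 1 := by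
  rw [integral_congr_ae (ae_of_all _ fun w => norm_mul_eval_sq_eq_prod u v i j w),
    integral_fintype_prod_eq_prod (fun m x =>
      (if m = i then ‖u x‖ ^ 2 else 1) * (if m = j then ‖v x‖ ^ 2 else 1))]
  refine Finset.prod_le_one (fun m _ => integral_nonneg fun x => ?_) fun m _ => ?_
  · dsimp only; split_ifs <;> positivity
  · by_cases hi : m = i
    · subst hi
      simpa [hij] using hu1 m
    · by_cases hj : m = j
      · subst hj
        simpa [hi] using hv1 m
      · simp [hi, hj]

/-- A product in which some coordinate occurs exactly once, as an argument of a centered function,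
is centered. -/
lemma integral_mul_conj_mul_eval_eq_zero (hu0 : ∀ i, ∫ x, u x ∂(ν i) = 0)
    (hv0 : ∀ i, ∫ x, v x ∂(ν i) = 0) {i j k l : Fin n} (hij : i ≠ j)
    (h1 : ¬ (k = i ∧ l = j)) (h2 : ¬ (k = j ∧ l = i)) :
    ∫ w, u (w i) * v (w j) * conj (u (w k) * v (w l)) ∂(Measure.pi ν) = 0 := by
  have h : ∀ w : Fin n → E, u (w i) * v (w j) * conj (u (w k) * v (w l)) =
      ∏ m, (fun m x => (if m = i then u x else 1) * (if m = j then v x else 1) *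
        ((if m = k then conj (u x) else 1) * (if m = l then conj (v x) else 1))) m (w m) := by
    intro w
    simp only [Finset.prod_mul_distrib, Finset.prod_ite_eq', Finset.mem_univ, if_true, map_mul]
  rw [integral_congr_ae (ae_of_all _ h), integral_fintype_prod_eq_prod (fun m x =>
    (if m = i then u x else 1) * (if m = j then v x else 1) *
      ((if m = k then conj (u x) else 1) * (if m = l then conj (v x) else 1)))]
  by_cases hi : i = k ∨ i = l
  · have hj : j ≠ k ∧ j ≠ l := by
      grind
    refine Finset.prod_eq_zero (Finset.mem_univ j) ?_
    simpa [hij.symm, hj.1, hj.2] using hv0 j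
  · push Not at hi
    refine Finset.prod_eq_zero (Finset.mem_univ i) ?_
    simpa [hij, hi.1, hi.2] using hu0 i

/-- The off-diagonal part of a quadratic form in centered independent pairs: the products
`u (w i) * v (w j)`, `i ≠ j`, are orthogonal up to exchanging `i` and `j`. -/
lemma integral_norm_offDiag_sum_sq_le (hu : ∀ i, MemLp u 2 (ν i)) (hv : ∀ i, MemLp v 2 (ν i))
    (hu0 : ∀ i, ∫ x, u x ∂(ν i) = 0) (hv0 : ∀ i, ∫ x, v x ∂(ν i) = 0)
    (hu1 : ∀ i, ∫ x, ‖u x‖ ^ 2 ∂(ν i) ≤ 1) (hv1 : ∀ i, ∫ x, ‖v x‖ ^ 2 ∂(ν i) ≤ 1)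
    (r : Matrix (Fin n) (Fin n) ℂ) :
    ∫ w, ‖∑ p ∈ Finset.univ.offDiag, r p.1 p.2 * (u (w p.1) * v (w p.2))‖ ^ 2 ∂(Measure.pi ν) ≤
      2 * ∑ i, ∑ j, ‖r i j‖ ^ 2 := by
  set S : Finset (Fin n × Fin n) := Finset.univ.offDiag with hS
  have hne : ∀ p ∈ S, p.1 ≠ p.2 := fun p hp => by simpa [hS] using hp
  let Z : Fin n × Fin n → (Fin n → E) → ℂ := fun p w => u (w p.1) * v (w p.2)
  have hZ : ∀ p ∈ S, MemLp (Z p) 2 (Measure.pi ν) := fun p hp => memLp_mul_eval ν hu hv (hne p hp)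
  have hc : ∀ p ∈ S, ∀ q ∈ S, ‖∫ w, Z p w * conj (Z q w) ∂(Measure.pi ν)‖ ≤ 1 := by
    intro p hp q hq
    have h1 : ∀ w, ‖Z p w * conj (Z q w)‖ ≤ (‖Z p w‖ ^ 2 + ‖Z q w‖ ^ 2) / 2 := fun w => by
      rw [norm_mul, Complex.norm_conj]
      nlinarith [sq_nonneg (‖Z p w‖ - ‖Z q w‖)]
    have hi : ∀ p ∈ S, Integrable (fun w => ‖Z p w‖ ^ 2) (Measure.pi ν) := fun p hp =>
      (hZ p hp).integrable_norm_pow (p := 2) (by norm_num)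
    refine (norm_integral_le_of_norm_le (((hi p hp).add (hi q hq)).div_const 2)
      (ae_of_all _ h1)).trans ?_
    rw [integral_div]
    have h2 := integral_norm_mul_eval_sq_le ν hu1 hv1 (hne p hp)
    have h3 := integral_norm_mul_eval_sq_le ν hu1 hv1 (hne q hq)
    have h4 : ∫ w, ((fun w => ‖Z p w‖ ^ 2) + fun w => ‖Z q w‖ ^ 2) w ∂(Measure.pi ν) ≤ 2 := by
      rw [integral_add' (hi p hp) (hi q hq)]
      linarith
    linarith
  have h0 : ∀ p ∈ S, ∀ q ∈ S, q ≠ p → q ≠ p.swap →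
      ∫ w, Z p w * conj (Z q w) ∂(Measure.pi ν) = 0 := by
    intro p hp q hq h1 h2
    refine integral_mul_conj_mul_eval_eq_zero ν hu0 hv0 (hne p hp) ?_ ?_
    · rintro ⟨h3, h4⟩; exact h1 (Prod.ext h3 h4)
    · rintro ⟨h3, h4⟩; exact h2 (Prod.ext h3 h4)
  have key := integral_norm_sum_sq S hZ fun p => r p.1 p.2
  have h5 : ∀ p ∈ S, ‖∑ q ∈ S, r p.1 p.2 * conj (r q.1 q.2) *
      ∫ w, Z p w * conj (Z q w) ∂(Measure.pi ν)‖ ≤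
        3 / 2 * ‖r p.1 p.2‖ ^ 2 + 1 / 2 * ‖r p.2 p.1‖ ^ 2 := by
    intro p hp
    have hsub : ({p, p.swap} : Finset (Fin n × Fin n)) ⊆ S := by
      intro q hq
      simp only [Finset.mem_insert, Finset.mem_singleton] at hq
      rcases hq with rfl | rfl
      · exact hp
      · simpa [hS] using (hne p hp).symm
    rw [← Finset.sum_subset hsub fun q hq hq' => by
      simp only [Finset.mem_insert, Finset.mem_singleton, not_or] at hq'
      rw [h0 p hp q hq hq'.1 hq'.2, mul_zero]]
    have hps : p ≠ p.swap := fun h => hne p hp (congr_arg Prod.fst h)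
    rw [Finset.sum_pair hps]
    have hb : ∀ q ∈ S, ‖r p.1 p.2 * conj (r q.1 q.2) *
        ∫ w, Z p w * conj (Z q w) ∂(Measure.pi ν)‖ ≤ ‖r p.1 p.2‖ * ‖r q.1 q.2‖ := by
      intro q hq
      rw [norm_mul, norm_mul, Complex.norm_conj]
      exact mul_le_of_le_one_right (by positivity) (hc p hp q hq)
    have h6 := hb p hp
    have h7 := hb p.swap (hsub (by simp))
    refine (norm_add_le _ _).trans ((add_le_add h6 h7).trans ?_)
    simp only [Prod.fst_swap, Prod.snd_swap]
    nlinarith [sq_nonneg (‖r p.1 p.2‖ - ‖r p.2 p.1‖)]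
  have h8 : ∑ p ∈ S, (3 / 2 * ‖r p.1 p.2‖ ^ 2 + 1 / 2 * ‖r p.2 p.1‖ ^ 2) ≤
      2 * ∑ i, ∑ j, ‖r i j‖ ^ 2 := by
    refine (Finset.sum_le_sum_of_subset_of_nonneg (Finset.subset_univ S)
      fun _ _ _ => by positivity).trans (le_of_eq ?_)
    rw [Fintype.sum_prod_type]
    simp only [Finset.sum_add_distrib, ← Finset.mul_sum]
    rw [Finset.sum_comm (f := fun i j => ‖r j i‖ ^ 2)]
    ring
  calc _ ≤ ‖((∫ w, ‖∑ p ∈ S, r p.1 p.2 * Z p w‖ ^ 2 ∂(Measure.pi ν) : ℝ) : ℂ)‖ := by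
        rw [Complex.norm_real]
        exact Real.le_norm_self _
    _ ≤ _ := by
        rw [key]
        exact (norm_sum_le _ _).trans ((Finset.sum_le_sum h5).trans h8)

/-- Weak law of large numbers for weighted sums of uniformly integrable independent variables:
the truncated variables are controlled by the Efron-Stein inequality. -/
lemma lintegral_enorm_weighted_sum_le [Inhabited E] {f : E → ℂ} (hf : Measurable f)
    (hfi : ∀ i, Integrable f (ν i)) {K τ C : ℝ} (hK : 0 ≤ K) (hτ : 0 ≤ τ) (hC : 0 ≤ C)
    (htail : ∀ i, ∫ x, {x | K < ‖f x‖}.indicator (fun x => ‖f x‖) x ∂(ν i) ≤ τ)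
    {a : Fin n → ℂ} (ha : ∀ i, ‖a i‖ ≤ C) :
    ∫⁻ w, ‖∑ i, a i * (f (w i) - ∫ x, f x ∂(ν i))‖ₑ ∂(Measure.pi ν) ≤
      ENNReal.ofReal (2 * C * K * √n + 2 * C * τ * n) := by
  set T : Set E := {x | K < ‖f x‖} with hT
  have hTm : MeasurableSet T := measurableSet_lt measurable_const hf.norm
  set g : E → ℂ := Tᶜ.indicator f with hg
  set h : E → ℂ := T.indicator f with hh
  have hgh : ∀ x, f x = g x + h x := fun x => (Set.indicator_compl_add_self_apply T f x).symm
  have hgm : Measurable g := hf.indicator hTm.compl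
  have hgK : ∀ x, ‖g x‖ ≤ K := fun x => by
    by_cases hx : x ∈ T
    · simpa [hg, hx] using hK
    · simpa [hg, hx] using not_lt.1 hx
  have hgi : ∀ i, Integrable g (ν i) := fun i => (hfi i).indicator hTm.compl
  have hhi : ∀ i, Integrable h (ν i) := fun i => (hfi i).indicator hTm
  have hhτ : ∀ i, ∫ x, ‖h x‖ ∂(ν i) ≤ τ := fun i => by
    simpa only [hh, norm_indicator_eq_indicator_norm] using htail i
  let G : (Fin n → E) → ℂ := fun w => ∑ i, a i * g (w i)
  have hGm : Measurable G := Finset.measurable_fun_sum _ fun i _ =>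
    (hgm.comp (measurable_pi_apply i)).const_mul _
  have hGb : ∀ w, ‖G w‖ ≤ n * (C * K) := fun w => by
    refine (norm_sum_le _ _).trans ((Finset.sum_le_sum fun i _ => ?_).trans
      (by simp : ∑ _i : Fin n, C * K ≤ n * (C * K)))
    rw [norm_mul]
    exact mul_le_mul (ha i) (hgK _) (norm_nonneg _) hC
  have heval : ∀ {φ : E → ℂ} (i : Fin n), Integrable φ (ν i) →
      Integrable (fun w : Fin n → E => φ (w i)) (Measure.pi ν) := fun i hφ =>
    (measurePreserving_eval ν i).integrable_comp_of_integrable hφ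
  have hGint : ∫ w, G w ∂(Measure.pi ν) = ∑ i, a i * ∫ x, g x ∂(ν i) := by
    rw [integral_finsetSum _ fun i _ => (heval i (hgi i)).const_mul _]
    refine Finset.sum_congr rfl fun i _ => ?_
    rw [integral_const_mul, ← (measurePreserving_eval ν i).map_eq,
      integral_map (measurable_pi_apply i).aemeasurable hgm.aestronglyMeasurable]
  have h1 : ∫⁻ w, ‖G w - ∫ w', G w' ∂(Measure.pi ν)‖ₑ ∂(Measure.pi ν) ≤
      ENNReal.ofReal (2 * C * K * √n) := by
    have hv := integral_norm_sub_integral_sq_le (default : E) ν hGm hGb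
      (δ := fun _ _ => 2 * C * K) (fun i => integrable_const _) fun w i => by
        have : G w - G (Function.update w i default) = a i * (g (w i) - g default) := by
          simp only [G]
          rw [← Finset.sum_sub_distrib, Finset.sum_eq_single i]
          · simp [mul_sub]
          · intro j _ hj; simp [hj]
          · simp
        rw [this, norm_mul]
        calc ‖a i‖ * ‖g (w i) - g default‖ ≤ C * (K + K) := by
              gcongr
              · exact ha i
              · exact (norm_sub_le _ _).trans (add_le_add (hgK _) (hgK _))
          _ = 2 * C * K := by ring
    refine (lintegral_enorm_le_of_integral_sq_le ?_ hv).trans_eq ?_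
    · exact (MemLp.of_bound hGm.aestronglyMeasurable _ (ae_of_all _ hGb)).sub (memLp_const _)
    · congr 1
      simp only [integral_const, probReal_univ, smul_eq_mul, one_mul, Finset.sum_const,
        Finset.card_univ, Fintype.card_fin, nsmul_eq_mul]
      rw [mul_comm (n : ℝ), Real.sqrt_mul (by positivity), Real.sqrt_sq (by positivity)]
  have h2 : ∫⁻ w, ‖∑ i, a i * (h (w i) - ∫ x, h x ∂(ν i))‖ₑ ∂(Measure.pi ν) ≤
      ENNReal.ofReal (2 * C * τ * n) := by
    have hi : ∀ i, Integrable (fun w : Fin n → E => a i * (h (w i) - ∫ x, h x ∂(ν i)))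
        (Measure.pi ν) := fun i => ((heval i (hhi i)).sub (integrable_const _)).const_mul _
    rw [← ofReal_integral_norm_eq_lintegral_enorm (integrable_finsetSum _ fun i _ => hi i)]
    refine ENNReal.ofReal_le_ofReal ?_
    have hb : ∀ i, ∫ w, C * (‖h (w i)‖ + τ) ∂(Measure.pi ν) ≤ 2 * C * τ := fun i => by
      rw [integral_const_mul, integral_add (heval i (hhi i)).norm (integrable_const _)]
      have : ∫ w, ‖h (w i)‖ ∂(Measure.pi ν) = ∫ x, ‖h x‖ ∂(ν i) := by
        rw [← (measurePreserving_eval ν i).map_eq, integral_map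
          (measurable_pi_apply i).aemeasurable (hf.indicator hTm).norm.aestronglyMeasurable]
      rw [this]
      simp only [integral_const, probReal_univ, one_smul]
      nlinarith [hhτ i]
    calc _ ≤ ∫ w, ∑ i : Fin n, C * (‖h (w i)‖ + τ) ∂(Measure.pi ν) := by
          refine integral_mono (integrable_finsetSum _ fun i _ => hi i).norm
            (integrable_finsetSum _ fun i _ =>
              ((heval i (hhi i)).norm.add (integrable_const _)).const_mul _) fun w => ?_
          refine (norm_sum_le _ _).trans (Finset.sum_le_sum fun i _ => ?_)
          rw [norm_mul]
          refine mul_le_mul (ha i) ((norm_sub_le _ _).trans (add_le_add le_rfl ?_))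
            (norm_nonneg _) hC
          exact (norm_integral_le_integral_norm _).trans (hhτ i)
      _ = ∑ i : Fin n, ∫ w, C * (‖h (w i)‖ + τ) ∂(Measure.pi ν) :=
          integral_finsetSum _ fun i _ =>
            ((heval i (hhi i)).norm.add (integrable_const _)).const_mul _
      _ ≤ ∑ _i : Fin n, 2 * C * τ := Finset.sum_le_sum fun i _ => hb i
      _ = _ := by simp; ring
  have h3 : ∀ w : Fin n → E, ∑ i, a i * (f (w i) - ∫ x, f x ∂(ν i)) =
      (G w - ∫ w', G w' ∂(Measure.pi ν)) + ∑ i, a i * (h (w i) - ∫ x, h x ∂(ν i)) := by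
    intro w
    rw [hGint, ← Finset.sum_sub_distrib, ← Finset.sum_add_distrib]
    refine Finset.sum_congr rfl fun i _ => ?_
    have : ∫ x, f x ∂(ν i) = ∫ x, g x ∂(ν i) + ∫ x, h x ∂(ν i) := by
      rw [← integral_add (hgi i) (hhi i)]
      simp only [← hgh]
    rw [this, hgh]
    ring
  simp only [h3]
  rw [ENNReal.ofReal_add (by positivity) (by positivity)]
  refine (lintegral_mono fun w => enorm_add_le _ _).trans ?_
  rw [lintegral_add_left (hGm.sub_const _).enorm]
  exact add_le_add h1 h2

/-- Quadratic forms in independent centered pairs concentrate around their conditional mean, only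
second moments being required. -/
theorem lintegral_enorm_quadForm_le [Inhabited E] (hum : Measurable u) (hvm : Measurable v)
    (hu : ∀ i, MemLp u 2 (ν i)) (hv : ∀ i, MemLp v 2 (ν i))
    (hu0 : ∀ i, ∫ x, u x ∂(ν i) = 0) (hv0 : ∀ i, ∫ x, v x ∂(ν i) = 0)
    (hu1 : ∀ i, ∫ x, ‖u x‖ ^ 2 ∂(ν i) ≤ 1) (hv1 : ∀ i, ∫ x, ‖v x‖ ^ 2 ∂(ν i) ≤ 1)
    {K τ C : ℝ} (hK : 0 ≤ K) (hτ : 0 ≤ τ) (hC : 0 ≤ C)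
    (htail : ∀ i, ∫ x, {x | K < ‖u x * v x‖}.indicator (fun x => ‖u x * v x‖) x ∂(ν i) ≤ τ)
    {r : Matrix (Fin n) (Fin n) ℂ} (hr : ∀ i, ‖r i i‖ ≤ C)
    (hr2 : ∑ i, ∑ j, ‖r i j‖ ^ 2 ≤ n * C ^ 2) :
    ∫⁻ w, ‖∑ i, ∑ j, u (w i) * r i j * v (w j) -
        ∑ i, r i i * ∫ x, u x * v x ∂(ν i)‖ₑ ∂(Measure.pi ν) ≤
      ENNReal.ofReal (2 * C * (K + 1) * √n + 2 * C * τ * n) := by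
  have h1 : ∀ w : Fin n → E, ∑ i, ∑ j, u (w i) * r i j * v (w j) -
        ∑ i, r i i * ∫ x, u x * v x ∂(ν i) =
      ∑ p ∈ Finset.univ.offDiag, r p.1 p.2 * (u (w p.1) * v (w p.2)) +
        ∑ i, r i i * (u (w i) * v (w i) - ∫ x, u x * v x ∂(ν i)) := by
    intro w
    have e1 : ∑ i, ∑ j, u (w i) * r i j * v (w j) =
        ∑ p : Fin n × Fin n, r p.1 p.2 * (u (w p.1) * v (w p.2)) := by
      rw [Fintype.sum_prod_type]
      exact Finset.sum_congr rfl fun i _ => Finset.sum_congr rfl fun j _ => by ring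
    have e2 : (Finset.univ : Finset (Fin n × Fin n)) =
        Finset.univ.offDiag ∪ Finset.univ.diag := by
      ext p; simp [ne_or_eq]
    rw [e1, e2, Finset.sum_union (Finset.disjoint_diag_offDiag _).symm, Finset.sum_diag]
    simp only [mul_sub, Finset.sum_sub_distrib]
    ring
  simp only [h1]
  have hm : Measurable fun w : Fin n → E =>
      ∑ p ∈ Finset.univ.offDiag, r p.1 p.2 * (u (w p.1) * v (w p.2)) :=
    Finset.measurable_fun_sum _ fun p _ => ((hum.comp (measurable_pi_apply _)).mul
      (hvm.comp (measurable_pi_apply _))).const_mul _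
  refine (lintegral_mono fun w => enorm_add_le _ _).trans ?_
  rw [lintegral_add_left hm.enorm]
  have h2 := lintegral_enorm_weighted_sum_le ν (hum.mul hvm) (fun i => (hu i).integrable_mul (hv i))
    hK hτ hC htail hr
  have h3 := integral_norm_offDiag_sum_sq_le ν hu hv hu0 hv0 hu1 hv1 r
  have h4 : 2 * ∑ i, ∑ j, ‖r i j‖ ^ 2 ≤ (2 * C) ^ 2 * n := by
    nlinarith [sq_nonneg C, (Nat.cast_nonneg n : (0 : ℝ) ≤ n), mul_nonneg (sq_nonneg C)
      (Nat.cast_nonneg n : (0 : ℝ) ≤ n)]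
  have h5 : ∫⁻ w, ‖∑ p ∈ Finset.univ.offDiag, r p.1 p.2 * (u (w p.1) * v (w p.2))‖ₑ
      ∂(Measure.pi ν) ≤ ENNReal.ofReal (2 * C * √n) := by
    refine (lintegral_enorm_le_of_integral_sq_le ?_ (h3.trans h4)).trans_eq ?_
    · exact memLp_finsetSum _ fun p hp =>
        (memLp_mul_eval ν hu hv (by simpa using hp)).const_mul _
    · rw [Real.sqrt_mul (by positivity), Real.sqrt_sq (by positivity)]
  refine (add_le_add h5 h2).trans ?_
  rw [← ENNReal.ofReal_add (by positivity) (by positivity)]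
  exact ENNReal.ofReal_le_ofReal (le_of_eq (by ring))

end QuadraticForm

/-! ### Characteristic functions -/

section CharFun

lemma inner_complex (x t : ℂ) : inner ℝ x t = x.re * t.re + x.im * t.im := by
  rw [Complex.inner]
  simp
  ring

lemma posSemidef_diag {μ : ℝ} (h0 : 0 ≤ μ) (h1 : μ ≤ 1) :
    (!![μ, 0; 0, 1 - μ] : Matrix (Fin 2) (Fin 2) ℝ).PosSemidef := by
  have : (!![μ, 0; 0, 1 - μ] : Matrix (Fin 2) (Fin 2) ℝ) = diagonal ![μ, 1 - μ] := by
    ext i j; fin_cases i <;> fin_cases j <;> simp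
  rw [this]
  refine PosSemidef.diagonal fun i => ?_
  fin_cases i <;> simp [h0, h1]

lemma measurable_complex_mk :
    Measurable fun v : EuclideanSpace ℝ (Fin 2) => (⟨v 0, v 1⟩ : ℂ) := by
  have : (fun v : EuclideanSpace ℝ (Fin 2) => (⟨v 0, v 1⟩ : ℂ)) =
      fun v => ((v 0 : ℝ) : ℂ) + ((v 1 : ℝ) : ℂ) * Complex.I := by
    ext v; exact Complex.mk_eq_add_mul_I _ _
  rw [this]
  fun_prop

instance isProbabilityMeasure_gaussianLaw (μ : ℝ) : IsProbabilityMeasure (gaussianLaw μ) :=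
  Measure.isProbabilityMeasure_map measurable_complex_mk.aemeasurable

lemma charFun_gaussianLaw {μ : ℝ} (h0 : 0 ≤ μ) (h1 : μ ≤ 1) (t : ℂ) :
    charFun (gaussianLaw μ) t =
      Complex.exp (-((μ * t.re ^ 2 + (1 - μ) * t.im ^ 2 : ℝ) : ℂ) / 2) := by
  have h2 := charFun_multivariateGaussian (μ := 0) (posSemidef_diag h0 h1)
    (WithLp.toLp 2 ![t.re, t.im])
  have h3 : charFun (gaussianLaw μ) t = charFun (multivariateGaussian 0 !![μ, 0; 0, 1 - μ])
      (WithLp.toLp 2 ![t.re, t.im]) := by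
    rw [charFun_apply, charFun_apply, gaussianLaw,
      integral_map measurable_complex_mk.aemeasurable (by fun_prop)]
    refine integral_congr_ae (ae_of_all _ fun v => ?_)
    simp only [inner_complex]
    simp [PiLp.inner_apply, mul_comm]
  rw [h3, h2]
  congr 1
  simp [dotProduct, mulVec, Fin.sum_univ_two]
  ring

lemma norm_prod_sub_prod_le {ι : Type*} (S : Finset ι) {a b : ι → ℂ} (ha : ∀ i, ‖a i‖ ≤ 1)
    (hb : ∀ i, ‖b i‖ ≤ 1) : ‖∏ i ∈ S, a i - ∏ i ∈ S, b i‖ ≤ ∑ i ∈ S, ‖a i - b i‖ := by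
  classical
  induction S using Finset.induction_on with
  | empty => simp
  | insert i S hi ih =>
    rw [Finset.prod_insert hi, Finset.prod_insert hi, Finset.sum_insert hi]
    have e : a i * ∏ j ∈ S, a j - b i * ∏ j ∈ S, b j =
        (a i - b i) * ∏ j ∈ S, a j + b i * (∏ j ∈ S, a j - ∏ j ∈ S, b j) := by ring
    rw [e]
    refine (norm_add_le _ _).trans (add_le_add ?_ ?_)
    · rw [norm_mul]
      refine mul_le_of_le_one_right (norm_nonneg _) ?_
      rw [norm_prod]
      exact Finset.prod_le_one (fun _ _ => norm_nonneg _) fun j _ => ha j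
    · rw [norm_mul]
      exact (mul_le_of_le_one_left (norm_nonneg _) (hb i)).trans ih

variable {Ω₀ : Type*} [MeasurableSpace Ω₀] {P₀ : Measure Ω₀} [IsProbabilityMeasure P₀]

/-- Second order expansion of the characteristic function of a centered complex random variable
with uncorrelated real and imaginary parts along the line through `t`. -/
lemma charFun_map_smul_sub_isLittleO {ξ : Ω₀ → ℂ} (hξ : MemLp ξ 2 P₀) {μ : ℝ}
    (h0 : ∫ ω, ξ ω ∂P₀ = 0) (hre : ∫ ω, (ξ ω).re ^ 2 ∂P₀ = μ)
    (him : ∫ ω, (ξ ω).im ^ 2 ∂P₀ = 1 - μ) (hri : ∫ ω, (ξ ω).re * (ξ ω).im ∂P₀ = 0) (t : ℂ) :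
    (fun s : ℝ => charFun (P₀.map ξ) (s • t) -
      (1 - ((μ * t.re ^ 2 + (1 - μ) * t.im ^ 2 : ℝ) : ℂ) * s ^ 2 / 2)) =o[𝓝 0] fun s => s ^ 2 := by
  let X : Ω₀ → ℝ := fun ω => (ξ ω).re * t.re + (ξ ω).im * t.im
  have hXm : MemLp X 2 P₀ := (hξ.re.mul_const t.re).add (hξ.im.mul_const t.im)
  have hre2 : MemLp (fun ω => (ξ ω).re) 2 P₀ := hξ.re
  have him2 : MemLp (fun ω => (ξ ω).im) 2 P₀ := hξ.im
  have hint : Integrable ξ P₀ := hξ.integrable (by norm_num)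
  have hX0 : ∫ ω, X ω ∂P₀ = 0 := by
    have e1 : ∫ ω, (ξ ω).re ∂P₀ = 0 := by
      have := integral_re hint
      simp only [RCLike.re_to_complex] at this
      rw [this, h0]; rfl
    have e2 : ∫ ω, (ξ ω).im ∂P₀ = 0 := by
      have := integral_im hint
      simp only [RCLike.im_to_complex] at this
      rw [this, h0]; rfl
    rw [integral_add ((hre2.integrable (by norm_num)).mul_const _)
      ((him2.integrable (by norm_num)).mul_const _), integral_mul_const, integral_mul_const, e1, e2]
    simp
  have hX1 : ∫ ω, (X ^ 2) ω ∂P₀ = μ * t.re ^ 2 + (1 - μ) * t.im ^ 2 := by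
    have e : ∀ ω, (X ^ 2) ω = t.re ^ 2 * (ξ ω).re ^ 2 + t.im ^ 2 * (ξ ω).im ^ 2 +
        2 * t.re * t.im * ((ξ ω).re * (ξ ω).im) := fun ω => by
      simp only [X, Pi.pow_apply]; ring
    simp only [e]
    have i1 := (hre2.integrable_sq).const_mul (t.re ^ 2)
    have i2 := (him2.integrable_sq).const_mul (t.im ^ 2)
    have i3 := (hre2.integrable_mul him2).const_mul (2 * t.re * t.im)
    simp only [Pi.mul_apply] at i3
    have i12 : Integrable (fun ω => t.re ^ 2 * (ξ ω).re ^ 2 + t.im ^ 2 * (ξ ω).im ^ 2) P₀ :=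
      i1.add i2
    rw [integral_add i12 i3, integral_add i1 i2, integral_const_mul, integral_const_mul,
      integral_const_mul, hre, him, hri]
    ring
  have hXa : AEMeasurable X P₀ := hXm.aestronglyMeasurable.aemeasurable
  have hmem : MemLp id 2 (P₀.map X) := (memLp_map_measure_iff (by fun_prop) hXa).2 hXm
  have : IsProbabilityMeasure (P₀.map X) := Measure.isProbabilityMeasure_map hXa
  have hc : ∀ s : ℝ, charFun (P₀.map ξ) (s • t) = charFun (P₀.map X) s := by
    intro s
    rw [charFun_apply, charFun_apply, integral_map hξ.aestronglyMeasurable.aemeasurable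
      (by fun_prop), integral_map hXa (by fun_prop)]
    refine integral_congr_ae (ae_of_all _ fun ω => ?_)
    simp only [inner_complex, X]
    simp
    ring_nf
  have key : (fun s : ℝ => charFun (P₀.map X) s -
      taylorWithinEval (charFun (P₀.map X)) 2 Set.univ 0 s) =o[𝓝 0] fun s => s ^ 2 := by
    convert! taylor_isLittleO_univ ?_
    · simp
    · exact contDiff_charFun hmem
  refine key.congr_left fun s => ?_
  rw [hc, taylorWithinEval_charFun_two_zero hXa hmem, hX0, hX1]
  push_cast
  ring

/-- The scaled error in the comparison of the characteristic function of one summand with its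
Gaussian counterpart. -/
lemma tendsto_mul_norm_charFun_sub_exp {ξ : Ω₀ → ℂ} (hξ : MemLp ξ 2 P₀) {μ : ℝ}
    (h0 : ∫ ω, ξ ω ∂P₀ = 0) (hre : ∫ ω, (ξ ω).re ^ 2 ∂P₀ = μ)
    (him : ∫ ω, (ξ ω).im ^ 2 ∂P₀ = 1 - μ) (hri : ∫ ω, (ξ ω).re * (ξ ω).im ∂P₀ = 0) (t : ℂ) :
    Tendsto (fun n : ℕ => n * ‖charFun (P₀.map ξ) ((-(√n)⁻¹ : ℝ) • t) -
      Complex.exp (-((μ * t.re ^ 2 + (1 - μ) * t.im ^ 2 : ℝ) : ℂ) / 2 / n)‖) atTop (𝓝 0) := by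
  set v : ℝ := μ * t.re ^ 2 + (1 - μ) * t.im ^ 2 with hv
  have h1 := charFun_map_smul_sub_isLittleO hξ h0 hre him hri t
  have hs : Tendsto (fun n : ℕ => -(√n : ℝ)⁻¹) atTop (𝓝 0) := by
    rw [← neg_zero]
    exact (tendsto_inv_atTop_zero.comp
      (Real.tendsto_sqrt_atTop.comp tendsto_natCast_atTop_atTop)).neg
  have h2 : (fun s : ℝ => (1 - (v : ℂ) * s ^ 2 / 2) - Complex.exp (-(v : ℂ) / 2 * s ^ 2))
      =o[𝓝 0] fun s => s ^ 2 := by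
    have e1 := (Complex.hasDerivAt_exp 0).isLittleO
    have e2 : Tendsto (fun s : ℝ => -(v : ℂ) / 2 * (s : ℂ) ^ 2) (𝓝 0) (𝓝 0) := by
      have : Continuous fun s : ℝ => -(v : ℂ) / 2 * (s : ℂ) ^ 2 := by fun_prop
      simpa using this.tendsto 0
    have e3 := e1.comp_tendsto e2
    have e4 : (fun s : ℝ => -(v : ℂ) / 2 * (s : ℂ) ^ 2) =O[𝓝 0] fun s : ℝ => s ^ 2 := by
      refine Asymptotics.IsBigO.of_bound ‖-(v : ℂ) / 2‖ (Eventually.of_forall fun s => ?_)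
      simp
    refine ((e3.trans_isBigO (by simpa [Function.comp_def] using e4)).neg_left).congr_left
      fun s => ?_
    simp
    ring
  have h3 := (h1.add h2).comp_tendsto hs
  rw [Asymptotics.isLittleO_iff] at h3
  rw [Metric.tendsto_nhds]
  intro ε hε
  filter_upwards [h3 (half_pos hε), eventually_gt_atTop 0] with n hn hn0
  have hn1 : (0 : ℝ) < n := by exact_mod_cast hn0
  have e5 : (((-(√n)⁻¹ : ℝ) : ℂ)) ^ 2 = (n : ℂ)⁻¹ := by
    rw [← Complex.ofReal_pow, neg_sq, inv_pow, Real.sq_sqrt hn1.le]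
    simp
  have e6 : ‖((-(√n)⁻¹ : ℝ)) ^ 2‖ = (n : ℝ)⁻¹ := by
    rw [neg_sq, inv_pow, Real.sq_sqrt hn1.le, norm_inv, Real.norm_of_nonneg hn1.le]
  simp only [Function.comp_apply, ← hv] at hn
  rw [sub_add_sub_cancel, e5, e6, ← div_eq_mul_inv (-(v : ℂ) / 2)] at hn
  rw [dist_zero_right, norm_mul, norm_norm, Real.norm_of_nonneg hn1.le]
  calc _ ≤ n * (ε / 2 * (n : ℝ)⁻¹) := by gcongr
    _ = ε / 2 := by field_simp
    _ < ε := half_lt_self hε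

end CharFun

/-! ### The random matrix model -/

section Model

variable {Ω₀ Ω : Type*} [MeasurableSpace Ω₀] [MeasurableSpace Ω] {P₀ : Measure Ω₀}
  {ξ₁ ξ₂ : Ω₀ → ℂ} {P : Measure Ω} {n : ℕ}

/-- The matrix `X` with its diagonal replaced by zero. -/
noncomputable def zeroDiag (X : Matrix (Fin n) (Fin n) ℂ) : Matrix (Fin n) (Fin n) ℂ :=
  Matrix.of fun i j => if i = j then 0 else X i j

lemma zeroDiag_apply (X : Matrix (Fin n) (Fin n) ℂ) (i j : Fin n) :
    zeroDiag X i j = if i = j then 0 else X i j := rfl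

/-- The diagonal entries of `X` cancel in its Laplacian. -/
lemma laplacian_zeroDiag (X : Matrix (Fin n) (Fin n) ℂ) : laplacian (zeroDiag X) = laplacian X := by
  have h : ∀ i, ∑ l, zeroDiag X i l = ∑ l, X i l - X i i := by
    intro i
    have h1 : ∀ l, zeroDiag X i l = X i l - if i = l then X i l else 0 := fun l => by
      by_cases h : i = l <;> simp [zeroDiag_apply, h]
    simp [h1]
  ext i j
  by_cases hij : i = j
  · subst hij
    have hd : zeroDiag X i i = 0 := by simp [zeroDiag_apply]
    simp [laplacian, rowSums, h, hd]
  · simp [laplacian, rowSums, hij, zeroDiag_apply]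

lemma IsElliptic.zeroDiag {X : Ω → Matrix (Fin n) (Fin n) ℂ}
    (hX : IsElliptic P₀ ξ₁ ξ₂ P X) : IsElliptic P₀ ξ₁ ξ₂ P fun ω => zeroDiag (X ω) where
  measurable_entry i j := by
    simp only [zeroDiag_apply]
    split_ifs
    · exact measurable_const
    · exact hX.measurable_entry i j
  indep := by
    refine (hX.indep.comp (fun p w => if p.1.1 = p.1.2 then 0 else w) fun p => ?_).congr
      fun p => ae_of_all _ fun ω => ?_
    · split_ifs
      · exact measurable_const
      · exact measurable_id
    · by_cases h : p.1.1 = p.1.2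
      · simp [zeroDiag_apply, h, Prod.ext_iff]
      · simp [zeroDiag_apply, h, Ne.symm h]
  identDistrib i j hij := by
    simpa [zeroDiag_apply, hij.ne, hij.ne'] using hX.identDistrib i j hij

/-- The law of `(Y k j, Y j k)` for a matrix `Y` with zero diagonal in the model. -/
noncomputable def pairLaw (P₀ : Measure Ω₀) (ξ₁ ξ₂ : Ω₀ → ℂ) (k j : Fin n) : Measure (ℂ × ℂ) :=
  if k < j then P₀.map fun ω => (ξ₁ ω, ξ₂ ω)
  else if j < k then P₀.map fun ω => (ξ₂ ω, ξ₁ ω) else Measure.dirac 0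

variable {Y : Ω → Matrix (Fin n) (Fin n) ℂ} (hY : IsElliptic P₀ ξ₁ ξ₂ P Y)
include hY

lemma IsElliptic.measurable_crossPairs (k j : Fin n) : Measurable fun ω => crossPairs (Y ω) k j :=
  (hY.measurable_entry k j).prodMk (hY.measurable_entry j k)

lemma IsElliptic.map_crossPairs [IsProbabilityMeasure P] (h0 : ∀ ω i, Y ω i i = 0) (k j : Fin n) :
    P.map (fun ω => crossPairs (Y ω) k j) = pairLaw P₀ ξ₁ ξ₂ k j := by
  rw [pairLaw]
  split_ifs with h1 h2
  · exact (hY.identDistrib k j h1).map_eq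
  · exact ((hY.identDistrib j k h2).comp measurable_swap).map_eq
  · have : j = k := le_antisymm (not_lt.1 h1) (not_lt.1 h2)
    subst this
    have : (fun ω => crossPairs (Y ω) j j) = fun _ => (0 : ℂ × ℂ) := by
      ext ω <;> simp [crossPairs, h0]
    rw [this]
    simp

lemma IsElliptic.iIndepFun_crossPairs (k : Fin n) :
    iIndepFun (fun j ω => crossPairs (Y ω) k j) P := by
  let g : Fin n → {p : Fin n × Fin n // p.1 ≤ p.2} := fun j =>
    if h : k ≤ j then ⟨(k, j), h⟩ else ⟨(j, k), (not_le.1 h).le⟩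
  have hg : Function.Injective g := by
    intro i j hij
    simp only [g] at hij
    split_ifs at hij <;> simp only [Subtype.mk.injEq, Prod.mk.injEq] at hij <;> grind
  refine ((hY.indep.precomp hg).comp (fun j => if k ≤ j then id else Prod.swap) fun j => ?_).congr
    fun j => ae_of_all _ fun ω => ?_
  · split_ifs
    · exact measurable_id
    · exact measurable_swap
  · by_cases h : k ≤ j <;> simp [g, h, crossPairs]

/-- Row and column `k` are independent of the other entries: the independent pairs are split
according to whether they contain the index `k`. -/
lemma IsElliptic.indepFun_crossPairs_zeroCross (k : Fin n) :
    IndepFun (fun ω => crossPairs (Y ω) k) (fun ω i j => zeroCross (Y ω) k i j) P := by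
  classical
  let S : Finset {p : Fin n × Fin n // p.1 ≤ p.2} := {p | p.1.1 = k ∨ p.1.2 = k}
  have hind := hY.indep.indepFun_finset S Sᶜ disjoint_compl_right fun p =>
    (hY.measurable_entry _ _).prodMk (hY.measurable_entry _ _)
  let φ : (S → ℂ × ℂ) → Fin n → ℂ × ℂ := fun w j =>
    if h : k ≤ j then w ⟨⟨(k, j), h⟩, by simp [S]⟩
    else (w ⟨⟨(j, k), (not_le.1 h).le⟩, by simp [S]⟩).swap
  let ψ : ((Sᶜ : Finset _) → ℂ × ℂ) → Fin n → Fin n → ℂ := fun w i j =>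
    if h : i = k ∨ j = k then 0 else
      if h' : i ≤ j then (w ⟨⟨(i, j), h'⟩, by simpa [S] using h⟩).1
      else (w ⟨⟨(j, i), (not_le.1 h').le⟩, by simpa [S, and_comm] using h⟩).2
  have hφ : Measurable φ := by
    refine measurable_pi_iff.2 fun j => ?_
    simp only [φ]
    split_ifs
    · exact measurable_pi_apply _
    · exact measurable_swap.comp (measurable_pi_apply _)
  have hψ : Measurable ψ := by
    refine measurable_pi_iff.2 fun i => measurable_pi_iff.2 fun j => ?_
    simp only [ψ]
    split_ifs
    · exact measurable_const
    · exact measurable_fst.comp (measurable_pi_apply _)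
    · exact measurable_snd.comp (measurable_pi_apply _)
  convert hind.comp hφ hψ using 1
  · ext ω j <;> simp only [Function.comp_apply, φ] <;> split_ifs <;> simp [crossPairs]
  · ext ω i j
    simp only [Function.comp_apply, ψ, zeroCross, Matrix.of_apply]
    split_ifs <;> rfl

end Model

/-! ### Moments of the atom variables -/

section Moments

lemma measurable_rowVar (s : Fin 2) : Measurable (rowVar s) := by
  fin_cases s
  · exact measurable_fst
  · exact Complex.continuous_conj.measurable.comp measurable_snd

lemma measurable_colVar (s : Fin 2) : Measurable (colVar s) := by
  fin_cases s
  · exact Complex.continuous_conj.measurable.comp measurable_fst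
  · exact measurable_snd

/-- The truncated second moment `𝔼 (|ξ₁|² + |ξ₂|²; |ξ₁|² + |ξ₂|² > K)`. -/
noncomputable def tailMoment {Ω₀ : Type*} [MeasurableSpace Ω₀]
    (P₀ : Measure Ω₀) (ξ₁ ξ₂ : Ω₀ → ℂ) (K : ℝ) : ℝ :=
  ∫ ω, {ω | K < ‖ξ₁ ω‖ ^ 2 + ‖ξ₂ ω‖ ^ 2}.indicator (fun ω => ‖ξ₁ ω‖ ^ 2 + ‖ξ₂ ω‖ ^ 2) ω ∂P₀

lemma tailMoment_nonneg {Ω₀ : Type*} [MeasurableSpace Ω₀] {P₀ : Measure Ω₀} {ξ₁ ξ₂ : Ω₀ → ℂ}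
    (K : ℝ) : 0 ≤ tailMoment P₀ ξ₁ ξ₂ K :=
  integral_nonneg fun ω => Set.indicator_nonneg (fun _ _ => by positivity) ω

lemma measurable_indicator_norm_sq_add (K : ℝ) :
    Measurable ({w : ℂ × ℂ | K < ‖w.1‖ ^ 2 + ‖w.2‖ ^ 2}.indicator
      fun w => ‖w.1‖ ^ 2 + ‖w.2‖ ^ 2) :=
  Measurable.indicator (by fun_prop) (measurableSet_lt measurable_const (by fun_prop))

lemma norm_rowVar_mul_colVar_le (s t : Fin 2) (w : ℂ × ℂ) :
    ‖rowVar s w * colVar t w‖ ≤ ‖w.1‖ ^ 2 + ‖w.2‖ ^ 2 := by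
  rw [norm_mul]
  fin_cases s <;> fin_cases t <;> simp [rowVar, colVar] <;>
    nlinarith [sq_nonneg (‖w.1‖ - ‖w.2‖), sq_nonneg ‖w.1‖, sq_nonneg ‖w.2‖]

variable {Ω₀ : Type*} [MeasurableSpace Ω₀] {P₀ : Measure Ω₀} {μ γ : ℝ}
  {ξ₁ ξ₂ : Ω₀ → ℂ} (hξ : IsFamily P₀ μ γ ξ₁ ξ₂) {n : ℕ}
include hξ

lemma IsFamily.abs_gamma_le : |γ| ≤ 1 :=
  abs_le.2 ⟨hξ.neg_one_lt_gamma.le, hξ.gamma_lt_one.le⟩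

lemma IsFamily.aemeasurable₁ : AEMeasurable ξ₁ P₀ := hξ.memLp₁.aestronglyMeasurable.aemeasurable

lemma IsFamily.aemeasurable₂ : AEMeasurable ξ₂ P₀ := hξ.memLp₂.aestronglyMeasurable.aemeasurable

lemma IsFamily.isProbabilityMeasure_pairLaw [IsProbabilityMeasure P₀] (k j : Fin n) :
    IsProbabilityMeasure (pairLaw P₀ ξ₁ ξ₂ k j) := by
  rw [pairLaw]
  split_ifs
  · exact Measure.isProbabilityMeasure_map (hξ.aemeasurable₁.prodMk hξ.aemeasurable₂)
  · exact Measure.isProbabilityMeasure_map (hξ.aemeasurable₂.prodMk hξ.aemeasurable₁)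
  · infer_instance

/-- Integration against `pairLaw`. -/
lemma IsFamily.integral_pairLaw {G : Type*} [NormedAddCommGroup G] [NormedSpace ℝ G]
    [MeasurableSpace G] [BorelSpace G] [SecondCountableTopology G] [CompleteSpace G]
    {f : ℂ × ℂ → G} (hf : Measurable f) (k j : Fin n) :
    ∫ w, f w ∂(pairLaw P₀ ξ₁ ξ₂ k j) = if k < j then ∫ ω, f (ξ₁ ω, ξ₂ ω) ∂P₀
      else if j < k then ∫ ω, f (ξ₂ ω, ξ₁ ω) ∂P₀ else f 0 := by
  rw [pairLaw]
  split_ifs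
  · exact integral_map (hξ.aemeasurable₁.prodMk hξ.aemeasurable₂) hf.aestronglyMeasurable
  · exact integral_map (hξ.aemeasurable₂.prodMk hξ.aemeasurable₁) hf.aestronglyMeasurable
  · exact integral_dirac _ _

lemma IsFamily.memLp_pairLaw {f : ℂ × ℂ → ℂ} (hf : Measurable f)
    (h1 : MemLp (fun ω => f (ξ₁ ω, ξ₂ ω)) 2 P₀) (h2 : MemLp (fun ω => f (ξ₂ ω, ξ₁ ω)) 2 P₀)
    (k j : Fin n) : MemLp f 2 (pairLaw P₀ ξ₁ ξ₂ k j) := by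
  rw [pairLaw]
  split_ifs
  · exact (memLp_map_measure_iff hf.aestronglyMeasurable
      (hξ.aemeasurable₁.prodMk hξ.aemeasurable₂)).2 h1
  · exact (memLp_map_measure_iff hf.aestronglyMeasurable
      (hξ.aemeasurable₂.prodMk hξ.aemeasurable₁)).2 h2
  · exact (memLp_const (f 0)).ae_eq (ae_eq_dirac f).symm

lemma IsFamily.memLp_fst (k j : Fin n) : MemLp Prod.fst 2 (pairLaw P₀ ξ₁ ξ₂ k j) :=
  hξ.memLp_pairLaw measurable_fst hξ.memLp₁ hξ.memLp₂ k j

lemma IsFamily.memLp_snd (k j : Fin n) : MemLp Prod.snd 2 (pairLaw P₀ ξ₁ ξ₂ k j) :=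
  hξ.memLp_pairLaw measurable_snd hξ.memLp₂ hξ.memLp₁ k j

lemma IsFamily.memLp_rowVar (s : Fin 2) (k j : Fin n) :
    MemLp (rowVar s) 2 (pairLaw P₀ ξ₁ ξ₂ k j) := by
  fin_cases s
  · exact hξ.memLp_fst k j
  · exact (hξ.memLp_snd k j).star

lemma IsFamily.memLp_colVar (s : Fin 2) (k j : Fin n) :
    MemLp (colVar s) 2 (pairLaw P₀ ξ₁ ξ₂ k j) := by
  fin_cases s
  · exact (hξ.memLp_fst k j).star
  · exact hξ.memLp_snd k j

lemma IsFamily.integral_fst (k j : Fin n) : ∫ w, w.1 ∂(pairLaw P₀ ξ₁ ξ₂ k j) = 0 := by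
  rw [hξ.integral_pairLaw measurable_fst, hξ.mean₁, hξ.mean₂]
  simp

lemma IsFamily.integral_snd (k j : Fin n) : ∫ w, w.2 ∂(pairLaw P₀ ξ₁ ξ₂ k j) = 0 := by
  rw [hξ.integral_pairLaw measurable_snd, hξ.mean₁, hξ.mean₂]
  simp

lemma IsFamily.integral_rowVar (s : Fin 2) (k j : Fin n) :
    ∫ w, rowVar s w ∂(pairLaw P₀ ξ₁ ξ₂ k j) = 0 := by
  fin_cases s
  · exact hξ.integral_fst k j
  · exact integral_conj.trans (by rw [hξ.integral_snd, map_zero])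

lemma IsFamily.integral_colVar (s : Fin 2) (k j : Fin n) :
    ∫ w, colVar s w ∂(pairLaw P₀ ξ₁ ξ₂ k j) = 0 := by
  fin_cases s
  · exact integral_conj.trans (by rw [hξ.integral_fst, map_zero])
  · exact hξ.integral_snd k j

lemma IsFamily.integral_norm_fst_sq_le (k j : Fin n) :
    ∫ w, ‖w.1‖ ^ 2 ∂(pairLaw P₀ ξ₁ ξ₂ k j) ≤ 1 := by
  rw [hξ.integral_pairLaw (by fun_prop), hξ.variance₁, hξ.variance₂]
  split_ifs <;> simp

lemma IsFamily.integral_norm_snd_sq_le (k j : Fin n) :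
    ∫ w, ‖w.2‖ ^ 2 ∂(pairLaw P₀ ξ₁ ξ₂ k j) ≤ 1 := by
  rw [hξ.integral_pairLaw (by fun_prop), hξ.variance₁, hξ.variance₂]
  split_ifs <;> simp

lemma IsFamily.integral_norm_rowVar_sq_le (s : Fin 2) (k j : Fin n) :
    ∫ w, ‖rowVar s w‖ ^ 2 ∂(pairLaw P₀ ξ₁ ξ₂ k j) ≤ 1 := by
  fin_cases s
  · exact hξ.integral_norm_fst_sq_le k j
  · simpa [rowVar] using hξ.integral_norm_snd_sq_le k j

lemma IsFamily.integral_norm_colVar_sq_le (s : Fin 2) (k j : Fin n) :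
    ∫ w, ‖colVar s w‖ ^ 2 ∂(pairLaw P₀ ξ₁ ξ₂ k j) ≤ 1 := by
  fin_cases s
  · simpa [colVar] using hξ.integral_norm_fst_sq_le k j
  · exact hξ.integral_norm_snd_sq_le k j

/-- The mixed moment `𝔼 ξ₁ ξ₂ = μ γ - (-(1 - μ) γ)`. -/
lemma IsFamily.integral_mul : ∫ ω, ξ₁ ω * ξ₂ ω ∂P₀ = γ := by
  have hi : Integrable (fun ω => ξ₁ ω * ξ₂ ω) P₀ := hξ.memLp₁.integrable_mul hξ.memLp₂
  have r1 : MemLp (fun ω => (ξ₁ ω).re) 2 P₀ := hξ.memLp₁.re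
  have r2 : MemLp (fun ω => (ξ₂ ω).re) 2 P₀ := hξ.memLp₂.re
  have m1 : MemLp (fun ω => (ξ₁ ω).im) 2 P₀ := hξ.memLp₁.im
  have m2 : MemLp (fun ω => (ξ₂ ω).im) 2 P₀ := hξ.memLp₂.im
  have e1 : ∫ ω, (ξ₁ ω * ξ₂ ω).re ∂P₀ = γ := by
    have i1 : Integrable (fun ω => (ξ₁ ω).re * (ξ₂ ω).re) P₀ := r1.integrable_mul r2
    have i2 : Integrable (fun ω => (ξ₁ ω).im * (ξ₂ ω).im) P₀ := m1.integrable_mul m2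
    simp only [Complex.mul_re]
    rw [integral_sub i1 i2, hξ.re_re, hξ.im_im]
    ring
  have e2 : ∫ ω, (ξ₁ ω * ξ₂ ω).im ∂P₀ = 0 := by
    simp only [Complex.mul_im]
    have : ∀ ω, (ξ₁ ω).im * (ξ₂ ω).re = (ξ₂ ω).re * (ξ₁ ω).im := fun ω => mul_comm _ _
    have i1 : Integrable (fun ω => (ξ₁ ω).re * (ξ₂ ω).im) P₀ := r1.integrable_mul m2
    have i2 : Integrable (fun ω => (ξ₂ ω).re * (ξ₁ ω).im) P₀ := r2.integrable_mul m1
    simp only [this]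
    rw [integral_add i1 i2, hξ.re_im₁₂, hξ.re_im₂₁]
    ring
  apply Complex.ext
  · rw [← e1]; exact (integral_re hi).symm
  · rw [Complex.ofReal_im, ← e2]; exact (integral_im hi).symm

/-- The covariances of the entries of the block row and the block column. For `j = k` the law is the
Dirac measure at zero. -/
lemma IsFamily.integral_rowVar_mul_colVar (s t : Fin 2) (k j : Fin n) :
    ∫ w, rowVar s w * colVar t w ∂(pairLaw P₀ ξ₁ ξ₂ k j) =
      if j = k then 0 else (!![1, (γ : ℂ); γ, 1] : Matrix (Fin 2) (Fin 2) ℂ) s t := by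
  have hv : ∀ {ξ : Ω₀ → ℂ}, ∫ ω, ‖ξ ω‖ ^ 2 ∂P₀ = 1 → ∫ ω, (‖ξ ω‖ : ℂ) ^ 2 ∂P₀ = 1 := by
    intro ξ h
    have := integral_complex_ofReal (μ := P₀) (f := fun ω => ‖ξ ω‖ ^ 2)
    rw [h] at this
    simpa using this
  have h1 := hv hξ.variance₁
  have h2 := hv hξ.variance₂
  have h3 := hξ.integral_mul
  have h4 : ∫ ω, ξ₂ ω * ξ₁ ω ∂P₀ = γ := by simpa only [mul_comm] using h3
  have h5 : ∫ ω, conj (ξ₂ ω) * conj (ξ₁ ω) ∂P₀ = γ := by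
    simp only [← map_mul]
    rw [integral_conj, h4, Complex.conj_ofReal]
  have h6 : ∫ ω, conj (ξ₁ ω) * conj (ξ₂ ω) ∂P₀ = γ := by simpa only [mul_comm] using h5
  have hm : Measurable fun w => rowVar s w * colVar t w :=
    (measurable_rowVar s).mul (measurable_colVar t)
  rw [hξ.integral_pairLaw hm]
  rcases lt_trichotomy k j with h | h | h
  · rw [if_pos h, if_neg h.ne']
    fin_cases s <;> fin_cases t <;>
      simp [rowVar, colVar, Complex.mul_conj', Complex.conj_mul', h1, h2, h3, h5]
  · subst h
    fin_cases s <;> simp [rowVar]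
  · rw [if_neg h.not_gt, if_pos h, if_neg h.ne]
    fin_cases s <;> fin_cases t <;>
      simp [rowVar, colVar, Complex.mul_conj', Complex.conj_mul', h1, h2, h4, h6]

lemma IsFamily.integrable_norm_sq_add : Integrable (fun ω => ‖ξ₁ ω‖ ^ 2 + ‖ξ₂ ω‖ ^ 2) P₀ :=
  (hξ.memLp₁.integrable_norm_pow (p := 2) (by norm_num)).add
    (hξ.memLp₂.integrable_norm_pow (p := 2) (by norm_num))

lemma IsFamily.tendsto_tailMoment : Tendsto (tailMoment P₀ ξ₁ ξ₂) atTop (𝓝 0) := by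
  rw [← integral_zero Ω₀ ℝ (μ := P₀)]
  refine tendsto_integral_filter_of_dominated_convergence
    (fun ω => ‖ξ₁ ω‖ ^ 2 + ‖ξ₂ ω‖ ^ 2) (Eventually.of_forall fun K => ?_)
    (Eventually.of_forall fun K => ae_of_all _ fun ω => ?_) hξ.integrable_norm_sq_add
    (ae_of_all _ fun ω => ?_)
  · have h1 : Measurable ((Set.Ioi K).indicator (id : ℝ → ℝ)) := measurable_id.indicator
      measurableSet_Ioi
    exact (h1.comp_aemeasurable
      hξ.integrable_norm_sq_add.aestronglyMeasurable.aemeasurable).aestronglyMeasurable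
  · refine (norm_indicator_le_norm_self _ _).trans_eq (Real.norm_of_nonneg (by positivity))
  · refine tendsto_const_nhds.congr' ?_
    filter_upwards [eventually_ge_atTop (‖ξ₁ ω‖ ^ 2 + ‖ξ₂ ω‖ ^ 2)] with K hK
    rw [Set.indicator_of_notMem]
    simpa using hK

lemma IsFamily.integral_indicator_pairLaw_le {K : ℝ} (hK : 0 ≤ K) (k j : Fin n) :
    ∫ w, {w : ℂ × ℂ | K < ‖w.1‖ ^ 2 + ‖w.2‖ ^ 2}.indicator
      (fun w => ‖w.1‖ ^ 2 + ‖w.2‖ ^ 2) w ∂(pairLaw P₀ ξ₁ ξ₂ k j) ≤ tailMoment P₀ ξ₁ ξ₂ K := by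
  rw [hξ.integral_pairLaw (measurable_indicator_norm_sq_add K)]
  split_ifs
  · exact le_rfl
  · refine le_of_eq (integral_congr_ae (ae_of_all _ fun ω => ?_))
    simp only [Set.indicator_apply, Set.mem_ofPred_eq, add_comm]
  · rw [Set.indicator_of_notMem (by simpa using hK)]
    exact tailMoment_nonneg K

lemma IsFamily.integrable_norm_sq_add_pairLaw (k j : Fin n) :
    Integrable (fun w : ℂ × ℂ => ‖w.1‖ ^ 2 + ‖w.2‖ ^ 2) (pairLaw P₀ ξ₁ ξ₂ k j) :=
  ((hξ.memLp_fst k j).integrable_norm_pow (p := 2) (by norm_num)).add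
    ((hξ.memLp_snd k j).integrable_norm_pow (p := 2) (by norm_num))

lemma IsFamily.integral_indicator_rowVar_mul_colVar_le {K : ℝ} (hK : 0 ≤ K) (s t : Fin 2)
    (k j : Fin n) :
    ∫ w, {w | K < ‖rowVar s w * colVar t w‖}.indicator (fun w => ‖rowVar s w * colVar t w‖) w
      ∂(pairLaw P₀ ξ₁ ξ₂ k j) ≤ tailMoment P₀ ξ₁ ξ₂ K := by
  have hm : Measurable fun w => rowVar s w * colVar t w :=
    (measurable_rowVar s).mul (measurable_colVar t)
  refine (integral_mono ?_ ?_ fun w => ?_).trans (hξ.integral_indicator_pairLaw_le hK k j)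
  · refine Integrable.indicator ?_ (measurableSet_lt measurable_const hm.norm)
    exact ((hξ.memLp_rowVar s k j).integrable_mul (hξ.memLp_colVar t k j)).norm
  · exact (hξ.integrable_norm_sq_add_pairLaw k j).indicator
      (measurableSet_lt measurable_const (by fun_prop))
  · have h := norm_rowVar_mul_colVar_le s t w
    simp only [Set.indicator_apply, Set.mem_ofPred_eq]
    split_ifs <;> first | positivity | linarith

end Moments

/-! ### Measurability of the resolvent -/

section Measurability

variable {n : ℕ} (z : ℂ) {η : ℂ}

lemma continuous_resolvent (hη : 0 < η.im) :
    Continuous fun M : Matrix (Fin n) (Fin n) ℂ => resolvent M (qMat z η) := by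
  have h1 : Continuous fun M : Matrix (Fin n) (Fin n) ℂ => shifted M (qMat z η) := by
    refine continuous_matrix fun p p' => ?_
    obtain ⟨i, s⟩ := p
    obtain ⟨j, t⟩ := p'
    simp only [shifted_apply]
    refine Continuous.sub ?_ continuous_const
    have h2 : Continuous fun M : Matrix (Fin n) (Fin n) ℂ => M i j := continuous_id.matrix_elem i j
    have h3 : Continuous fun M : Matrix (Fin n) (Fin n) ℂ => M j i := continuous_id.matrix_elem j i
    fin_cases s <;> fin_cases t <;> simp [offDiag] <;> fun_prop
  simp only [resolvent, Matrix.inv_def, Ring.inverse_eq_inv']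
  exact (h1.matrix_det.inv₀ fun M => (isUnit_det_shifted M z hη).ne_zero).smul h1.matrix_adjugate

lemma continuous_laplacian :
    Continuous fun Y : Matrix (Fin n) (Fin n) ℂ => laplacian Y := by
  refine continuous_matrix fun i j => ?_
  have h : ∀ i j, Continuous fun M : Matrix (Fin n) (Fin n) ℂ => M i j := fun i j =>
    continuous_id.matrix_elem i j
  by_cases hij : i = j
  · subst hij
    simp [laplacian, rowSums]
    fun_prop
  · simp [laplacian, rowSums, hij]
    fun_prop

lemma continuous_resolvent_laplacian_apply (hη : 0 < η.im) (p p' : Fin n × Fin 2) :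
    Continuous fun Y : Fin n → Fin n → ℂ => resolvent (laplacian (Matrix.of Y)) (qMat z η) p p' :=
  ((continuous_resolvent z hη).comp continuous_laplacian).matrix_elem p p'

variable {Ω : Type*} [MeasurableSpace Ω] {Y : Ω → Matrix (Fin n) (Fin n) ℂ}

lemma measurable_resolvent_laplacian_apply (hη : 0 < η.im)
    (hY : ∀ i j, Measurable fun ω => Y ω i j) (p p' : Fin n × Fin 2) :
    Measurable fun ω => resolvent (laplacian (Y ω)) (qMat z η) p p' :=
  (continuous_resolvent_laplacian_apply z hη p p').measurable.comp
    (g := fun Y : Fin n → Fin n → ℂ => resolvent (laplacian (Matrix.of Y)) (qMat z η) p p')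
    (f := fun ω i j => Y ω i j) (measurable_pi_iff.2 fun i => measurable_pi_iff.2 fun j => hY i j)

lemma measurable_avgBlock_laplacian_apply (hη : 0 < η.im)
    (hY : ∀ i j, Measurable fun ω => Y ω i j) (s t : Fin 2) :
    Measurable fun ω => avgBlock (laplacian (Y ω)) (qMat z η) s t := by
  simp only [avgBlock_apply]
  exact (Finset.measurable_fun_sum _ fun k _ =>
    measurable_resolvent_laplacian_apply z hη hY _ _).const_mul _

lemma integrable_avgBlock_laplacian_apply {P : Measure Ω} [IsFiniteMeasure P] (hη : 0 < η.im)
    (hY : ∀ i j, Measurable fun ω => Y ω i j) (s t : Fin 2) :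
    Integrable (fun ω => avgBlock (laplacian (Y ω)) (qMat z η) s t) P :=
  Integrable.of_bound (measurable_avgBlock_laplacian_apply z hη hY s t).aestronglyMeasurable _
    (ae_of_all _ fun _ => norm_avgBlock_apply_le _ z hη s t)

end Measurability

/-! ### Concentration of the averaged block -/

section Concentration

variable {Ω₀ Ω : Type*} [MeasurableSpace Ω₀] [MeasurableSpace Ω] {P₀ : Measure Ω₀}
  [IsProbabilityMeasure P₀] {μ γ : ℝ}
  {ξ₁ ξ₂ : Ω₀ → ℂ} {P : Measure Ω} [IsProbabilityMeasure P] {n : ℕ}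
  {Y : Ω → Matrix (Fin n) (Fin n) ℂ} (z : ℂ) {η : ℂ}

omit [IsProbabilityMeasure P₀] in
lemma IsFamily.integral_norm_add_sq_le (hξ : IsFamily P₀ μ γ ξ₁ ξ₂) (k j : Fin n) :
    ∫ w, (‖w.1‖ + ‖w.2‖) ^ 2 ∂(pairLaw P₀ ξ₁ ξ₂ k j) ≤ 4 := by
  have i1 : Integrable (fun w : ℂ × ℂ => ‖w.1‖ ^ 2) (pairLaw P₀ ξ₁ ξ₂ k j) :=
    (hξ.memLp_fst k j).integrable_norm_pow (p := 2) (by norm_num)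
  have i2 : Integrable (fun w : ℂ × ℂ => ‖w.2‖ ^ 2) (pairLaw P₀ ξ₁ ξ₂ k j) :=
    (hξ.memLp_snd k j).integrable_norm_pow (p := 2) (by norm_num)
  calc ∫ w, (‖w.1‖ + ‖w.2‖) ^ 2 ∂(pairLaw P₀ ξ₁ ξ₂ k j) ≤
      ∫ w, (2 * ‖w.1‖ ^ 2 + 2 * ‖w.2‖ ^ 2) ∂(pairLaw P₀ ξ₁ ξ₂ k j) := by
        refine integral_mono_of_nonneg (ae_of_all _ fun w => by positivity)
          ((i1.const_mul 2).add (i2.const_mul 2)) (ae_of_all _ fun w => ?_)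
        simp only []
        nlinarith [sq_nonneg (‖w.1‖ - ‖w.2‖)]
    _ ≤ 4 := by
        rw [integral_add (i1.const_mul 2) (i2.const_mul 2), integral_const_mul, integral_const_mul]
        linarith [hξ.integral_norm_fst_sq_le k j, hξ.integral_norm_snd_sq_le k j]

omit [IsProbabilityMeasure P₀] in
lemma IsFamily.integrable_norm_add_sq (hξ : IsFamily P₀ μ γ ξ₁ ξ₂) (k j : Fin n) :
    Integrable (fun w : ℂ × ℂ => (‖w.1‖ + ‖w.2‖) ^ 2) (pairLaw P₀ ξ₁ ξ₂ k j) :=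
  MemLp.integrable_sq (f := fun w : ℂ × ℂ => ‖w.1‖ + ‖w.2‖)
    ((hξ.memLp_fst k j).norm.add (hξ.memLp_snd k j).norm)

/-- The averaged block has variance `O(1 / n)`, as it changes by `O(n ^ (-3/2))` when one of the
`O(n²)` independent pairs of entries is changed. -/
theorem IsElliptic.lintegral_enorm_avgBlock_sub_le (hξ : IsFamily P₀ μ γ ξ₁ ξ₂)
    (hY : IsElliptic P₀ ξ₁ ξ₂ P Y) (h0 : ∀ ω i, Y ω i i = 0) (hη : 0 < η.im) (s t : Fin 2) :
    ∫⁻ ω, ‖avgBlock (laplacian (Y ω)) (qMat z η) s t -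
      ∫ ω', avgBlock (laplacian (Y ω')) (qMat z η) s t ∂P‖ₑ ∂P ≤
        ENNReal.ofReal (8 * η.im⁻¹ ^ 2 / √n) := by
  classical
  let I := {p : Fin n × Fin n // p.1 ≤ p.2}
  let e : Fin (Fintype.card I) ≃ I := (Fintype.equivFin I).symm
  let f : Fin (Fintype.card I) → Ω → ℂ × ℂ := fun a ω =>
    (Y ω (e a).1.1 (e a).1.2, Y ω (e a).1.2 (e a).1.1)
  have hfm : ∀ a, Measurable (f a) := fun a =>
    (hY.measurable_entry _ _).prodMk (hY.measurable_entry _ _)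
  have hfi : iIndepFun f P := hY.indep.precomp e.injective
  let ν : Fin (Fintype.card I) → Measure (ℂ × ℂ) := fun a => pairLaw P₀ ξ₁ ξ₂ (e a).1.1 (e a).1.2
  have hν : ∀ a, IsProbabilityMeasure (ν a) := fun a => hξ.isProbabilityMeasure_pairLaw _ _
  have hlaw : P.map (fun ω a => f a ω) = Measure.pi ν := by
    rw [(iIndepFun_iff_map_fun_eq_pi_map fun a => (hfm a).aemeasurable).1 hfi]
    congr 1
    ext1 a
    exact hY.map_crossPairs h0 _ _
  -- `asm w` is the matrix with entries `w`
  let asm : (Fin (Fintype.card I) → ℂ × ℂ) → Matrix (Fin n) (Fin n) ℂ := fun w => Matrix.of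
    fun i j => if h : i < j then (w (e.symm ⟨(i, j), h.le⟩)).1
      else if h : j < i then (w (e.symm ⟨(j, i), h.le⟩)).2 else 0
  have hasm : ∀ ω, asm (fun a => f a ω) = Y ω := by
    intro ω
    ext i j
    simp only [asm, Matrix.of_apply, f, Equiv.apply_symm_apply]
    split_ifs with h1 h2
    · rfl
    · rfl
    · rw [le_antisymm (not_lt.1 h2) (not_lt.1 h1), h0]
  have hasmm : ∀ i j, Measurable fun w => asm w i j := by
    intro i j
    simp only [asm, Matrix.of_apply]
    split_ifs
    · exact measurable_fst.comp (measurable_pi_apply _)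
    · exact measurable_snd.comp (measurable_pi_apply _)
    · exact measurable_const
  let F : (Fin (Fintype.card I) → ℂ × ℂ) → ℂ := fun w =>
    avgBlock (laplacian (asm w)) (qMat z η) s t
  have hF : Measurable F := measurable_avgBlock_laplacian_apply z hη hasmm s t
  have hFb : ∀ w, ‖F w‖ ≤ η.im⁻¹ := fun w => norm_avgBlock_apply_le _ z hη s t
  set L : ℝ := 4 * η.im⁻¹ ^ 2 / (n * √n) with hL
  have hL0 : 0 ≤ L := by positivity
  have hd : ∀ w a, ‖F w - F (Function.update w a 0)‖ ≤ L * (‖(w a).1‖ + ‖(w a).2‖) := by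
    intro w a
    refine (norm_avgBlock_laplacian_sub_le z hη _ _ s t).trans ?_
    rw [← hL]
    refine mul_le_mul_of_nonneg_left ?_ hL0
    have hij : ∀ i j, ‖asm w i j - asm (Function.update w a 0) i j‖ ≤
        (if i = (e a).1.1 then if j = (e a).1.2 then ‖(w a).1‖ else 0 else 0) +
        (if i = (e a).1.2 then if j = (e a).1.1 then ‖(w a).2‖ else 0 else 0) := by
      intro i j
      have p1 : 0 ≤ if i = (e a).1.1 then if j = (e a).1.2 then ‖(w a).1‖ else 0 else 0 := by
        positivity
      have p2 : 0 ≤ if i = (e a).1.2 then if j = (e a).1.1 then ‖(w a).2‖ else 0 else 0 := by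
        positivity
      simp only [asm, Matrix.of_apply]
      by_cases h1 : i < j
      · rw [dif_pos h1, dif_pos h1]
        by_cases hb : e.symm ⟨(i, j), h1.le⟩ = a
        · have he : e a = ⟨(i, j), h1.le⟩ := by rw [← hb, Equiv.apply_symm_apply]
          rw [hb, Function.update_self]
          simp only [he] at p2 ⊢
          simpa using p2
        · rw [Function.update_of_ne hb, sub_self, norm_zero]
          exact add_nonneg p1 p2
      rw [dif_neg h1, dif_neg h1]
      by_cases h2 : j < i
      · rw [dif_pos h2, dif_pos h2]
        by_cases hb : e.symm ⟨(j, i), h2.le⟩ = a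
        · have he : e a = ⟨(j, i), h2.le⟩ := by rw [← hb, Equiv.apply_symm_apply]
          rw [hb, Function.update_self]
          simp only [he] at p1 ⊢
          simpa using p1
        · rw [Function.update_of_ne hb, sub_self, norm_zero]
          exact add_nonneg p1 p2
      · rw [dif_neg h2, dif_neg h2, sub_self, norm_zero]
        exact add_nonneg p1 p2
    refine (Finset.sum_le_sum fun i _ => Finset.sum_le_sum fun j _ => hij i j).trans
      (le_of_eq ?_)
    simp [Finset.sum_add_distrib]
  have hES := integral_norm_sub_integral_sq_le (0 : ℂ × ℂ) ν hF hFb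
    (δ := fun _ x => L * (‖x.1‖ + ‖x.2‖)) (fun a => by
      simp only [mul_pow]
      exact (hξ.integrable_norm_add_sq _ _).const_mul _) hd
  have hbound : ∑ a, ∫ x, (L * (‖x.1‖ + ‖x.2‖)) ^ 2 ∂(ν a) ≤ (8 * η.im⁻¹ ^ 2 / √n) ^ 2 := by
    have h1 : ∀ a, ∫ x, (L * (‖x.1‖ + ‖x.2‖)) ^ 2 ∂(ν a) ≤ L ^ 2 * 4 := fun a => by
      simp only [mul_pow]
      rw [integral_const_mul]
      gcongr
      exact hξ.integral_norm_add_sq_le _ _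
    refine (Finset.sum_le_sum fun a _ => h1 a).trans ?_
    have hcard : (Fintype.card I : ℝ) ≤ n ^ 2 := by
      have : Fintype.card I ≤ Fintype.card (Fin n × Fin n) := Fintype.card_subtype_le _
      rw [Fintype.card_prod, Fintype.card_fin] at this
      rw [sq]
      exact_mod_cast this
    rw [Finset.sum_const, Finset.card_univ, Fintype.card_fin, nsmul_eq_mul]
    calc (Fintype.card I : ℝ) * (L ^ 2 * 4) ≤ n ^ 2 * (L ^ 2 * 4) := by gcongr
      _ = (8 * η.im⁻¹ ^ 2 / √n) ^ 2 := by
        rcases Nat.eq_zero_or_pos n with rfl | hn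
        · simp
        · have : (0 : ℝ) < n := by exact_mod_cast hn
          rw [hL]
          field_simp
          ring
  have hmap : ∀ {G : Type} [NormedAddCommGroup G] [NormedSpace ℝ G] (g : ℂ → G), Continuous g →
      ∫ w, g (F w) ∂(Measure.pi ν) =
        ∫ ω, g (avgBlock (laplacian (Y ω)) (qMat z η) s t) ∂P := by
    intro G _ _ g hg
    rw [← hlaw, integral_map (measurable_pi_iff.2 fun a => hfm a).aemeasurable
      (hg.comp_aestronglyMeasurable hF.aestronglyMeasurable)]
    refine integral_congr_ae (ae_of_all _ fun ω => ?_)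
    change g (avgBlock (laplacian (asm fun a => f a ω)) _ s t) = _
    rw [hasm]
  have hm := hmap (fun x => x) continuous_id
  rw [hm] at hES
  rw [hmap (fun x => ‖x - _‖ ^ 2) (by fun_prop)] at hES
  refine (lintegral_enorm_le_of_integral_sq_le ?_ (hES.trans hbound)).trans_eq ?_
  · exact MemLp.sub (MemLp.of_bound
      (measurable_avgBlock_laplacian_apply z hη hY.measurable_entry s t).aestronglyMeasurable _
      (ae_of_all _ fun _ => norm_avgBlock_apply_le _ z hη s t)) (memLp_const _)
  · rw [Real.sqrt_sq (by positivity)]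

/-- Removing a row and a column changes the averaged block by `O(n ^ (-1/2))` on average. -/
theorem IsElliptic.lintegral_enorm_avgBlock_zeroCross_sub_le (hξ : IsFamily P₀ μ γ ξ₁ ξ₂)
    (hY : IsElliptic P₀ ξ₁ ξ₂ P Y) (h0 : ∀ ω i, Y ω i i = 0) (hη : 0 < η.im) (k : Fin n)
    (s t : Fin 2) :
    ∫⁻ ω, ‖avgBlock (laplacian (zeroCross (Y ω) k)) (qMat z η) s t -
      avgBlock (laplacian (Y ω)) (qMat z η) s t‖ₑ ∂P ≤
        ENNReal.ofReal (8 * η.im⁻¹ ^ 2 / √n) := by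
  have hn : (0 : ℝ) < n := by exact_mod_cast k.pos
  set L : ℝ := 4 * η.im⁻¹ ^ 2 / (n * √n) with hL
  have hL0 : 0 ≤ L := by positivity
  have h1 : ∀ ω, ‖avgBlock (laplacian (zeroCross (Y ω) k)) (qMat z η) s t -
      avgBlock (laplacian (Y ω)) (qMat z η) s t‖ ≤ L * ∑ j, (‖Y ω k j‖ + ‖Y ω j k‖) := by
    intro ω
    refine (norm_avgBlock_laplacian_sub_le z hη _ _ s t).trans ?_
    rw [← hL]
    refine mul_le_mul_of_nonneg_left ?_ hL0
    have hij : ∀ i j, ‖zeroCross (Y ω) k i j - Y ω i j‖ ≤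
        (if i = k then ‖Y ω k j‖ else 0) + (if j = k then ‖Y ω i k‖ else 0) := by
      intro i j
      rw [zeroCross_apply]
      by_cases hi : i = k
      · subst hi
        have : 0 ≤ if j = i then ‖Y ω i i‖ else 0 := by positivity
        simpa using this
      · by_cases hj : j = k
        · subst hj; simp [hi]
        · simp [hi, hj]
    refine (Finset.sum_le_sum fun i _ => Finset.sum_le_sum fun j _ => hij i j).trans
      (le_of_eq ?_)
    simp only [Finset.sum_add_distrib]
    simp
  have h2 : ∀ j, Integrable (fun ω => ‖Y ω k j‖ + ‖Y ω j k‖) P ∧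
      ∫ ω, (‖Y ω k j‖ + ‖Y ω j k‖) ∂P ≤ 2 := by
    intro j
    have hp := hξ.isProbabilityMeasure_pairLaw k j
    have hi : Integrable (fun w : ℂ × ℂ => ‖w.1‖ + ‖w.2‖) (pairLaw P₀ ξ₁ ξ₂ k j) :=
      ((hξ.memLp_fst k j).norm.add (hξ.memLp_snd k j).norm).integrable (by norm_num)
    have hb : ∫ w, (‖w.1‖ + ‖w.2‖) ∂(pairLaw P₀ ξ₁ ξ₂ k j) ≤ 2 := by
      have h3 := hξ.integral_norm_add_sq_le k j
      have h4 : ∫ w, (‖w.1‖ + ‖w.2‖) ∂(pairLaw P₀ ξ₁ ξ₂ k j) ≤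
          ∫ w, ((‖w.1‖ + ‖w.2‖) ^ 2 / 4 + 1) ∂(pairLaw P₀ ξ₁ ξ₂ k j) := by
        refine integral_mono hi (((hξ.integrable_norm_add_sq k j).div_const 4).add
          (integrable_const 1)) fun w => ?_
        simp only []
        nlinarith [sq_nonneg (‖w.1‖ + ‖w.2‖ - 2)]
      rw [integral_add ((hξ.integrable_norm_add_sq k j).div_const 4) (integrable_const 1),
        integral_div] at h4
      simp at h4
      linarith
    rw [← hY.map_crossPairs h0] at hi hb
    rw [integral_map (hY.measurable_crossPairs k j).aemeasurable (by fun_prop)] at hb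
    exact ⟨(integrable_map_measure (by fun_prop)
      (hY.measurable_crossPairs k j).aemeasurable).1 hi, hb⟩
  have hm : ∀ i j, Measurable fun ω => zeroCross (Y ω) k i j := fun i j => by
    simp only [zeroCross_apply]
    split_ifs
    · exact measurable_const
    · exact hY.measurable_entry i j
  have hi : Integrable (fun ω => avgBlock (laplacian (zeroCross (Y ω) k)) (qMat z η) s t -
      avgBlock (laplacian (Y ω)) (qMat z η) s t) P :=
    (integrable_avgBlock_laplacian_apply z hη hm s t).sub
      (integrable_avgBlock_laplacian_apply z hη hY.measurable_entry s t)
  rw [← ofReal_integral_norm_eq_lintegral_enorm hi]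
  refine ENNReal.ofReal_le_ofReal ?_
  calc _ ≤ ∫ ω, L * ∑ j, (‖Y ω k j‖ + ‖Y ω j k‖) ∂P := integral_mono hi.norm
        ((integrable_finsetSum _ fun j _ => (h2 j).1).const_mul _) h1
    _ = L * ∑ j, ∫ ω, (‖Y ω k j‖ + ‖Y ω j k‖) ∂P := by
        rw [integral_const_mul, integral_finsetSum _ fun j _ => (h2 j).1]
    _ ≤ L * ∑ _j : Fin n, 2 := by gcongr with j; exact (h2 j).2
    _ = _ := by
        rw [hL]
        simp
        field_simp
        norm_num

end Concentration

/-! ### The Schur complement of a random matrix -/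

lemma lintegral_comp_prodMk_le_of_indepFun {Ω E F : Type*} [MeasurableSpace Ω] [MeasurableSpace E]
    [MeasurableSpace F] {P : Measure Ω} [IsFiniteMeasure P] {f : Ω → E} {g : Ω → F}
    (hfg : IndepFun f g P) (hf : Measurable f) (hg : Measurable g) {φ : E × F → ENNReal}
    (hφ : Measurable φ) {B : ENNReal} (hB : ∀ b, ∫⁻ a, φ (a, b) ∂(P.map f) ≤ B) :
    ∫⁻ ω, φ (f ω, g ω) ∂P ≤ B * P Set.univ := by
  rw [← lintegral_map hφ (hf.prodMk hg), hfg.map_prod_eq_prod_map_map hf.aemeasurable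
    hg.aemeasurable, lintegral_prod_symm _ hφ.aemeasurable]
  refine (lintegral_mono hB).trans_eq ?_
  rw [lintegral_const, Measure.map_apply hg MeasurableSet.univ, Set.preimage_univ]

section RowSum

open scoped Matrix.Norms.L2Operator

lemma sum_sum_norm_resolvent_sq_le {n : ℕ} (M : Matrix (Fin n) (Fin n) ℂ) (z : ℂ) {η : ℂ}
    (hη : 0 < η.im) (s t : Fin 2) :
    ∑ i, ∑ j, ‖resolvent M (qMat z η) (i, s) (j, t)‖ ^ 2 ≤ n * η.im⁻¹ ^ 2 := by
  have h : ∀ i, ∑ j, ‖resolvent M (qMat z η) (i, s) (j, t)‖ ^ 2 ≤ η.im⁻¹ ^ 2 := by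
    intro i
    calc ∑ j, ‖resolvent M (qMat z η) (i, s) (j, t)‖ ^ 2
        ≤ ∑ p, ‖resolvent M (qMat z η) (i, s) p‖ ^ 2 := by
          rw [Fintype.sum_prod_type]
          exact Finset.sum_le_sum fun j _ => Finset.single_le_sum
            (f := fun t => ‖resolvent M (qMat z η) (i, s) (j, t)‖ ^ 2)
            (fun _ _ => by positivity) (Finset.mem_univ t)
      _ ≤ ‖resolvent M (qMat z η)‖ ^ 2 := sum_row_sq_le _ _
      _ ≤ η.im⁻¹ ^ 2 := by gcongr; exact norm_resolvent_le M z hη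
  refine (Finset.sum_le_sum fun i _ => h i).trans_eq ?_
  simp

end RowSum

section Estimates

variable {Ω₀ Ω : Type*} [MeasurableSpace Ω₀] [MeasurableSpace Ω] {P₀ : Measure Ω₀}
  [IsProbabilityMeasure P₀] {μ γ : ℝ}
  {ξ₁ ξ₂ : Ω₀ → ℂ} {P : Measure Ω} [IsProbabilityMeasure P] {n : ℕ}
  {Y : Ω → Matrix (Fin n) (Fin n) ℂ} (z : ℂ) {η : ℂ}

/-- The matrix of the covariances `𝔼 rowVar s w * colVar t w`, for `w` distributed as the atom
variables. -/
noncomputable def covMat (γ : ℝ) : Matrix (Fin 2) (Fin 2) ℂ := !![1, γ; γ, 1]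

lemma norm_covMat_apply_le (hγ : |γ| ≤ 1) (s t : Fin 2) : ‖covMat γ s t‖ ≤ 1 := by
  fin_cases s <;> fin_cases t <;> simp [covMat, hγ]

/-- For a deterministic matrix `M`, the quadratic form in the Schur complement formula concentrates
around its expectation. -/
theorem IsFamily.lintegral_enorm_schurForm_sub_le (hξ : IsFamily P₀ μ γ ξ₁ ξ₂)
    (M : Matrix (Fin n) (Fin n) ℂ) (hη : 0 < η.im) (k : Fin n) {K : ℝ} (hK : 0 ≤ K)
    (s t : Fin 2) :
    ∫⁻ w, ‖schurForm (resolvent M (qMat z η)) w s t -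
        covMat γ s t * avgBlock M (qMat z η) (1 - s) (1 - t)‖ₑ
      ∂(Measure.pi fun j => pairLaw P₀ ξ₁ ξ₂ k j) ≤
    ENNReal.ofReal (2 * η.im⁻¹ * ((K + 1) / √n + tailMoment P₀ ξ₁ ξ₂ K) + η.im⁻¹ / n) := by
  have hn : (0 : ℝ) < n := by exact_mod_cast k.pos
  have hν := fun j => hξ.isProbabilityMeasure_pairLaw k j
  have hτ := tailMoment_nonneg (P₀ := P₀) (ξ₁ := ξ₁) (ξ₂ := ξ₂) K
  set r : Matrix (Fin n) (Fin n) ℂ := Matrix.of fun i j =>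
    resolvent M (qMat z η) (i, 1 - s) (j, 1 - t) with hr
  have hrb : ∀ i, ‖r i i‖ ≤ η.im⁻¹ := fun i => norm_diagBlock_apply_le M z hη i _ _
  have hq := lintegral_enorm_quadForm_le (fun j => pairLaw P₀ ξ₁ ξ₂ k j) (measurable_rowVar s)
    (measurable_colVar t) (hξ.memLp_rowVar s k) (hξ.memLp_colVar t k) (hξ.integral_rowVar s k)
    (hξ.integral_colVar t k) (hξ.integral_norm_rowVar_sq_le s k)
    (hξ.integral_norm_colVar_sq_le t k) hK hτ (inv_nonneg.2 hη.le)
    (hξ.integral_indicator_rowVar_mul_colVar_le hK s t k) hrb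
    (sum_sum_norm_resolvent_sq_le M z hη (1 - s) (1 - t))
  have hS : ∑ i, r i i * ∫ w, rowVar s w * colVar t w ∂(pairLaw P₀ ξ₁ ξ₂ k i) =
      covMat γ s t * (∑ i, r i i - r k k) := by
    simp only [hξ.integral_rowVar_mul_colVar s t k]
    rw [← Finset.sum_erase_eq_sub (Finset.mem_univ k), Finset.mul_sum,
      ← Finset.sum_erase_add _ _ (Finset.mem_univ k), if_pos rfl, mul_zero, add_zero]
    refine Finset.sum_congr rfl fun i hi => ?_
    rw [if_neg (Finset.ne_of_mem_erase hi), mul_comm]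
    rfl
  have hdec : ∀ w, schurForm (resolvent M (qMat z η)) w s t -
      covMat γ s t * avgBlock M (qMat z η) (1 - s) (1 - t) =
      (n : ℂ)⁻¹ * (∑ i, ∑ j, rowVar s (w i) * r i j * colVar t (w j) -
        ∑ i, r i i * ∫ w, rowVar s w * colVar t w ∂(pairLaw P₀ ξ₁ ξ₂ k i)) -
      (n : ℂ)⁻¹ * (covMat γ s t * r k k) := by
    intro w
    rw [hS, avgBlock_apply]
    simp only [schurForm, hr, Matrix.of_apply]
    ring
  have hle : ∀ w, ‖schurForm (resolvent M (qMat z η)) w s t -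
      covMat γ s t * avgBlock M (qMat z η) (1 - s) (1 - t)‖ₑ ≤
      ENNReal.ofReal ((n : ℝ)⁻¹) * ‖∑ i, ∑ j, rowVar s (w i) * r i j * colVar t (w j) -
        ∑ i, r i i * ∫ w, rowVar s w * colVar t w ∂(pairLaw P₀ ξ₁ ξ₂ k i)‖ₑ +
      ENNReal.ofReal (η.im⁻¹ / n) := by
    intro w
    rw [hdec w]
    refine (enorm_sub_le).trans (add_le_add (le_of_eq ?_) ?_)
    · rw [enorm_mul]
      congr 1
      rw [← ofReal_norm, norm_inv, Complex.norm_natCast]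
    · rw [← ofReal_norm]
      refine ENNReal.ofReal_le_ofReal ?_
      rw [norm_mul, norm_inv, Complex.norm_natCast, norm_mul, inv_mul_eq_div]
      gcongr
      exact (mul_le_of_le_one_left (norm_nonneg _) (norm_covMat_apply_le hξ.abs_gamma_le s t)).trans
        (hrb k)
  refine (lintegral_mono hle).trans ?_
  rw [lintegral_add_right _ measurable_const, lintegral_const_mul' _ _ ENNReal.ofReal_ne_top,
    lintegral_const, measure_univ, mul_one]
  refine (add_le_add (mul_le_mul_right hq _) le_rfl).trans_eq ?_
  rw [← ENNReal.ofReal_mul (by positivity), ← ENNReal.ofReal_add (by positivity) (by positivity)]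
  congr 1
  have : √(n : ℝ) * √n = n := Real.mul_self_sqrt hn.le
  have h3 : (n : ℝ)⁻¹ * √n = 1 / √n := by
    field_simp
    rw [sq, this]
  rw [mul_add, show (n : ℝ)⁻¹ * (2 * η.im⁻¹ * (K + 1) * √n) =
    2 * η.im⁻¹ * (K + 1) * ((n : ℝ)⁻¹ * √n) by ring, h3]
  field_simp

omit [IsProbabilityMeasure P₀] [IsProbabilityMeasure P] in
lemma IsElliptic.measurable_zeroCross (hY : IsElliptic P₀ ξ₁ ξ₂ P Y) (k i j : Fin n) :
    Measurable fun ω => zeroCross (Y ω) k i j := by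
  simp only [zeroCross_apply]
  split_ifs
  · exact measurable_const
  · exact hY.measurable_entry i j

lemma measurable_schurForm {E : Type*} [MeasurableSpace E]
    {R : E → Matrix (Fin n × Fin 2) (Fin n × Fin 2) ℂ} (hR : ∀ p p', Measurable fun x => R x p p')
    {w : E → Fin n → ℂ × ℂ} (hw : Measurable w) (s t : Fin 2) :
    Measurable fun x => schurForm (R x) (w x) s t := by
  simp only [schurForm, Matrix.of_apply]
  refine (Finset.measurable_fun_sum _ fun i _ => Finset.measurable_fun_sum _ fun j _ =>
    Measurable.mul (Measurable.mul ?_ (hR _ _)) ?_).const_mul _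
  · exact (measurable_rowVar s).comp ((measurable_pi_apply i).comp hw)
  · exact (measurable_colVar t).comp ((measurable_pi_apply j).comp hw)

/-- Row and column `k` are independent of the rest of the matrix, so the quadratic form in the Schur
complement formula concentrates around its conditional expectation. -/
theorem IsElliptic.lintegral_enorm_schurForm_sub_le (hξ : IsFamily P₀ μ γ ξ₁ ξ₂)
    (hY : IsElliptic P₀ ξ₁ ξ₂ P Y) (h0 : ∀ ω i, Y ω i i = 0) (hη : 0 < η.im) (k : Fin n)
    {K : ℝ} (hK : 0 ≤ K) (s t : Fin 2) :
    ∫⁻ ω, ‖schurForm (resolvent (laplacian (zeroCross (Y ω) k)) (qMat z η)) (crossPairs (Y ω) k) s t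
        - covMat γ s t * avgBlock (laplacian (zeroCross (Y ω) k)) (qMat z η) (1 - s) (1 - t)‖ₑ ∂P ≤
    ENNReal.ofReal (2 * η.im⁻¹ * ((K + 1) / √n + tailMoment P₀ ξ₁ ξ₂ K) + η.im⁻¹ / n) := by
  have hc : Measurable fun ω => crossPairs (Y ω) k :=
    measurable_pi_iff.2 fun j => hY.measurable_crossPairs k j
  have hlaw : P.map (fun ω => crossPairs (Y ω) k) =
      Measure.pi fun j => pairLaw P₀ ξ₁ ξ₂ k j := by
    rw [← funext fun j => hY.map_crossPairs h0 k j]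
    exact (iIndepFun_iff_map_fun_eq_pi_map fun j =>
      (hY.measurable_crossPairs k j).aemeasurable).1 (hY.iIndepFun_crossPairs k)
  let φ : (Fin n → ℂ × ℂ) × (Fin n → Fin n → ℂ) → ENNReal := fun p =>
    ‖schurForm (resolvent (laplacian (Matrix.of p.2)) (qMat z η)) p.1 s t -
      covMat γ s t * avgBlock (laplacian (Matrix.of p.2)) (qMat z η) (1 - s) (1 - t)‖ₑ
  have hφ : Measurable φ := by
    have hm : ∀ i j, Measurable fun p : (Fin n → ℂ × ℂ) × (Fin n → Fin n → ℂ) =>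
        Matrix.of p.2 i j := fun i j => by
      simp only [Matrix.of_apply]
      fun_prop
    exact ((measurable_schurForm (measurable_resolvent_laplacian_apply z hη hm) measurable_fst
      s t).sub ((measurable_avgBlock_laplacian_apply z hη hm _ _).const_mul _)).enorm
  have hB : ∀ b, ∫⁻ a, φ (a, b) ∂(P.map fun ω => crossPairs (Y ω) k) ≤ ENNReal.ofReal
      (2 * η.im⁻¹ * ((K + 1) / √n + tailMoment P₀ ξ₁ ξ₂ K) + η.im⁻¹ / n) := fun b => by
    rw [hlaw]
    exact hξ.lintegral_enorm_schurForm_sub_le z (laplacian (Matrix.of b)) hη k hK s t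
  have h := lintegral_comp_prodMk_le_of_indepFun (hY.indepFun_crossPairs_zeroCross k) hc
    (measurable_pi_iff.2 fun i => measurable_pi_iff.2 fun j => hY.measurable_zeroCross k i j) hφ hB
  rw [measure_univ, mul_one] at h
  exact h

omit [IsProbabilityMeasure P₀] in
/-- A column of the normalized matrix is small in the sup norm: the square of its largest entry is
at most `K` plus the sum of the squares of those entries for which `‖Y k j‖ ^ 2 + ‖Y j k‖ ^ 2`
exceeds `K`. -/
theorem IsElliptic.lintegral_norm_col_le (hξ : IsFamily P₀ μ γ ξ₁ ξ₂)
    (hY : IsElliptic P₀ ξ₁ ξ₂ P Y) (h0 : ∀ ω i, Y ω i i = 0) (k : Fin n) {K : ℝ} (hK : 0 ≤ K) :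
    ∫⁻ ω, ENNReal.ofReal (‖fun i => Y ω i k‖ / √n) ∂P ≤
      ENNReal.ofReal √(K / n + tailMoment P₀ ξ₁ ξ₂ K) := by
  have hn : (0 : ℝ) < n := by exact_mod_cast k.pos
  let S : ℂ × ℂ → ℝ := {w : ℂ × ℂ | K < ‖w.1‖ ^ 2 + ‖w.2‖ ^ 2}.indicator
      (fun w => ‖w.1‖ ^ 2 + ‖w.2‖ ^ 2)
  have hS0 : ∀ w, 0 ≤ S w := fun w => Set.indicator_nonneg (fun _ _ => by positivity) w
  have hSm : Measurable S := measurable_indicator_norm_sq_add K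
  have hSi : ∀ j, Integrable (fun ω => S (crossPairs (Y ω) k j)) P ∧
      ∫ ω, S (crossPairs (Y ω) k j) ∂P ≤ tailMoment P₀ ξ₁ ξ₂ K := by
    intro j
    have hi : Integrable S (pairLaw P₀ ξ₁ ξ₂ k j) :=
      (hξ.integrable_norm_sq_add_pairLaw k j).indicator
        (measurableSet_lt measurable_const (by fun_prop))
    have hb := hξ.integral_indicator_pairLaw_le hK k j
    change ∫ w, S w ∂_ ≤ _ at hb
    have hc := (hY.measurable_crossPairs k j).aemeasurable (μ := P)
    rw [← hY.map_crossPairs h0] at hi hb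
    rw [integral_map hc hSm.aestronglyMeasurable] at hb
    exact ⟨(integrable_map_measure hSm.aestronglyMeasurable hc).1 hi, hb⟩
  have hpt : ∀ ω, ‖fun i => Y ω i k‖ ^ 2 ≤ K + ∑ j, S (crossPairs (Y ω) k j) := by
    intro ω
    have hT : 0 ≤ K + ∑ j, S (crossPairs (Y ω) k j) :=
      add_nonneg hK (Finset.sum_nonneg fun j _ => hS0 _)
    rw [← Real.le_sqrt (norm_nonneg _) hT, pi_norm_le_iff_of_nonneg (Real.sqrt_nonneg _)]
    intro i
    rw [Real.le_sqrt (norm_nonneg _) hT]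
    have h1 := Finset.single_le_sum (f := fun j => S (crossPairs (Y ω) k j)) (fun j _ => hS0 _)
      (Finset.mem_univ i)
    have h2 : ‖Y ω i k‖ ^ 2 ≤ K + S (crossPairs (Y ω) k i) := by
      simp only [S, Set.indicator_apply, Set.mem_ofPred_eq, crossPairs]
      split_ifs with h
      · nlinarith [sq_nonneg ‖Y ω k i‖]
      · nlinarith [sq_nonneg ‖Y ω k i‖]
    linarith
  let f : Ω → ℂ := fun ω => ((‖fun i => Y ω i k‖ / √n : ℝ) : ℂ)
  have hfn : ∀ ω, ‖f ω‖ = ‖fun i => Y ω i k‖ / √n := fun ω => by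
    rw [Complex.norm_real, Real.norm_of_nonneg (by positivity)]
  have hfm : Measurable f :=
    Complex.measurable_ofReal.comp ((measurable_norm.comp (measurable_pi_iff.2 fun i =>
      hY.measurable_entry i k)).div_const _)
  have hdom : Integrable (fun ω => (n : ℝ)⁻¹ * (K + ∑ j, S (crossPairs (Y ω) k j))) P :=
    ((integrable_const K).add (integrable_finsetSum _ fun j _ => (hSi j).1)).const_mul _
  have hfb : ∀ ω, ‖f ω‖ ^ 2 ≤ (n : ℝ)⁻¹ * (K + ∑ j, S (crossPairs (Y ω) k j)) := by
    intro ω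
    rw [hfn, div_pow, Real.sq_sqrt hn.le, ← inv_mul_eq_div]
    gcongr
    exact hpt ω
  have hfL : MemLp f 2 P := by
    rw [memLp_two_iff_integrable_sq_norm hfm.aestronglyMeasurable]
    exact hdom.mono' (by fun_prop) (ae_of_all _ fun ω => by
      rw [Real.norm_of_nonneg (by positivity)]; exact hfb ω)
  have hfI : ∫ ω, ‖f ω‖ ^ 2 ∂P ≤ K / n + tailMoment P₀ ξ₁ ξ₂ K := by
    refine (integral_mono_of_nonneg (ae_of_all _ fun ω => by positivity) hdom
      (ae_of_all _ hfb)).trans ?_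
    rw [integral_const_mul, integral_add (integrable_const K)
      (integrable_finsetSum _ fun j _ => (hSi j).1), integral_finsetSum _ fun j _ => (hSi j).1]
    have : ∑ j, ∫ ω, S (crossPairs (Y ω) k j) ∂P ≤ n * tailMoment P₀ ξ₁ ξ₂ K := by
      refine (Finset.sum_le_sum fun j _ => (hSi j).2).trans_eq ?_
      simp
    calc _ ≤ (n : ℝ)⁻¹ * (K + n * tailMoment P₀ ξ₁ ξ₂ K) := by
          gcongr
          simp
      _ = _ := by field_simp
  refine (lintegral_mono fun ω => le_of_eq ?_).trans (lintegral_enorm_le_of_integral_sq_le hfL hfI)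
  rw [← ofReal_norm, hfn]

end Estimates

/-! ### The approximate fixed point equation -/

section FixedPoint

variable {Ω₀ Ω : Type*} [MeasurableSpace Ω₀] [MeasurableSpace Ω] {P₀ : Measure Ω₀}
  [IsProbabilityMeasure P₀] {μ γ : ℝ}
  {ξ₁ ξ₂ : Ω₀ → ℂ} {P : Measure Ω} [IsProbabilityMeasure P] {n : ℕ}
  {Y : Ω → Matrix (Fin n) (Fin n) ℂ} (z : ℂ) {η : ℂ}

/-- The error in the approximate fixed point equation, in terms of the lower bound `c` for the
imaginary part of `B - 1 ⊗ q`, the truncation level `K`, and the second moment `τ` of the part of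
the atom variables above that level. -/
noncomputable def schurError (c τ K : ℝ) (n : ℕ) : ℝ :=
  c⁻¹ ^ 2 * √(K / n + τ) + 4 * (c⁻¹ ^ 2 *
    (2 * c⁻¹ * ((K + 1) / √n + τ) + c⁻¹ / n + 8 * c⁻¹ ^ 2 / √n + 8 * c⁻¹ ^ 2 / √n))

omit [IsProbabilityMeasure P] in
lemma expectation_avgBlock_one_one (hη : 0 < η.im) :
    expectation P (fun ω => avgBlock (laplacian (Y ω)) (qMat z η)) 1 1 =
      expectation P (fun ω => avgBlock (laplacian (Y ω)) (qMat z η)) 0 0 := by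
  simp only [expectation, Matrix.of_apply, avgBlock_one_one _ z hη]

/-- The expectation of the averaged block inherits the bound that makes the matrix in the fixed
point equation invertible. -/
lemma norm_expectation_avgBlock_sub_le (hη : 0 < η.im)
    (hY : ∀ i j, Measurable fun ω => Y ω i j) :
    ‖expectation P (fun ω => avgBlock (laplacian (Y ω)) (qMat z η)) 1 0 -
      conj (expectation P (fun ω => avgBlock (laplacian (Y ω)) (qMat z η)) 0 1)‖ ≤
      2 * (expectation P (fun ω => avgBlock (laplacian (Y ω)) (qMat z η)) 0 0).im := by
  have hi := fun s t => integrable_avgBlock_laplacian_apply (P := P) z hη hY s t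
  have hc : Integrable (fun ω => conj (avgBlock (laplacian (Y ω)) (qMat z η) 0 1)) P :=
    (Complex.conjCLE : ℂ →L[ℝ] ℂ).integrable_comp (hi 0 1)
  have him : (∫ ω, avgBlock (laplacian (Y ω)) (qMat z η) 0 0 ∂P).im =
      ∫ ω, (avgBlock (laplacian (Y ω)) (qMat z η) 0 0).im ∂P := (integral_im (hi 0 0)).symm
  simp only [expectation, Matrix.of_apply]
  rw [him, ← integral_conj, ← integral_sub (hi 1 0) hc, ← integral_const_mul]
  refine (norm_integral_le_integral_norm _).trans (integral_mono ((hi 1 0).sub hc).norm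
    ((hi 0 0).im.const_mul 2) fun ω => norm_avgBlock_sub_le _ z hη)

/-- Up to a small error, the expectation of a diagonal block of the resolvent is minus that of the
inverse of the matrix in the fixed point equation, with a diagonal entry of the Laplacian in the
place of the Gaussian variable. -/
theorem IsElliptic.lintegral_enorm_resolvent_add_le (hξ : IsFamily P₀ μ γ ξ₁ ξ₂)
    (hY : IsElliptic P₀ ξ₁ ξ₂ P Y) (h0 : ∀ ω i, Y ω i i = 0) (hη : 0 < η.im)
    {K : ℝ} (hK : 0 ≤ K) {E : Matrix (Fin 2) (Fin 2) ℂ}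
    (hE : E = expectation P fun ω => avgBlock (laplacian (Y ω)) (qMat z η)) (k : Fin n)
    (s t : Fin 2) :
    ∫⁻ ω, ‖resolvent (laplacian (Y ω)) (qMat z η) (k, s) (k, t) +
        (fixedPointMat γ (qMat z η) (E 0 0) (E 0 1) (E 1 0) (laplacian (Y ω) k k))⁻¹ s t‖ₑ ∂P ≤
      ENNReal.ofReal (schurError η.im (tailMoment P₀ ξ₁ ξ₂ K) K n) := by
  have hn : (0 : ℝ) < n := by exact_mod_cast k.pos
  have hτ := tailMoment_nonneg (P₀ := P₀) (ξ₁ := ξ₁) (ξ₂ := ξ₂) K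
  set c := η.im with hc
  set τ := tailMoment P₀ ξ₁ ξ₂ K
  have hE11 : E 1 1 = E 0 0 := by rw [hE]; exact expectation_avgBlock_one_one z hη
  have hEb : ‖E 1 0 - conj (E 0 1)‖ ≤ 2 * (E 0 0).im := by
    rw [hE]; exact norm_expectation_avgBlock_sub_le z hη hY.measurable_entry
  -- the conditional mean of the quadratic form, with the averaged block replaced by its expectation
  have hEκ : ∀ u v, (!![E 0 0, γ * E 1 0; γ * E 0 1, E 0 0] : Matrix (Fin 2) (Fin 2) ℂ) u v =
      covMat γ u v * E (1 - u) (1 - v) := by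
    intro u v
    fin_cases u <;> fin_cases v <;> simp [covMat, hE11]
  -- the quadratic form minus its conditional mean, the effect of removing row and column `k`, and
  -- the fluctuation of the averaged block
  let T : Fin 2 → Fin 2 → Ω → ℂ := fun u v ω =>
    schurForm (resolvent (laplacian (zeroCross (Y ω) k)) (qMat z η)) (crossPairs (Y ω) k) u v
      - covMat γ u v * avgBlock (laplacian (zeroCross (Y ω) k)) (qMat z η) (1 - u) (1 - v)
  let U : Fin 2 → Fin 2 → Ω → ℂ := fun u v ω =>
    avgBlock (laplacian (zeroCross (Y ω) k)) (qMat z η) u v -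
      avgBlock (laplacian (Y ω)) (qMat z η) u v
  let V : Fin 2 → Fin 2 → Ω → ℂ := fun u v ω =>
    avgBlock (laplacian (Y ω)) (qMat z η) u v - E u v
  have hzc := hY.measurable_zeroCross k
  have hcp : Measurable fun ω => crossPairs (Y ω) k :=
    measurable_pi_iff.2 fun j => hY.measurable_crossPairs k j
  have hTm : ∀ u v, Measurable (T u v) := fun u v =>
    (measurable_schurForm (measurable_resolvent_laplacian_apply z hη hzc) hcp u v).sub
      ((measurable_avgBlock_laplacian_apply z hη hzc _ _).const_mul _)
  have hUm : ∀ u v, Measurable (U u v) := fun u v =>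
    (measurable_avgBlock_laplacian_apply z hη hzc _ _).sub
      (measurable_avgBlock_laplacian_apply z hη hY.measurable_entry _ _)
  have hVm : ∀ u v, Measurable (V u v) := fun u v =>
    (measurable_avgBlock_laplacian_apply z hη hY.measurable_entry _ _).sub_const _
  have hnm : Measurable fun ω => ‖fun i => Y ω i k‖ / √n :=
    (measurable_norm.comp (measurable_pi_iff.2 fun i => hY.measurable_entry i k)).div_const _
  have huv : ∀ u v, ∫⁻ ω, (‖T u v ω‖ₑ + ‖U (1 - u) (1 - v) ω‖ₑ + ‖V (1 - u) (1 - v) ω‖ₑ) ∂P ≤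
      ENNReal.ofReal (2 * c⁻¹ * ((K + 1) / √n + τ) + c⁻¹ / n + 8 * c⁻¹ ^ 2 / √n +
        8 * c⁻¹ ^ 2 / √n) := by
    intro u v
    rw [lintegral_add_right _ (hVm _ _).enorm, lintegral_add_right _ (hUm _ _).enorm,
      ENNReal.ofReal_add (by positivity) (by positivity),
      ENNReal.ofReal_add (by positivity) (by positivity)]
    refine add_le_add (add_le_add ?_ ?_) ?_
    · exact hY.lintegral_enorm_schurForm_sub_le z hξ h0 hη k hK u v
    · exact hY.lintegral_enorm_avgBlock_zeroCross_sub_le z hξ h0 hη k _ _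
    · have := hY.lintegral_enorm_avgBlock_sub_le z hξ h0 hη (1 - u) (1 - v)
      simp only [V, hE]
      exact this
  have hpt : ∀ ω, ‖resolvent (laplacian (Y ω)) (qMat z η) (k, s) (k, t) +
      (fixedPointMat γ (qMat z η) (E 0 0) (E 0 1) (E 1 0) (laplacian (Y ω) k k))⁻¹ s t‖ₑ ≤
      ENNReal.ofReal (c⁻¹ ^ 2) * ENNReal.ofReal (‖fun i => Y ω i k‖ / √n) +
      ENNReal.ofReal (c⁻¹ ^ 2) * ∑ u, ∑ v,
        (‖T u v ω‖ₑ + ‖U (1 - u) (1 - v) ω‖ₑ + ‖V (1 - u) (1 - v) ω‖ₑ) := by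
    intro ω
    have h1 := norm_resolvent_add_inv_fixedPointMat_le (Y ω) z k hη (h0 ω) hξ.abs_gamma_le hEb s t
    have h2 : ∀ u v, ‖(schurForm (resolvent (laplacian (zeroCross (Y ω) k)) (qMat z η))
        (crossPairs (Y ω) k) - !![E 0 0, γ * E 1 0; γ * E 0 1, E 0 0]) u v‖ ≤
        ‖T u v ω‖ + ‖U (1 - u) (1 - v) ω‖ + ‖V (1 - u) (1 - v) ω‖ := by
      intro u v
      have h3 : (schurForm (resolvent (laplacian (zeroCross (Y ω) k)) (qMat z η))
        (crossPairs (Y ω) k) - !![E 0 0, γ * E 1 0; γ * E 0 1, E 0 0]) u v =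
          T u v ω + covMat γ u v * U (1 - u) (1 - v) ω + covMat γ u v * V (1 - u) (1 - v) ω := by
        rw [Matrix.sub_apply, hEκ]
        simp only [T, U, V]
        ring
      rw [h3]
      have h4 : ∀ x : ℂ, ‖covMat γ u v * x‖ ≤ ‖x‖ := fun x => by
        rw [norm_mul]
        exact mul_le_of_le_one_left (norm_nonneg _) (norm_covMat_apply_le hξ.abs_gamma_le u v)
      exact (norm_add₃_le).trans (add_le_add (add_le_add le_rfl (h4 _)) (h4 _))
    have h5 := h1.trans (add_le_add le_rfl (mul_le_mul_of_nonneg_left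
      (Finset.sum_le_sum fun u _ => Finset.sum_le_sum fun v _ => h2 u v) (by positivity)))
    rw [← ofReal_norm]
    refine (ENNReal.ofReal_le_ofReal h5).trans_eq ?_
    simp only [← ofReal_norm]
    rw [ENNReal.ofReal_add (by positivity) (by positivity), ENNReal.ofReal_mul (by positivity),
      ENNReal.ofReal_mul (by positivity), ENNReal.ofReal_sum_of_nonneg fun _ _ => by positivity]
    congr 2
    refine Finset.sum_congr rfl fun u _ => ?_
    rw [ENNReal.ofReal_sum_of_nonneg fun _ _ => by positivity]
    refine Finset.sum_congr rfl fun v _ => ?_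
    rw [ENNReal.ofReal_add (by positivity) (by positivity),
      ENNReal.ofReal_add (by positivity) (by positivity)]
  refine (lintegral_mono hpt).trans ?_
  have hm3 : ∀ u v, Measurable fun ω =>
      ‖T u v ω‖ₑ + ‖U (1 - u) (1 - v) ω‖ₑ + ‖V (1 - u) (1 - v) ω‖ₑ := fun u v =>
    ((hTm _ _).enorm.add (hUm _ _).enorm).add (hVm _ _).enorm
  rw [lintegral_add_left (hnm.ennreal_ofReal.const_mul _),
    lintegral_const_mul' _ _ ENNReal.ofReal_ne_top, lintegral_const_mul' _ _ ENNReal.ofReal_ne_top,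
    lintegral_finsetSum _ fun u _ => Finset.measurable_fun_sum _ fun v _ => hm3 u v]
  simp only [lintegral_finsetSum _ fun v _ => hm3 _ v]
  refine (add_le_add (mul_le_mul_right (hY.lintegral_norm_col_le hξ h0 k hK) _)
    (mul_le_mul_right (Finset.sum_le_sum fun u _ => Finset.sum_le_sum fun v _ => huv u v)
      _)).trans_eq ?_
  have hD : 0 ≤ 2 * c⁻¹ * ((K + 1) / √n + τ) + c⁻¹ / n + 8 * c⁻¹ ^ 2 / √n + 8 * c⁻¹ ^ 2 / √n := by
    positivity
  rw [schurError]
  generalize 2 * c⁻¹ * ((K + 1) / √n + τ) + c⁻¹ / n + 8 * c⁻¹ ^ 2 / √n + 8 * c⁻¹ ^ 2 / √n = D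
    at hD ⊢
  rw [ENNReal.ofReal_add (by positivity) (by positivity), ENNReal.ofReal_mul (by positivity),
    ENNReal.ofReal_mul (by positivity), ENNReal.ofReal_mul (by positivity)]
  congr 1
  simp only [Finset.sum_const, Finset.card_univ, Fintype.card_fin, nsmul_eq_mul,
    ENNReal.ofReal_ofNat, Nat.cast_ofNat]
  ring

/-- The average of the laws of the diagonal entries of the Laplacian. -/
noncomputable def diagLaw (P : Measure Ω) (Y : Ω → Matrix (Fin n) (Fin n) ℂ) : Measure ℂ :=
  (n : ENNReal)⁻¹ • ∑ k, P.map fun ω => laplacian (Y ω) k k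

omit [IsProbabilityMeasure P] in
lemma measurable_laplacian_apply (hY : ∀ i j, Measurable fun ω => Y ω i j) (i j : Fin n) :
    Measurable fun ω => laplacian (Y ω) i j := by
  by_cases h : i = j
  · subst h
    simp only [laplacian, rowSums, Matrix.smul_apply, Matrix.sub_apply, Matrix.diagonal_apply_eq,
      smul_eq_mul]
    exact ((hY i i).sub (Finset.measurable_fun_sum _ fun k _ => hY i k)).const_mul _
  · simp only [laplacian, rowSums, Matrix.smul_apply, Matrix.sub_apply,
      Matrix.diagonal_apply_ne _ h, smul_eq_mul]
    exact ((hY i j).sub_const _).const_mul _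

lemma integral_diagLaw (hY : ∀ i j, Measurable fun ω => Y ω i j) {f : ℂ → ℂ} (hf : Measurable f)
    {C : ℝ} (hC : ∀ g, ‖f g‖ ≤ C) :
    ∫ g, f g ∂(diagLaw P Y) = (n : ℂ)⁻¹ * ∑ k, ∫ ω, f (laplacian (Y ω) k k) ∂P := by
  have hm := fun k => (measurable_laplacian_apply hY k k).aemeasurable (μ := P)
  have hp : ∀ k, IsProbabilityMeasure (P.map fun ω => laplacian (Y ω) k k) := fun k =>
    Measure.isProbabilityMeasure_map (hm k)
  rw [diagLaw, integral_smul_measure, integral_finsetSum_measure fun k _ =>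
    Integrable.of_bound hf.aestronglyMeasurable C (ae_of_all _ hC)]
  simp only [integral_map (hm _) hf.aestronglyMeasurable]
  simp

lemma isProbabilityMeasure_diagLaw (hY : ∀ i j, Measurable fun ω => Y ω i j) (hn : n ≠ 0) :
    IsProbabilityMeasure (diagLaw P Y) := by
  have hp : ∀ k, IsProbabilityMeasure (P.map fun ω => laplacian (Y ω) k k) := fun k =>
    Measure.isProbabilityMeasure_map (measurable_laplacian_apply hY k k).aemeasurable
  constructor
  simp only [diagLaw, Measure.smul_apply, Measure.finsetSum_apply, measure_univ, smul_eq_mul]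
  simp only [Finset.sum_const, Finset.card_univ, Fintype.card_fin, nsmul_eq_mul, mul_one]
  exact ENNReal.inv_mul_cancel (by exact_mod_cast hn) (ENNReal.natCast_ne_top n)

lemma continuous_inv_fixedPointMat_apply {α β δ : ℂ} (hη : 0 < η.im) (hγ : |γ| ≤ 1)
    (h : ‖δ - conj β‖ ≤ 2 * α.im) (s t : Fin 2) :
    Continuous fun g => (fixedPointMat γ (qMat z η) α β δ g)⁻¹ s t := by
  have h1 : Continuous fun g => fixedPointMat γ (qMat z η) α β δ g := by
    refine continuous_const.sub (continuous_matrix fun s t => ?_)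
    fin_cases s <;> fin_cases t <;> simp [offDiag] <;> fun_prop
  simp only [Matrix.inv_def, Ring.inverse_eq_inv']
  exact ((h1.matrix_det.inv₀ fun g => (isUnit_det_fixedPointMat hη hγ h g).ne_zero).smul
    h1.matrix_adjugate).matrix_elem s t

/-- The expectation of the averaged block solves the fixed point equation up to a small error, with
`diagLaw` in the place of the Gaussian law. -/
theorem IsElliptic.norm_expectation_add_integral_le (hξ : IsFamily P₀ μ γ ξ₁ ξ₂)
    (hY : IsElliptic P₀ ξ₁ ξ₂ P Y) (h0 : ∀ ω i, Y ω i i = 0) (hη : 0 < η.im) (hn : n ≠ 0)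
    {K : ℝ} (hK : 0 ≤ K) {E : Matrix (Fin 2) (Fin 2) ℂ}
    (hE : E = expectation P fun ω => avgBlock (laplacian (Y ω)) (qMat z η)) (s t : Fin 2) :
    ‖E s t + ∫ g, (fixedPointMat γ (qMat z η) (E 0 0) (E 0 1) (E 1 0) g)⁻¹ s t ∂(diagLaw P Y)‖ ≤
      schurError η.im (tailMoment P₀ ξ₁ ξ₂ K) K n := by
  have hτ := tailMoment_nonneg (P₀ := P₀) (ξ₁ := ξ₁) (ξ₂ := ξ₂) K
  have hn1 : (0 : ℝ) < n := by exact_mod_cast Nat.pos_of_ne_zero hn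
  have hEb : ‖E 1 0 - conj (E 0 1)‖ ≤ 2 * (E 0 0).im := by
    rw [hE]; exact norm_expectation_avgBlock_sub_le z hη hY.measurable_entry
  have hcont := continuous_inv_fixedPointMat_apply z hη hξ.abs_gamma_le hEb s t
  have hRi : ∀ k, Integrable (fun ω => resolvent (laplacian (Y ω)) (qMat z η) (k, s) (k, t)) P :=
    fun k => Integrable.of_bound (measurable_resolvent_laplacian_apply z hη hY.measurable_entry _
      _).aestronglyMeasurable _ (ae_of_all _ fun ω => norm_diagBlock_apply_le _ z hη k s t)
  have hFi : ∀ k, Integrable (fun ω => (fixedPointMat γ (qMat z η) (E 0 0) (E 0 1) (E 1 0)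
      (laplacian (Y ω) k k))⁻¹ s t) P := fun k =>
    Integrable.of_bound (hcont.measurable.comp
      (measurable_laplacian_apply hY.measurable_entry k k)).aestronglyMeasurable _
      (ae_of_all _ fun ω => norm_inv_fixedPointMat_apply_le hη hξ.abs_gamma_le hEb _ s t)
  have h1 : E s t = (n : ℂ)⁻¹ *
      ∑ k, ∫ ω, resolvent (laplacian (Y ω)) (qMat z η) (k, s) (k, t) ∂P := by
    rw [hE, expectation, Matrix.of_apply]
    simp only [avgBlock_apply]
    rw [integral_const_mul, integral_finsetSum _ fun k _ => hRi k]
  rw [integral_diagLaw hY.measurable_entry hcont.measurable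
    fun g => norm_inv_fixedPointMat_apply_le hη hξ.abs_gamma_le hEb g s t]
  nth_rewrite 1 [h1]
  rw [← mul_add, ← Finset.sum_add_distrib, norm_mul, norm_inv, Complex.norm_natCast,
    inv_mul_le_iff₀ hn1]
  refine (norm_sum_le _ _).trans ((Finset.sum_le_sum fun k _ => ?_).trans_eq
    (b := ∑ _k : Fin n, schurError η.im (tailMoment P₀ ξ₁ ξ₂ K) K n) (by simp))
  rw [← integral_add (hRi k) (hFi k)]
  have h2 := (enorm_integral_le_lintegral_enorm _).trans
    (hY.lintegral_enorm_resolvent_add_le z hξ h0 hη hK hE k s t)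
  rw [← ofReal_norm] at h2
  exact (ENNReal.ofReal_le_ofReal_iff (by unfold schurError; positivity)).1 h2

end FixedPoint

/-! ### The central limit theorem for the diagonal entries -/

section CentralLimit

variable {Ω₀ Ω : Type*} [MeasurableSpace Ω₀] [MeasurableSpace Ω] {P₀ : Measure Ω₀}
  [IsProbabilityMeasure P₀] {μ γ : ℝ}
  {ξ₁ ξ₂ : Ω₀ → ℂ} {P : Measure Ω} [IsProbabilityMeasure P] {n : ℕ}
  {Y : Ω → Matrix (Fin n) (Fin n) ℂ}

lemma laplacian_apply_self_eq_sum {Y : Matrix (Fin n) (Fin n) ℂ} (h0 : ∀ i, Y i i = 0) (k : Fin n) :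
    laplacian Y k k = ∑ j, (-(√n)⁻¹ : ℝ) • Y k j := by
  simp [laplacian, rowSums, h0, Finset.mul_sum]

omit [IsProbabilityMeasure P₀] [IsProbabilityMeasure P] in
lemma IsElliptic.charFun_map_laplacian (hY : IsElliptic P₀ ξ₁ ξ₂ P Y) (h0 : ∀ ω i, Y ω i i = 0)
    (k : Fin n) (t : ℂ) :
    charFun (P.map fun ω => laplacian (Y ω) k k) t =
      ∏ j, charFun (P.map fun ω => Y ω k j) ((-(√n)⁻¹ : ℝ) • t) := by
  have hi : iIndepFun (fun j ω => (-(√n)⁻¹ : ℝ) • Y ω k j) P :=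
    (hY.iIndepFun_crossPairs k).comp (fun _ w => (-(√n)⁻¹ : ℝ) • w.1) fun _ => by fun_prop
  have hm : ∀ j, Measurable fun ω => (-(√n)⁻¹ : ℝ) • Y ω k j := fun j =>
    (hY.measurable_entry k j).const_smul (-(√n)⁻¹ : ℝ)
  simp only [laplacian_apply_self_eq_sum (h0 _) k]
  have hr : iIndepFun (Finset.univ.restrict fun j ω => (-(√n)⁻¹ : ℝ) • Y ω k j) P :=
    hi.precomp (g := fun j : (Finset.univ : Finset (Fin n)) => (j : Fin n)) Subtype.val_injective
  have h := iIndepFun.charFun_map_fun_finsetSum_eq_prod (s := Finset.univ)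
    (X := fun j ω => (-(√n)⁻¹ : ℝ) • Y ω k j) (fun j _ => (hm j).aemeasurable) hr
  rw [h, Finset.prod_apply]
  refine Finset.prod_congr rfl fun j _ => ?_
  rw [← charFun_map_smul, Measure.map_map (by fun_prop) (hY.measurable_entry k j)]
  rfl

omit [IsProbabilityMeasure P₀] in
/-- Each off-diagonal entry is distributed as `ξ₁` or `ξ₂`, so the law of a diagonal entry of the
Laplacian is compared with the `n`-fold convolution of a Gaussian. -/
lemma IsElliptic.norm_charFun_map_laplacian_sub_le (hξ : IsFamily P₀ μ γ ξ₁ ξ₂)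
    (hY : IsElliptic P₀ ξ₁ ξ₂ P Y) (h0 : ∀ ω i, Y ω i i = 0) (k : Fin n) (t : ℂ) {v : ℝ}
    (hv : 0 ≤ v) :
    ‖charFun (P.map fun ω => laplacian (Y ω) k k) t - Complex.exp (-(v : ℂ) / 2)‖ ≤
      n * ‖charFun (P₀.map ξ₁) ((-(√n)⁻¹ : ℝ) • t) - Complex.exp (-(v : ℂ) / 2 / n)‖ +
      n * ‖charFun (P₀.map ξ₂) ((-(√n)⁻¹ : ℝ) • t) - Complex.exp (-(v : ℂ) / 2 / n)‖ +
      ‖1 - Complex.exp (-(v : ℂ) / 2 / n)‖ := by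
  have hn : (n : ℂ) ≠ 0 := by exact_mod_cast k.pos.ne'
  set b := Complex.exp (-(v : ℂ) / 2 / n)
  set s : ℂ := (-(√n)⁻¹ : ℝ) • t
  have hb : ‖b‖ ≤ 1 := by
    have : -(v : ℂ) / 2 / n = ((-v / 2 / n : ℝ) : ℂ) := by push_cast; rfl
    rw [Complex.norm_exp, this, Complex.ofReal_re, Real.exp_le_one_iff, neg_div, neg_div]
    exact neg_nonpos.2 (by positivity)
  have hexp : Complex.exp (-(v : ℂ) / 2) = ∏ _j : Fin n, b := by
    rw [Finset.prod_const, Finset.card_univ, Fintype.card_fin, ← Complex.exp_nat_mul]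
    congr 1
    field_simp
  have hp : ∀ j, IsProbabilityMeasure (P.map fun ω => Y ω k j) := fun j =>
    Measure.isProbabilityMeasure_map (hY.measurable_entry k j).aemeasurable
  rw [hY.charFun_map_laplacian h0, hexp]
  refine (norm_prod_sub_prod_le _ (fun j => norm_charFun_le_one _) fun _ => hb).trans ?_
  have hmap : ∀ j, P.map (fun ω => Y ω k j) = (pairLaw P₀ ξ₁ ξ₂ k j).map Prod.fst := by
    intro j
    rw [← hY.map_crossPairs h0, Measure.map_map measurable_fst (hY.measurable_crossPairs k j)]
    rfl
  have h1 : ∀ j, ‖charFun (P.map fun ω => Y ω k j) s - b‖ ≤ ‖charFun (P₀.map ξ₁) s - b‖ +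
      ‖charFun (P₀.map ξ₂) s - b‖ + if j = k then ‖1 - b‖ else 0 := by
    intro j
    have m12 := hξ.aemeasurable₁.prodMk hξ.aemeasurable₂
    have m21 := hξ.aemeasurable₂.prodMk hξ.aemeasurable₁
    rw [hmap, pairLaw]
    rcases lt_trichotomy k j with h | h | h
    · rw [if_pos h, if_neg h.ne', AEMeasurable.map_map_of_aemeasurable
        measurable_fst.aemeasurable m12]
      simp only [add_zero]
      exact le_add_of_nonneg_right (norm_nonneg _)
    · rw [h, if_neg (lt_irrefl _), if_neg (lt_irrefl _), if_pos rfl,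
        Measure.map_dirac' measurable_fst, charFun_dirac]
      simp only [Prod.fst_zero, inner_zero_left, Complex.ofReal_zero, zero_mul, Complex.exp_zero]
      exact le_add_of_nonneg_left (by positivity)
    · rw [if_neg h.not_gt, if_pos h, if_neg h.ne, AEMeasurable.map_map_of_aemeasurable
        measurable_fst.aemeasurable m21]
      simp only [add_zero]
      exact le_add_of_nonneg_left (norm_nonneg _)
  refine (Finset.sum_le_sum fun j _ => h1 j).trans_eq ?_
  simp [Finset.sum_add_distrib]

lemma charFun_diagLaw (hY : ∀ i j, Measurable fun ω => Y ω i j) (t : ℂ) :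
    charFun (diagLaw P Y) t =
      (n : ℂ)⁻¹ * ∑ k, charFun (P.map fun ω => laplacian (Y ω) k k) t := by
  rw [charFun_apply, integral_diagLaw hY (by fun_prop) (C := 1) fun g => ?_]
  · congr 1
    refine Finset.sum_congr rfl fun k _ => ?_
    rw [charFun_apply, integral_map (measurable_laplacian_apply hY k k).aemeasurable
      (by fun_prop)]
  · rw [Complex.norm_exp_ofReal_mul_I]

end CentralLimit

/-! ### Passage to the limit -/

section Limit

variable {Ω₀ : Type*} [MeasurableSpace Ω₀] {P₀ : Measure Ω₀} [IsProbabilityMeasure P₀] {μ γ : ℝ}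
  {ξ₁ ξ₂ : Ω₀ → ℂ} {Ω : ℕ → Type*} [∀ n, MeasurableSpace (Ω n)] {P : ∀ n, Measure (Ω n)}
  [∀ n, IsProbabilityMeasure (P n)] {Y : ∀ n, Ω n → Matrix (Fin n) (Fin n) ℂ}

theorem tendsto_charFun_diagLaw (hξ : IsFamily P₀ μ γ ξ₁ ξ₂)
    (hY : ∀ n, IsElliptic P₀ ξ₁ ξ₂ (P n) (Y n)) (h0 : ∀ n ω i, Y n ω i i = 0) (t : ℂ) :
    Tendsto (fun n => charFun (diagLaw (P n) (Y n)) t) atTop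
      (𝓝 (charFun (gaussianLaw μ) t)) := by
  rw [charFun_gaussianLaw hξ.mu_nonneg hξ.mu_le_one]
  set v : ℝ := μ * t.re ^ 2 + (1 - μ) * t.im ^ 2 with hvdef
  have hv : 0 ≤ v := add_nonneg (mul_nonneg hξ.mu_nonneg (sq_nonneg _))
    (mul_nonneg (sub_nonneg.2 hξ.mu_le_one) (sq_nonneg _))
  have l1 := tendsto_mul_norm_charFun_sub_exp hξ.memLp₁ hξ.mean₁ hξ.re_sq₁ hξ.im_sq₁ hξ.re_im₁₁ t
  have l2 := tendsto_mul_norm_charFun_sub_exp hξ.memLp₂ hξ.mean₂ hξ.re_sq₂ hξ.im_sq₂ hξ.re_im₂₂ t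
  have l3 : Tendsto (fun n : ℕ => ‖1 - Complex.exp (-(v : ℂ) / 2 / n)‖) atTop (𝓝 0) := by
    have h := (Complex.continuous_exp.tendsto 0).comp
      (tendsto_const_div_atTop_nhds_zero_nat (-(v : ℂ) / 2))
    have h2 := (h.const_sub 1).norm
    simpa using h2
  have l := (l1.add l2).add l3
  simp only [add_zero] at l
  refine tendsto_iff_norm_sub_tendsto_zero.2 (squeeze_zero' (Eventually.of_forall fun n =>
    norm_nonneg _) ?_ l)
  filter_upwards [eventually_ne_atTop 0] with n hn
  have hn0 : (n : ℂ) ≠ 0 := by exact_mod_cast hn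
  have hn1 : (0 : ℝ) < n := by exact_mod_cast Nat.pos_of_ne_zero hn
  rw [charFun_diagLaw (hY n).measurable_entry]
  have e : Complex.exp (-(v : ℂ) / 2) =
      (n : ℂ)⁻¹ * ∑ _k : Fin n, Complex.exp (-(v : ℂ) / 2) := by
    simp [hn0]
  rw [e, ← mul_sub, ← Finset.sum_sub_distrib, norm_mul, norm_inv, Complex.norm_natCast,
    inv_mul_le_iff₀ hn1]
  refine (norm_sum_le _ _).trans ((Finset.sum_le_sum fun k _ =>
    (hY n).norm_charFun_map_laplacian_sub_le hξ (h0 n) k t hv).trans_eq ?_)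
  rw [Finset.sum_const, Finset.card_univ, Fintype.card_fin, nsmul_eq_mul]

/-- The averaged law of the diagonal entries of the Laplacian converges weakly to the Gaussian
law. -/
theorem tendsto_integral_diagLaw (hξ : IsFamily P₀ μ γ ξ₁ ξ₂)
    (hY : ∀ n, IsElliptic P₀ ξ₁ ξ₂ (P n) (Y n)) (h0 : ∀ n ω i, Y n ω i i = 0) {f : ℂ → ℂ}
    (hf : Continuous f) {C : ℝ} (hC : ∀ g, ‖f g‖ ≤ C) :
    Tendsto (fun n => ∫ g, f g ∂(diagLaw (P n) (Y n))) atTop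
      (𝓝 (∫ g, f g ∂(gaussianLaw μ))) := by
  -- `diagLaw` is the zero measure for `n = 0`, hence the shift of the index
  let ρ : ℕ → ProbabilityMeasure ℂ := fun n => ⟨diagLaw (P (n + 1)) (Y (n + 1)),
    isProbabilityMeasure_diagLaw (hY (n + 1)).measurable_entry n.succ_ne_zero⟩
  let ρ₀ : ProbabilityMeasure ℂ := ⟨gaussianLaw μ, inferInstance⟩
  have h1 : Tendsto ρ atTop (𝓝 ρ₀) := ProbabilityMeasure.tendsto_of_tendsto_charFun fun t =>
    (tendsto_charFun_diagLaw hξ hY h0 t).comp (tendsto_add_atTop_nat 1)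
  have h2 := (ProbabilityMeasure.tendsto_iff_forall_integral_rclike_tendsto ℂ).1 h1
    (BoundedContinuousFunction.ofNormedAddCommGroup f hf C hC)
  exact (tendsto_add_atTop_iff_nat 1).1 h2

omit [IsProbabilityMeasure P₀] in
/-- With the truncation level `K = n ^ (1/4)`, the error in the approximate fixed point equation
vanishes as `n → ∞`. -/
lemma tendsto_schurError (hξ : IsFamily P₀ μ γ ξ₁ ξ₂) (c : ℝ) :
    Tendsto (fun n : ℕ => schurError c (tailMoment P₀ ξ₁ ξ₂ √√n) √√n n) atTop (𝓝 0) := by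
  have hs : Tendsto (fun n : ℕ => √(n : ℝ)) atTop atTop :=
    Real.tendsto_sqrt_atTop.comp tendsto_natCast_atTop_atTop
  have hss : Tendsto (fun n : ℕ => √√(n : ℝ)) atTop atTop := Real.tendsto_sqrt_atTop.comp hs
  have hτ : Tendsto (fun n : ℕ => tailMoment P₀ ξ₁ ξ₂ √√n) atTop (𝓝 0) :=
    hξ.tendsto_tailMoment.comp hss
  have i1 : Tendsto (fun n : ℕ => (√(n : ℝ))⁻¹) atTop (𝓝 0) := tendsto_inv_atTop_zero.comp hs
  have i2 : Tendsto (fun n : ℕ => (√√(n : ℝ))⁻¹) atTop (𝓝 0) := tendsto_inv_atTop_zero.comp hss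
  have i3 : Tendsto (fun n : ℕ => (n : ℝ)⁻¹) atTop (𝓝 0) := tendsto_inv_atTop_nhds_zero_nat
  have e1 : ∀ n : ℕ, √√(n : ℝ) / √n = (√√n)⁻¹ := fun n => Real.sqrt_div_self'.trans (one_div _)
  have e2 : ∀ n : ℕ, √√(n : ℝ) / n = (√√n)⁻¹ * (√n)⁻¹ := fun n => by
    rw [← e1, div_mul_eq_mul_div, ← div_eq_mul_inv, div_div, Real.mul_self_sqrt n.cast_nonneg]
  have hg : Continuous fun p : ℝ × ℝ × ℝ × ℝ => c⁻¹ ^ 2 * √(p.1 * p.2.1 + p.2.2.1) +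
      4 * (c⁻¹ ^ 2 * (2 * c⁻¹ * (p.1 + p.2.1 + p.2.2.1) + c⁻¹ * p.2.2.2 +
        8 * c⁻¹ ^ 2 * p.2.1 + 8 * c⁻¹ ^ 2 * p.2.1)) := by fun_prop
  have h := (hg.tendsto (0, 0, 0, 0)).comp (i2.prodMk_nhds (i1.prodMk_nhds (hτ.prodMk_nhds i3)))
  simp only [mul_zero, add_zero, Real.sqrt_zero] at h
  refine h.congr fun n => ?_
  simp only [Function.comp_apply, schurError]
  rw [e2, add_div, e1]
  simp only [div_eq_mul_inv, one_mul]

/-- The inverse of the matrix in the fixed point equation is a Lipschitz function of the parameters,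
uniformly in the Gaussian variable. -/
lemma norm_inv_fixedPointMat_sub_le {z η α β δ α' β' δ' : ℂ} (hη : 0 < η.im) (hγ : |γ| ≤ 1)
    (h : ‖δ - conj β‖ ≤ 2 * α.im) (h' : ‖δ' - conj β'‖ ≤ 2 * α'.im) (g : ℂ) (s t : Fin 2) :
    ‖(fixedPointMat γ (qMat z η) α β δ g)⁻¹ s t - (fixedPointMat γ (qMat z η) α' β' δ' g)⁻¹ s t‖ ≤
      η.im⁻¹ * η.im⁻¹ * (2 * ‖α' - α‖ + ‖δ' - δ‖ + ‖β' - β‖) := by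
  set F := fixedPointMat γ (qMat z η) α β δ g with hF
  set F' := fixedPointMat γ (qMat z η) α' β' δ' g with hF'
  have hu : IsUnit F.det := isUnit_det_fixedPointMat hη hγ h g
  have hu' : IsUnit F'.det := isUnit_det_fixedPointMat hη hγ h' g
  have h1 : F⁻¹ - F'⁻¹ = F⁻¹ * (F' - F) * F'⁻¹ := by
    rw [mul_sub, sub_mul, Matrix.nonsing_inv_mul _ hu, one_mul, mul_assoc,
      Matrix.mul_nonsing_inv _ hu', mul_one]
  have h2 : F' - F = !![α' - α, γ * (δ' - δ); γ * (β' - β), α' - α] := by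
    ext s t
    simp only [hF, hF', fixedPointMat]
    fin_cases s <;> fin_cases t <;> simp <;> ring
  rw [← Matrix.sub_apply, h1]
  refine (norm_triple_mul_apply_le (inv_nonneg.2 hη.le)
    (fun s t => norm_inv_fixedPointMat_apply_le hη hγ h g s t)
    (fun s t => norm_inv_fixedPointMat_apply_le hη hγ h' g s t) s t).trans ?_
  have h3 : ∀ x : ℂ, ‖(γ : ℂ) * x‖ ≤ ‖x‖ := fun x => by
    rw [norm_mul, Complex.norm_real]
    exact mul_le_of_le_one_left (norm_nonneg _) hγ
  refine mul_le_mul_of_nonneg_left ?_ (by positivity)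
  rw [h2]
  simp only [Fin.sum_univ_two, Matrix.of_apply, Matrix.cons_val', Matrix.cons_val_zero,
    Matrix.cons_val_one, Matrix.cons_val_fin_one]
  linarith [h3 (δ' - δ), h3 (β' - β)]

/-- The limit along a subsequence of the approximate fixed point equation. -/
theorem fixedPoint_of_tendsto (hξ : IsFamily P₀ μ γ ξ₁ ξ₂)
    (hY : ∀ n, IsElliptic P₀ ξ₁ ξ₂ (P n) (Y n)) (h0 : ∀ n ω i, Y n ω i i = 0) (z : ℂ) {η : ℂ}
    (hη : 0 < η.im) {A : Matrix (Fin 2) (Fin 2) ℂ} {E : ℕ → Matrix (Fin 2) (Fin 2) ℂ}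
    (hE : ∀ n, E n = expectation (P n) fun ω => avgBlock (laplacian (Y n ω)) (qMat z η))
    {ψ : ℕ → ℕ} (hψ : StrictMono ψ) (hA : ∀ s t, Tendsto (fun n => E (ψ n) s t) atTop (𝓝 (A s t)))
    (hAb : ‖A 1 0 - conj (A 0 1)‖ ≤ 2 * (A 0 0).im) (s t : Fin 2) :
    A s t = -∫ g, (fixedPointMat γ (qMat z η) (A 0 0) (A 0 1) (A 1 0) g)⁻¹ s t
      ∂(gaussianLaw μ) := by
  have hγ := hξ.abs_gamma_le
  let ρ := fun n => diagLaw (P n) (Y n)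
  let F : Matrix (Fin 2) (Fin 2) ℂ → ℂ → ℂ := fun E g =>
    (fixedPointMat γ (qMat z η) (E 0 0) (E 0 1) (E 1 0) g)⁻¹ s t
  have hEb : ∀ n, ‖E n 1 0 - conj (E n 0 1)‖ ≤ 2 * (E n 0 0).im := fun n => by
    rw [hE]; exact norm_expectation_avgBlock_sub_le z hη (hY n).measurable_entry
  have hψt := hψ.tendsto_atTop
  have l1 : Tendsto (fun n => E (ψ n) s t + ∫ g, F (E (ψ n)) g ∂(ρ (ψ n))) atTop (𝓝 0) := by
    refine squeeze_zero_norm' ?_ ((tendsto_schurError hξ η.im).comp hψt)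
    filter_upwards [hψt.eventually_ne_atTop 0] with n hn
    exact (hY _).norm_expectation_add_integral_le z hξ (h0 _) hη hn (Real.sqrt_nonneg _) (hE _) s t
  have l2 : Tendsto (fun n => ∫ g, F A g ∂(ρ (ψ n)) - ∫ g, F (E (ψ n)) g ∂(ρ (ψ n))) atTop
      (𝓝 0) := by
    have hd : Tendsto (fun n => η.im⁻¹ * η.im⁻¹ * (2 * ‖E (ψ n) 0 0 - A 0 0‖ +
        ‖E (ψ n) 1 0 - A 1 0‖ + ‖E (ψ n) 0 1 - A 0 1‖)) atTop (𝓝 0) := by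
      have := ((((hA 0 0).sub_const (A 0 0)).norm.const_mul 2).add
        ((hA 1 0).sub_const (A 1 0)).norm).add ((hA 0 1).sub_const (A 0 1)).norm
      simpa using this.const_mul (η.im⁻¹ * η.im⁻¹)
    refine squeeze_zero_norm' ?_ hd
    filter_upwards [hψt.eventually_ne_atTop 0] with n hn
    have hp : IsProbabilityMeasure (ρ (ψ n)) :=
      isProbabilityMeasure_diagLaw (hY _).measurable_entry hn
    have hi : ∀ E : Matrix (Fin 2) (Fin 2) ℂ, ‖E 1 0 - conj (E 0 1)‖ ≤ 2 * (E 0 0).im →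
        Integrable (F E) (ρ (ψ n)) := fun E hE => Integrable.of_bound
      (continuous_inv_fixedPointMat_apply z hη hγ hE s t).aestronglyMeasurable _
      (ae_of_all _ fun g => norm_inv_fixedPointMat_apply_le hη hγ hE g s t)
    rw [← integral_sub (hi _ hAb) (hi _ (hEb _))]
    refine (norm_integral_le_of_norm_le_const (ae_of_all _ fun g =>
      norm_inv_fixedPointMat_sub_le hη hγ hAb (hEb _) g s t)).trans_eq ?_
    simp
  have l3 : Tendsto (fun n => ∫ g, F A g ∂(ρ (ψ n))) atTop (𝓝 (∫ g, F A g ∂(gaussianLaw μ))) :=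
    (tendsto_integral_diagLaw hξ hY h0 (continuous_inv_fixedPointMat_apply z hη hγ hAb s t)
      fun g => norm_inv_fixedPointMat_apply_le hη hγ hAb g s t).comp hψt
  have l4 := ((l1.add l2).sub l3)
  have l5 := (hA s t).congr (f₂ := fun n => E (ψ n) s t + ∫ g, F (E (ψ n)) g ∂(ρ (ψ n)) +
    (∫ g, F A g ∂(ρ (ψ n)) - ∫ g, F (E (ψ n)) g ∂(ρ (ψ n))) - ∫ g, F A g ∂(ρ (ψ n)))
    fun n => by ring
  simpa using tendsto_nhds_unique l5 l4

end Limit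

end EllipticLaplacian

/-! ### The fixed point equation for the accumulation points -/

theorem mainTheorem3 {Ω₀ : Type*} [MeasurableSpace Ω₀] (P₀ : Measure Ω₀) [IsProbabilityMeasure P₀]
    (μ γ : ℝ) (ξ₁ ξ₂ : Ω₀ → ℂ) (hξ : EllipticLaplacian.IsFamily P₀ μ γ ξ₁ ξ₂)
    {Ω : ℕ → Type*} [∀ n, MeasurableSpace (Ω n)] (P : ∀ n, Measure (Ω n))
    [∀ n, IsProbabilityMeasure (P n)]
    (X : ∀ n, Ω n → Matrix (Fin n) (Fin n) ℂ)
    (hX : ∀ n, EllipticLaplacian.IsElliptic P₀ ξ₁ ξ₂ (P n) (X n))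
    (z η : ℂ) (hη : 0 < η.im)
    (q : Matrix (Fin 2) (Fin 2) ℂ) (hq : q = EllipticLaplacian.qMat z η)
    (Γ : ∀ n, Ω n → Matrix (Fin 2) (Fin 2) ℂ)
    (hΓ : ∀ n ω, Γ n ω =
      EllipticLaplacian.avgBlock (EllipticLaplacian.laplacian (X n ω)) q) :
    (∀ n,
      (∀ ω, IsUnit (EllipticLaplacian.shifted (EllipticLaplacian.laplacian (X n ω)) q).det ∧
        Γ n ω 1 1 = Γ n ω 0 0 ∧ (η.re = 0 → Γ n ω 1 0 = conj (Γ n ω 0 1))) ∧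
      ∀ i j, Integrable (fun ω => Γ n ω i j) (P n)) ∧
    ∀ A : Matrix (Fin 2) (Fin 2) ℂ,
      MapClusterPt A atTop (fun n => EllipticLaplacian.expectation (P n) (Γ n)) →
      ∃ α β δ : ℂ, A = !![α, β; δ, α] ∧ (η.re = 0 → δ = conj β) ∧
        (∀ g, IsUnit (EllipticLaplacian.fixedPointMat γ q α β δ g).det) ∧
        (∀ i j, Integrable (fun g => (EllipticLaplacian.fixedPointMat γ q α β δ g)⁻¹ i j)
          (EllipticLaplacian.gaussianLaw μ)) ∧
        !![α, β; δ, α] = -EllipticLaplacian.expectation (EllipticLaplacian.gaussianLaw μ)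
          (fun g => (EllipticLaplacian.fixedPointMat γ q α β δ g)⁻¹) := by
  subst hq
  obtain rfl : Γ = fun n ω => EllipticLaplacian.avgBlock (EllipticLaplacian.laplacian (X n ω))
    (EllipticLaplacian.qMat z η) := funext fun n => funext fun ω => hΓ n ω
  refine ⟨fun n => ⟨fun ω => ⟨EllipticLaplacian.isUnit_det_shifted _ z hη,
    EllipticLaplacian.avgBlock_one_one _ z hη, EllipticLaplacian.avgBlock_one_zero _ z hη⟩,
    EllipticLaplacian.integrable_avgBlock_laplacian_apply z hη (hX n).measurable_entry⟩,
    fun A hA => ?_⟩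
  have : FirstCountableTopology (Matrix (Fin 2) (Fin 2) ℂ) :=
    inferInstanceAs (FirstCountableTopology (Fin 2 → Fin 2 → ℂ))
  obtain ⟨ψ, hψ, hlim⟩ := hA.tendsto_subseq
  let E : ℕ → Matrix (Fin 2) (Fin 2) ℂ := fun n => EllipticLaplacian.expectation (P n) fun ω =>
    EllipticLaplacian.avgBlock (EllipticLaplacian.laplacian (X n ω)) (EllipticLaplacian.qMat z η)
  have hent : ∀ s t, Tendsto (fun n => E (ψ n) s t) atTop (𝓝 (A s t)) := fun s t =>
    ((continuous_id.matrix_elem s t).tendsto A).comp hlim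
  -- the relations between the entries of the averaged block pass to the limit
  have h11 : A 1 1 = A 0 0 := tendsto_nhds_unique (hent 1 1)
    ((hent 0 0).congr fun n => (EllipticLaplacian.expectation_avgBlock_one_one z hη).symm)
  have h10 : η.re = 0 → A 1 0 = conj (A 0 1) := fun h0 => tendsto_nhds_unique (hent 1 0)
    (((Complex.continuous_conj.tendsto _).comp (hent 0 1)).congr fun n => by
      simp only [E, Function.comp_apply, EllipticLaplacian.expectation, Matrix.of_apply,
        EllipticLaplacian.avgBlock_one_zero _ z hη h0]
      exact integral_conj.symm)
  have hAb : ‖A 1 0 - conj (A 0 1)‖ ≤ 2 * (A 0 0).im :=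
    le_of_tendsto_of_tendsto'
      ((hent 1 0).sub ((Complex.continuous_conj.tendsto _).comp (hent 0 1))).norm
      (((Complex.continuous_im.tendsto _).comp (hent 0 0)).const_mul 2)
      fun n => EllipticLaplacian.norm_expectation_avgBlock_sub_le z hη (hX _).measurable_entry
  have hA2 : A = !![A 0 0, A 0 1; A 1 0, A 0 0] := by
    ext s t
    fin_cases s <;> fin_cases t <;> simp [h11]
  have hγ := hξ.abs_gamma_le
  have hfix := EllipticLaplacian.fixedPoint_of_tendsto (Y := fun n ω =>
    EllipticLaplacian.zeroDiag (X n ω)) hξ (fun n => (hX n).zeroDiag)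
    (fun n ω i => by simp [EllipticLaplacian.zeroDiag_apply]) z hη (E := E)
    (fun n => by simp only [E, EllipticLaplacian.laplacian_zeroDiag]) hψ hent hAb
  refine ⟨A 0 0, A 0 1, A 1 0, hA2, h10,
    fun g => EllipticLaplacian.isUnit_det_fixedPointMat hη hγ hAb g, fun s t => ?_, ?_⟩
  · exact Integrable.of_bound
      (EllipticLaplacian.continuous_inv_fixedPointMat_apply z hη hγ hAb s t).aestronglyMeasurable _
      (ae_of_all _ fun g => EllipticLaplacian.norm_inv_fixedPointMat_apply_le hη hγ hAb g s t)
  · rw [← hA2]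
    ext s t
    rw [Matrix.neg_apply, EllipticLaplacian.expectation, Matrix.of_apply]
    exact hfix s t
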